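/- Let $\mathcal G$ be the set consisting of the free generators of a free group of finite rank at least $2$ and of their inverses, and let $g=|\mathcal G|\ge 4$; write $\bar a$ for the inverse of a letter $a$. A finite or infinite sequence with entries in $\mathcal G$ is *reduced* if no two adjacent entries are inverse to each other. A *joinable string* of length $n$ is a word $\alpha=a_1\cdots a_n$ all of whose cyclic permutations are reduced; $\sigma$ denotes the cyclic shift $\sigma(a_1a_2\cdots a_n)=a_2\cdots a_na_1$. A *necklace* of length $n$ is an equivalence class of joinable strings of length $n$ under cyclic permutation. Let $\lambda_n$ be the uniform distribution on the joinable strings of length $n$, and $\mu_n$ the uniform distribution on the necklaces of length $n$. Let $h_k$ $(k\ge 1)$ be real-valued functions of pairs of reduced sequences (finite or infinite) such that - (H0) each $h_k$ is symmetric; - (H1) there is $C<\infty$ with $|h_k|\le C$ for all $k\ge1$; - (H2) on pairs of sequences of length at least $k$, $h_k$ depends only on the first $k$ entries of each of its arguments; - (H3) there are $C<\infty$ and $0<\beta<1$ such that $E_{\lambda_n}|h_k(\alpha,\sigma^i\alpha)|\le C\beta^k$ for all $n\ge k\ge1$ and $1\le i<n$. For a necklace $\alpha$ of length $n$, unhook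 it at an arbitrary place to get a joinable string $\alpha^*$ and put $$N(\alpha)=\sum_{1\le i<j\le n}\ \sum_{k=1}^{n}h_k(\sigma^i\alpha^*,\sigma^j\alpha^*),$$ which by (H0) does not depend on the place. Let $\nu$ be the law, on infinite reduced sequences, of the stationary Markov chain $\mathbf X=X_1X_2\cdots$ on $\mathcal G$ with uniform initial distribution and transition probabilities $p(a,b)=1/(g-1)$ if $b\ne\bar a$ and $p(a,\bar a)=0$. Let $\tau$ be the forward shift, and let $H_k(\mathbf x)=E\,h_k(\mathbf x,\mathbf X)$ be the Hoeffding projection of $h_k$. Then $\sum_{k\ge1}EH_k(\mathbf X)$ converges, the series $\sum_{k\ge1}H_k(\mathbf x)$ converges for $\nu$-almost every $\mathbf x$, the random variables $\sum_{i=1}^n\sum_{k\ge1}H_k(\tau^i\mathbf X)$ are square integrable for every $n$, and with $$\kappa=\frac12\sum_{k=1}^\infty EH_k(\mathbf X),\qquad \sigma^2=\lim_{n\to\infty}\frac1n\,E\Bigl(\sum_{i=1}^n\sum_{k=1}^\infty H_k(\tau^i\mathbf X)-2n\kappa\Bigr)^2,$$ where the limit exists and is finite, the distribution of $(N(\alpha)-\kappa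 n^2)/n^{3/2}$ under $\mu_n$ converges weakly, as $n\to\infty$, to the normal distribution with mean $0$ and variance $\sigma^2$ (the point mass at $0$ if $\sigma^2=0$). -/

import Mathlib

open MeasureTheory ProbabilityTheory Filter Topology
open scoped NNReal ENNReal

/-! ### Letters and reduced words -/

/-- The letters: a generator `x_i` is `(i, true)` and its inverse is `(i, false)`. There are
`g = 2 * card ι` of them. -/
def Letter (ι : Type*) : Type _ := ι × Bool

namespace Letter

variable {ι : Type*}

instance [Finite ι] : Finite (Letter ι) := inferInstanceAs (Finite (ι × Bool))

instance [Nonempty ι] : Nonempty (Letter ι) := inferInstanceAs (Nonempty (ι × Bool))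

instance : MeasurableSpace (Letter ι) := ⊤

instance : DiscreteMeasurableSpace (Letter ι) := ⟨fun _ => trivial⟩

/-- The inverse letter. -/
def bar (a : Letter ι) : Letter ι := (a.1, !a.2)

theorem ne_bar (a : Letter ι) : a ≠ a.bar := by
  intro h
  have h2 : a.2 = !a.2 := congrArg Prod.snd h
  cases hb : a.2 <;> simp [hb] at h2

end Letter

/-- A finite word is reduced if no two adjacent letters are inverse to each other. -/
def IsReducedWord {ι : Type*} {n : ℕ} (w : Fin n → Letter ι) : Prop :=
  ∀ (i : ℕ) (hi : i + 1 < n), w ⟨i + 1, hi⟩ ≠ (w ⟨i, Nat.lt_of_succ_lt hi⟩).bar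

/-- Infinite reduced sequences `x₁ x₂ x₃ …`; the letter `x_j` is `x.1 (j - 1)`. -/
abbrev InfString (ι : Type*) : Type _ :=
  {x : ℕ → Letter ι // ∀ i, x (i + 1) ≠ (x i).bar}

/-- The forward shift on infinite reduced sequences. -/
def InfString.shift {ι : Type*} (x : InfString ι) : InfString ι :=
  ⟨fun j => x.1 (j + 1), fun i => x.2 (i + 1)⟩

/-- Reduced sequences, finite or infinite. -/
inductive ReducedSeq (ι : Type*) : Type _
  | finite {n : ℕ} (w : Fin n → Letter ι) (hw : IsReducedWord w) : ReducedSeq ι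
  | infinite (x : InfString ι) : ReducedSeq ι

namespace ReducedSeq

variable {ι : Type*}

/-- The length of a reduced sequence. -/
def length : ReducedSeq ι → ℕ∞
  | @finite _ n _ _ => n
  | infinite _ => ⊤

/-- The entry in position `j` (counted from `0`), if there is one. -/
def entry : ReducedSeq ι → ℕ → Option (Letter ι)
  | @finite _ n w _, j => if hj : j < n then some (w ⟨j, hj⟩) else none
  | infinite x, j => some (x.1 j)

end ReducedSeq

/-! ### Joinable strings and necklaces -/

/-- The cyclic shift `a₁ a₂ … aₙ ↦ a₂ … aₙ a₁`. -/
def cyclicShift {ι : Type*} {n : ℕ} (w : Fin n → Letter ι) : Fin n → Letter ι :=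
  fun j => w (finRotate n j)

/-- Joinable strings of length `n`: every cyclic permutation is reduced. -/
def JoinableString (ι : Type*) (n : ℕ) : Type _ :=
  {w : Fin n → Letter ι // ∀ i : ℕ, IsReducedWord (cyclicShift^[i] w)}

namespace JoinableString

variable {ι : Type*} {n : ℕ}

instance [Finite ι] : Finite (JoinableString ι n) :=
  inferInstanceAs (Finite {w : Fin n → Letter ι // ∀ i : ℕ, IsReducedWord (cyclicShift^[i] w)})

instance [Nonempty ι] : Nonempty (JoinableString ι n) := by
  obtain ⟨a⟩ := (inferInstance : Nonempty (Letter ι))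
  refine ⟨⟨fun _ => a, fun i => ?_⟩⟩
  have h : cyclicShift^[i] (fun _ : Fin n => a) = fun _ => a :=
    Function.iterate_fixed rfl i
  rw [h]
  exact fun _ _ => a.ne_bar

instance : MeasurableSpace (JoinableString ι n) := ⊤

instance : DiscreteMeasurableSpace (JoinableString ι n) := ⟨fun _ => trivial⟩

/-- The cyclic shift `σ` on joinable strings. -/
def shift (w : JoinableString ι n) : JoinableString ι n :=
  ⟨cyclicShift w.1, fun i => w.2 (i + 1)⟩

/-- A joinable string as a reduced sequence. -/
def toSeq (w : JoinableString ι n) : ReducedSeq ι := .finite w.1 (w.2 0)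

theorem shift_val_iterate (w : JoinableString ι n) (i : ℕ) :
    (shift^[i] w).1 = cyclicShift^[i] w.1 := by
  induction i generalizing w with
  | zero => rfl
  | succ i ih => rw [Function.iterate_succ_apply, Function.iterate_succ_apply, ih]; rfl

theorem shift_iterate_length (w : JoinableString ι n) : shift^[n] w = w := by
  have key : ∀ (i : ℕ) (v : Fin n → Letter ι), cyclicShift^[i] v = v ∘ (finRotate n)^[i] := by
    intro i
    induction i with
    | zero => intro v; rfl
    | succ i ih =>
      intro v
      rw [Function.iterate_succ_apply, ih]
      funext j
      simp only [Function.comp_apply, cyclicShift]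
      rw [← Function.iterate_succ_apply' (finRotate n)]
  refine Subtype.ext ?_
  rw [shift_val_iterate, key]
  funext j
  have : (finRotate n)^[n] j = j := by
    rcases n with _ | m
    · rfl
    · have h : ∀ i : ℕ, ((finRotate (m + 1))^[i] j).val = (j.val + i) % (m + 1) := by
        intro i
        induction i with
        | zero => simp [Nat.mod_eq_of_lt j.isLt]
        | succ i ih =>
          rw [Function.iterate_succ_apply', finRotate_apply, Fin.val_add, ih, Fin.val_one',
            ← Nat.add_mod, Nat.add_assoc]
      refine Fin.ext ?_
      rw [h, Nat.add_mod_right, Nat.mod_eq_of_lt j.isLt]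
  simp [this]

/-- Two joinable strings are equivalent if one is a cyclic permutation of the other. -/
instance rotationSetoid (ι : Type*) (n : ℕ) : Setoid (JoinableString ι n) where
  r w w' := ∃ i : ℕ, w' = shift^[i] w
  iseqv := by
    refine ⟨fun w => ⟨0, rfl⟩, ?_, ?_⟩
    · rintro w _ ⟨i, rfl⟩
      refine ⟨(n - 1) * i, ?_⟩
      rw [← Function.iterate_add_apply]
      rcases n with _ | m
      · exact Subtype.ext (funext fun j => j.elim0)
      · have : (m + 1 - 1) * i + i = (m + 1) * i := by simp; ring
        rw [this, Function.iterate_mul, Function.iterate_fixed (shift_iterate_length w)]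
    · rintro w _ _ ⟨i, rfl⟩ ⟨j, rfl⟩
      exact ⟨j + i, by rw [Function.iterate_add_apply]⟩

end JoinableString

/-- Necklaces (reduced cyclic words) of length `n`. -/
def Necklace (ι : Type*) (n : ℕ) : Type _ := Quotient (JoinableString.rotationSetoid ι n)

namespace Necklace

variable {ι : Type*} {n : ℕ}

instance [Finite ι] : Finite (Necklace ι n) :=
  inferInstanceAs (Finite (Quotient (JoinableString.rotationSetoid ι n)))

instance [Nonempty ι] : Nonempty (Necklace ι n) :=
  ⟨Quotient.mk _ (Classical.arbitrary (JoinableString ι n))⟩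

instance : MeasurableSpace (Necklace ι n) := ⊤

instance : DiscreteMeasurableSpace (Necklace ι n) := ⟨fun _ => trivial⟩

end Necklace

/-- The uniform distribution on joinable strings of length `n`. -/
noncomputable def joinableUniform (ι : Type*) (n : ℕ) : Measure (JoinableString ι n) :=
  uniformOn Set.univ

/-- The uniform distribution on necklaces of length `n`. -/
noncomputable def necklaceUniform (ι : Type*) (n : ℕ) : Measure (Necklace ι n) :=
  uniformOn Set.univ

instance {ι : Type*} [Finite ι] [Nonempty ι] (n : ℕ) :
    IsProbabilityMeasure (necklaceUniform ι n) :=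
  isProbabilityMeasure_uniformOn Set.finite_univ Set.univ_nonempty

/-! ### Kernels -/

/-- A sequence of real-valued kernels `h k`, on pairs of reduced sequences. Only the kernels with
`1 ≤ k` are ever used. -/
abbrev KernelFamily (ι : Type*) := ℕ → ReducedSeq ι → ReducedSeq ι → ℝ

namespace KernelFamily

variable {ι : Type*} (h : KernelFamily ι)

/-- Each kernel is symmetric. -/
def IsSymm : Prop :=
  ∀ k, 1 ≤ k → ∀ ω ω', h k ω ω' = h k ω' ω

/-- The kernels are uniformly bounded. -/
def IsBounded : Prop :=
  ∃ C : ℝ, ∀ k, 1 ≤ k → ∀ ω ω', |h k ω ω'| ≤ C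

/-- On sequences of length at least `k`, the kernel `h k` depends only on the first `k` entries of
each of its arguments. -/
def IsLocal : Prop :=
  ∀ k : ℕ, 1 ≤ k → ∀ ω₁ ω₁' ω₂ ω₂' : ReducedSeq ι,
    (k : ℕ∞) ≤ ω₁.length → (k : ℕ∞) ≤ ω₁'.length → (k : ℕ∞) ≤ ω₂.length → (k : ℕ∞) ≤ ω₂'.length →
    (∀ j < k, ω₁.entry j = ω₂.entry j) → (∀ j < k, ω₁'.entry j = ω₂'.entry j) →
    h k ω₁ ω₁' = h k ω₂ ω₂'

/-- The means of `|h k (α, σⁱα)|` for a uniformly random joinable string `α` of length `n ≥ k`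
decay exponentially in `k`, uniformly in `n` and in `1 ≤ i < n`. -/
def HasExpDecay : Prop :=
  ∃ C β : ℝ, 0 < β ∧ β < 1 ∧ ∀ n k i : ℕ, 1 ≤ k → k ≤ n → 1 ≤ i → i < n →
    ∫ α, |h k α.toSeq (JoinableString.shift^[i] α).toSeq| ∂(joinableUniform ι n) ≤ C * β ^ k

/-- `N(α) = ∑_{1 ≤ i < j ≤ n} ∑_{k=1}^n h k (σⁱα, σʲα)` for a joinable string `α` of length `n`. -/
def joinableCount {n : ℕ} (α : JoinableString ι n) : ℝ :=
  ∑ i ∈ Finset.Icc 1 n, ∑ j ∈ Finset.Icc (i + 1) n, ∑ k ∈ Finset.Icc 1 n,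
    h k (JoinableString.shift^[i] α).toSeq (JoinableString.shift^[j] α).toSeq

theorem joinableCount_shift {h : KernelFamily ι} (hs : h.IsSymm) {n : ℕ}
    (α : JoinableString ι n) : h.joinableCount α.shift = h.joinableCount α := by
  set f : ℕ → ℕ → ℝ := fun i j => ∑ k ∈ Finset.Icc 1 n,
    h k (JoinableString.shift^[i] α).toSeq (JoinableString.shift^[j] α).toSeq with hf
  have hsymm : ∀ i j, f i j = f j i := fun i j =>
    Finset.sum_congr rfl fun k hk => hs k (Finset.mem_Icc.1 hk).1 _ _
  have hper : ∀ i, f i (n + 1) = f i 1 := by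
    intro i
    simp only [hf]
    rw [Nat.add_comm n 1, Function.iterate_add_apply, α.shift_iterate_length]
  have e1 : h.joinableCount α = ∑ i ∈ Finset.Icc 1 n, ∑ j ∈ Finset.Icc (i + 1) n, f i j := rfl
  have e2 : h.joinableCount α.shift =
      ∑ i ∈ Finset.Icc 1 n, ∑ j ∈ Finset.Icc (i + 1) n, f (i + 1) (j + 1) := rfl
  rw [e1, e2]
  have head : ∀ (a : ℕ → ℝ) (m : ℕ), ∑ i ∈ Finset.Icc 1 (m + 1), a i =
      a 1 + ∑ i ∈ Finset.Icc 1 m, a (i + 1) := by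
    intro a m
    induction m with
    | zero => simp
    | succ m ih =>
      rw [Finset.sum_Icc_succ_top (by omega), ih,
        Finset.sum_Icc_succ_top (by omega : 1 ≤ m + 1)]
      ring
  have last : ∀ (F : ℕ → ℕ → ℝ) (m : ℕ),
      ∑ i ∈ Finset.Icc 1 (m + 1), ∑ j ∈ Finset.Icc (i + 1) (m + 1), F i j =
        ∑ i ∈ Finset.Icc 1 m, ∑ j ∈ Finset.Icc (i + 1) m, F i j +
          ∑ i ∈ Finset.Icc 1 m, F i (m + 1) := by
    intro F m
    rw [Finset.sum_Icc_succ_top (by omega), ← Finset.sum_add_distrib]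
    simp only [Finset.Icc_eq_empty_of_lt (Nat.lt_succ_self (m + 1)), Finset.sum_empty, add_zero]
    refine Finset.sum_congr rfl fun i hi => ?_
    rw [Finset.sum_Icc_succ_top (by have := (Finset.mem_Icc.1 hi).2; omega)]
  have main : ∀ m : ℕ,
      ∑ i ∈ Finset.Icc 1 m, ∑ j ∈ Finset.Icc (i + 1) m, f (i + 1) (j + 1) +
          ∑ j ∈ Finset.Icc 1 m, f 1 (j + 1) =
        ∑ i ∈ Finset.Icc 1 m, ∑ j ∈ Finset.Icc (i + 1) m, f i j +
          ∑ i ∈ Finset.Icc 1 m, f i (m + 1) := by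
    intro m
    induction m with
    | zero => simp
    | succ m ih =>
      rw [last (fun i j => f (i + 1) (j + 1)), last f, head (fun i => f i (m + 1 + 1)),
        Finset.sum_Icc_succ_top (by omega : 1 ≤ m + 1) (fun j => f 1 (j + 1))]
      linarith
  have h1 := head (fun j => f 1 j) n
  rw [Finset.sum_Icc_succ_top (by omega), hper] at h1
  have h2 : ∑ i ∈ Finset.Icc 1 n, f i (n + 1) = ∑ j ∈ Finset.Icc 1 n, f 1 j :=
    Finset.sum_congr rfl fun i _ => by rw [hper, hsymm]
  have h3 := main n
  rw [h2] at h3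
  linarith

/-- `N` on necklaces: unhook at an arbitrary place. -/
def necklaceCount (hs : h.IsSymm) {n : ℕ} : Necklace ι n → ℝ :=
  Quotient.lift (fun α => h.joinableCount α) (by
    rintro α _ ⟨i, rfl⟩
    induction i with
    | zero => rfl
    | succ i ih => rw [Function.iterate_succ_apply', joinableCount_shift hs]; exact ih)

end KernelFamily

/-! ### The stationary Markov chain of reduced sequences -/

/-- One step of the chain: from `a`, go to a uniformly chosen letter different from `a⁻¹`. -/
noncomputable def stepMeasure {ι : Type*} (a : Letter ι) : Measure (Letter ι) :=
  uniformOn {b | b ≠ a.bar}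

instance {ι : Type*} [Finite ι] (a : Letter ι) : IsProbabilityMeasure (stepMeasure a) :=
  isProbabilityMeasure_uniformOn (Set.toFinite _) ⟨a, a.ne_bar⟩

/-- The transition kernels of the chain, as kernels on the past up to time `n`. -/
noncomputable def stepKernel (ι : Type*) [Finite ι] (n : ℕ) :
    Kernel ((_i : Finset.Iic n) → Letter ι) (Letter ι) :=
  Kernel.ofFunOfCountable fun x => stepMeasure (x ⟨n, Finset.mem_Iic.2 le_rfl⟩)

instance {ι : Type*} [Finite ι] (n : ℕ) : IsMarkovKernel (stepKernel ι n) :=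
  ⟨fun x => inferInstanceAs
    (IsProbabilityMeasure (stepMeasure (x ⟨n, Finset.mem_Iic.2 le_rfl⟩)))⟩

/-- The law on `ℕ → Letter ι` of the Markov chain with uniform initial distribution and with
transition probabilities `p(a,b) = 1/(g-1)` for `b ≠ a⁻¹`, `p(a,a⁻¹) = 0`. -/
noncomputable def chainMeasure (ι : Type*) [Finite ι] [Nonempty ι] : Measure (ℕ → Letter ι) :=
  Kernel.trajMeasure (X := fun _ => Letter ι) (uniformOn Set.univ) (stepKernel ι)

/-- The Markov measure on the space of infinite reduced sequences (the chain above is almost surely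
reduced). -/
noncomputable def markovMeasure (ι : Type*) [Finite ι] [Nonempty ι] : Measure (InfString ι) :=
  (chainMeasure ι).comap Subtype.val

/-! ### Hoeffding projections -/

namespace KernelFamily

variable {ι : Type*} [Finite ι] [Nonempty ι] (h : KernelFamily ι)

/-- The Hoeffding projection `H_k(x) = E h_k(x, X)`, where `X` is the stationary chain. -/
noncomputable def hoeffding (k : ℕ) (x : InfString ι) : ℝ :=
  ∫ y, h k (.infinite x) (.infinite y) ∂(markovMeasure ι)

/-- `∑_{k ≥ 1} H_k(x)`. -/
noncomputable def hoeffdingSum (x : InfString ι) : ℝ :=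
  ∑' k : ℕ, h.hoeffding (k + 1) x

end KernelFamily

/-!
The number of pairs counted by `N` is a U-statistic of the windows of a random cyclic word, and
the theorem is a Hoeffding decomposition together with a central limit theorem for the linear part.

*Random cyclic words.* Put `d a b = g p(a, b) - 1` (`Letter.density`). A uniformly random joinable
string of length `n` is a cyclic word drawn with weight `∏ (1 + d (w z) (w (z + 1)))`, relative to
independent uniform letters, so that its means are the `cycMean d` of the general theory
(`integral_joinableUniform`). Since `d` has mean zero in each variable, summing out a run of `ℓ`
consecutive letters replaces `∏ (1 + d)` along the run by `1 + ∏ d` (`avg_gap`), and `∏ d` has mean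
absolute value at most `2 ^ (-ℓ)` (`avg_abs_pathDefect_le`). Hence letters on arcs separated by long
gaps are nearly independent (`norm_cycMean_mixing`), and a window of the cyclic word is nearly
distributed as the stationary chain (`abs_cycMean_sub_integral_le`). All that is used of `d` is
`IsChainDensity`.

*Linearization.* The kernels are cut off at a level `K`. Those above it contribute little by their
exponential decay, which passes to the product measure (`IsKernelSeq.integral_integral_abs_le`).
The others are split into a degenerate kernel, the two Hoeffding projections and the mean. The
degenerate part has a second moment of order `n ^ 2 K ^ 4`, since four windows of which one is far
from the others have a negligible joint moment (`cycMean_sq_cycSum₂_le`), so it is lost on the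
scale `n ^ (3 / 2)`. What remains is `n` times the sum of a centred function of the first `K`
letters along the cycle (`IsKernelSeq.cycMean_abs_kernelCount_sub_le`).

*Central limit theorem.* The characteristic function `φ` of such a sum nearly satisfies
`φ' = - n v s φ`, where `v` is the sum of the nearby covariances: this is Stein's method in its
form for characteristic functions, with explicit errors, polynomial in `K` and with a factor
`2 ^ (-K)` for the dependence at a distance (`norm_cycChar_sub_le`). Taking for `K` the sixteenth
root of `n` makes all errors vanish (`IsKernelSeq.tendsto_cycMean_cexp_kernelCount`), and `v`
converges to the sum of the autocovariances of the full projection, which is also the limit of the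
normalized variances along the chain (`IsKernelSeq.tendsto_variance`).

*Necklaces.* Each necklace without rotational symmetry is the class of exactly `n` joinable
strings, and a word with a symmetry is determined by its first half, so the uniform measures on
joinable strings and on necklaces differ by an exponentially small amount
(`norm_integral_necklaceUniform_sub_le`). Lévy's continuity theorem concludes.
-/


/-! ### Uniform averages and integrating out coordinates -/

section Averages

/-- The uniform average of a function on a finite type. -/
noncomputable def avg {Ω V : Type*} [Fintype Ω] [AddCommGroup V] [Module ℝ V] (F : Ω → V) : V :=
  (Fintype.card Ω : ℝ)⁻¹ • ∑ w, F w

variable {Ω Ω' V : Type*} [Fintype Ω] [Fintype Ω'] [NormedAddCommGroup V] [NormedSpace ℝ V]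

theorem avg_add (F G : Ω → V) : avg (fun w => F w + G w) = avg F + avg G := by
  simp [avg, Finset.sum_add_distrib]

theorem avg_sub (F G : Ω → V) : avg (fun w => F w - G w) = avg F - avg G := by
  simp [avg, Finset.sum_sub_distrib, smul_sub]

theorem avg_smul (c : ℝ) (F : Ω → V) : avg (fun w => c • F w) = c • avg F := by
  simp only [avg, ← Finset.smul_sum]; rw [smul_comm]

theorem avg_smul_const (f : Ω → ℝ) (x : V) : avg (fun w => f w • x) = avg f • x := by
  simp only [avg, ← Finset.sum_smul, smul_eq_mul]; rw [mul_smul]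

theorem avg_mono {f g : Ω → ℝ} (h : ∀ w, f w ≤ g w) : avg f ≤ avg g := by
  simp only [avg, smul_eq_mul]
  have : ∑ w, f w ≤ ∑ w, g w := Finset.sum_le_sum fun w _ => h w
  gcongr

theorem avg_nonneg {f : Ω → ℝ} (h : ∀ w, 0 ≤ f w) : 0 ≤ avg f := by
  simp only [avg, smul_eq_mul]
  have : 0 ≤ ∑ w, f w := Finset.sum_nonneg fun w _ => h w
  positivity

theorem norm_avg_le (F : Ω → V) : ‖avg F‖ ≤ avg fun w => ‖F w‖ := by
  simp only [avg, norm_smul, smul_eq_mul]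
  have : ‖∑ w, F w‖ ≤ ∑ w, ‖F w‖ := norm_sum_le _ _
  rw [Real.norm_of_nonneg (by positivity)]
  gcongr

theorem avg_const [Nonempty Ω] (x : V) : avg (fun _ : Ω => x) = x := by
  simp only [avg, Finset.sum_const, Finset.card_univ, ← Nat.cast_smul_eq_nsmul ℝ, smul_smul]
  rw [inv_mul_cancel₀ (by simp), one_smul]

theorem avg_equiv (e : Ω ≃ Ω') (F : Ω' → V) : avg (fun w => F (e w)) = avg F := by
  simp only [avg, Fintype.card_congr e]
  rw [Equiv.sum_comp e F]

theorem avg_prod (F : Ω → Ω' → V) :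
    avg (fun p : Ω × Ω' => F p.1 p.2) = avg fun w => avg fun w' => F w w' := by
  simp only [avg, ← Finset.smul_sum, Fintype.sum_prod_type, Fintype.card_prod, Nat.cast_mul,
    mul_inv, mul_smul]

variable {I A : Type*} [Fintype I] [DecidableEq I] [Fintype A] [Nonempty A]

/-- Integrating out one coordinate does not change the average over all words. -/
theorem avg_update (i : I) (F : (I → A) → V) :
    avg (fun w => avg fun c => F (Function.update w i c)) = avg F := by
  classical
  let e : (I → A) × A ≃ (I → A) × A :=
    { toFun := fun p => (Function.update p.1 i p.2, p.1 i)
      invFun := fun p => (Function.update p.1 i p.2, p.1 i)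
      left_inv := fun p => by simp
      right_inv := fun p => by simp }
  rw [← avg_prod (fun w c => F (Function.update w i c))]
  have h := avg_equiv e (fun p => F p.1)
  simp only [e, Equiv.coe_fn_mk] at h
  rw [h, avg_prod (fun w _ => F w)]
  simp only [avg_const]

/-- `F` does not depend on the coordinate `i`. -/
def FreeOf {β : Type*} (F : (I → A) → β) (i : I) : Prop :=
  ∀ w c, F (Function.update w i c) = F w

omit [Fintype I] [Fintype A] [Nonempty A] in
theorem FreeOf.map₂ {β γ δ : Type*} {F : (I → A) → β} {G : (I → A) → γ} {i : I}
    (hF : FreeOf F i) (hG : FreeOf G i) (φ : β → γ → δ) : FreeOf (fun w => φ (F w) (G w)) i :=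
  fun w c => by simp only [hF w c, hG w c]

omit [Fintype I] [Fintype A] [Nonempty A] in
theorem FreeOf.map {β γ : Type*} {F : (I → A) → β} {i : I}
    (hF : FreeOf F i) (φ : β → γ) : FreeOf (fun w => φ (F w)) i :=
  fun w c => by simp only [hF w c]

omit [Fintype I] [Fintype A] [Nonempty A] in
theorem freeOf_coord {i j : I} (h : j ≠ i) : FreeOf (fun w : I → A => w j) i :=
  fun w c => by simp [h]

omit [Fintype I] [Fintype A] [Nonempty A] in
theorem freeOf_prod {i : I} (s : Finset ℕ) {f : ℕ → (I → A) → ℝ}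
    (h : ∀ j ∈ s, FreeOf (f j) i) : FreeOf (fun w => ∏ j ∈ s, f j w) i :=
  fun w c => Finset.prod_congr rfl fun j hj => h j hj w c

omit [Fintype I] [Fintype A] [Nonempty A] in
theorem DependsOn.freeOf {β : Type*} {F : (I → A) → β} {s : Set I} (hF : DependsOn F s) {i : I}
    (hi : i ∉ s) : FreeOf F i :=
  fun w c => hF fun j hj => Function.update_of_ne (by rintro rfl; exact hi hj) c w

theorem avg_integrate_right {φ : A → A → ℝ} {κ : ℝ} (hφ : ∀ a, avg (φ a) = κ) {i j : I}
    (hij : j ≠ i) {G : (I → A) → V} (hG : FreeOf G i) :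
    avg (fun w => φ (w j) (w i) • G w) = κ • avg G := by
  rw [← avg_update i, ← avg_smul]
  congr 1; funext w
  simp only [hG w, Function.update_self, Function.update_of_ne hij]
  rw [avg_smul_const, hφ]

theorem avg_integrate_left {φ : A → A → ℝ} {κ : ℝ} (hφ : ∀ b, avg (fun a => φ a b) = κ) {i j : I}
    (hij : j ≠ i) {G : (I → A) → V} (hG : FreeOf G i) :
    avg (fun w => φ (w i) (w j) • G w) = κ • avg G :=
  avg_integrate_right (φ := fun a b => φ b a) hφ hij hG

theorem avg_integrate_right_le {φ : A → A → ℝ} {κ : ℝ} (hφ : ∀ a, avg (φ a) ≤ κ) {i j : I}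
    (hij : j ≠ i) {G : (I → A) → ℝ} (hG : FreeOf G i) (hG0 : ∀ w, 0 ≤ G w) :
    avg (fun w => φ (w j) (w i) * G w) ≤ κ * avg G := by
  rw [← avg_update i, ← smul_eq_mul κ, ← avg_smul]
  refine avg_mono fun w => ?_
  simp only [hG w, Function.update_self, Function.update_of_ne hij]
  have := avg_smul_const (φ (w j)) (G w)
  simp only [smul_eq_mul] at this ⊢
  rw [this]
  exact mul_le_mul_of_nonneg_right (hφ _) (hG0 w)

omit [Nonempty A] in
/-- If `F w w'` depends on `w` through the coordinates in `s` and on `w'` through those outside `s`,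
then, under a product weight, the two arguments are independent. -/
theorem avg_decouple (s : Set I) {WA WB : (I → A) → ℝ} (hA : DependsOn WA s) (hB : DependsOn WB sᶜ)
    {F : (I → A) → (I → A) → V} (hF1 : ∀ w', DependsOn (fun w => F w w') s)
    (hF2 : ∀ w, DependsOn (F w) sᶜ) (h1 : avg (fun w => WA w * WB w) = 1) :
    avg (fun w => avg fun w' => (WA w * WB w) • (WA w' * WB w') • F w w') =
      avg fun w => (WA w * WB w) • F w w := by
  classical
  let mix : (I → A) → (I → A) → (I → A) := fun w w' i => if i ∈ s then w i else w' i
  let e : (I → A) × (I → A) ≃ (I → A) × (I → A) :=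
    { toFun := fun p => (mix p.1 p.2, mix p.2 p.1)
      invFun := fun p => (mix p.1 p.2, mix p.2 p.1)
      left_inv := fun p => by
        ext i <;> by_cases h : i ∈ s <;> simp [mix, h]
      right_inv := fun p => by
        ext i <;> by_cases h : i ∈ s <;> simp [mix, h] }
  have hs : ∀ w w', ∀ i ∈ s, mix w w' i = w i := fun w w' i h => by simp [mix, h]
  have hsc : ∀ w w', ∀ i ∈ sᶜ, mix w w' i = w' i := fun w w' i h => by
    have : i ∉ s := h
    simp [mix, this]
  have key : avg (fun w => avg fun w' => (WA w * WB w) • (WA w' * WB w') • F w w') =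
      avg (fun w => avg fun w' => (WA w * WB w) • (WA w' * WB w') • F w w) := by
    rw [← avg_prod (fun w w' => (WA w * WB w) • (WA w' * WB w') • F w w'),
      ← avg_prod (fun w w' => (WA w * WB w) • (WA w' * WB w') • F w w),
      ← avg_equiv e (fun p => (WA p.1 * WB p.1) • (WA p.2 * WB p.2) • F p.1 p.1)]
    congr 1; funext p
    simp only [e, Equiv.coe_fn_mk]
    have a1 : WA (mix p.1 p.2) = WA p.1 := hA (hs _ _)
    have a2 : WA (mix p.2 p.1) = WA p.2 := hA (hs _ _)
    have b1 : WB (mix p.1 p.2) = WB p.2 := hB (hsc _ _)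
    have b2 : WB (mix p.2 p.1) = WB p.1 := hB (hsc _ _)
    have f1 : F (mix p.1 p.2) (mix p.1 p.2) = F p.1 p.2 :=
      (hF1 _ (hs p.1 p.2)).trans (hF2 _ (hsc p.1 p.2))
    rw [a1, a2, b1, b2, f1, smul_smul, smul_smul]
    congr 1; ring
  rw [key]
  congr 1; funext w
  rw [avg_smul, avg_smul_const, h1, one_smul]

end Averages

/-! ### Densities of chains and gaps -/

section Gaps

variable {A : Type*} [Fintype A] [Nonempty A]

/-- `1 + d a b` is the density, relative to the uniform distribution, of a doubly stochastic
transition function, and the row averages of `|d|` are at most `1 / 2`. -/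
structure IsChainDensity (d : A → A → ℝ) : Prop where
  abs_le : ∀ a b, |d a b| ≤ 1
  avg_right : ∀ a, avg (d a) = 0
  avg_left : ∀ b, avg (fun a => d a b) = 0
  avg_abs : ∀ a, avg (fun b => |d a b|) ≤ 1 / 2

variable {d : A → A → ℝ} (hd : IsChainDensity d)
variable {V I : Type*} [NormedAddCommGroup V] [NormedSpace ℝ V] [Fintype I] [DecidableEq I]

/-- The weight of a path: the product of the densities along its edges `v j → v (j + 1)`, for
`j < ℓ`. -/
def pathWeight (d : A → A → ℝ) (v : ℕ → I) (ℓ : ℕ) (w : I → A) : ℝ :=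
  ∏ j ∈ Finset.range ℓ, (1 + d (w (v j)) (w (v (j + 1))))

/-- The product of the centred densities along a path. -/
def pathDefect (d : A → A → ℝ) (v : ℕ → I) (ℓ : ℕ) (w : I → A) : ℝ :=
  ∏ j ∈ Finset.range ℓ, d (w (v j)) (w (v (j + 1)))

include hd

omit [Nonempty A] in
theorem IsChainDensity.one_add_nonneg (a b : A) : 0 ≤ 1 + d a b := by
  have := _root_.abs_le.1 (hd.abs_le a b); linarith

omit [Fintype I] [DecidableEq I] [Nonempty A] in
theorem pathWeight_nonneg (v : ℕ → I) (ℓ : ℕ) (w : I → A) : 0 ≤ pathWeight d v ℓ w :=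
  Finset.prod_nonneg fun _ _ => hd.one_add_nonneg _ _

omit [Fintype I] [DecidableEq I] [Nonempty A] in
theorem abs_pathDefect_le (v : ℕ → I) (ℓ : ℕ) (w : I → A) : |pathDefect d v ℓ w| ≤ 1 := by
  rw [pathDefect, Finset.abs_prod]
  exact Finset.prod_le_one (fun _ _ => abs_nonneg _) fun _ _ => hd.abs_le _ _

omit hd [Fintype A] [Nonempty A] [Fintype I] in
theorem pathWeight_freeOf {v : ℕ → I} {ℓ : ℕ} {i : I} (h : ∀ j ≤ ℓ, v j ≠ i) :
    FreeOf (pathWeight d v ℓ) i := by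
  refine freeOf_prod _ fun j hj => ?_
  have hj' := Finset.mem_range.1 hj
  exact (freeOf_coord (h j hj'.le)).map₂ (freeOf_coord (h (j + 1) hj')) fun a b => 1 + d a b

omit hd [Fintype A] [Nonempty A] [Fintype I] in
theorem pathDefect_freeOf {v : ℕ → I} {ℓ : ℕ} {i : I} (h : ∀ j ≤ ℓ, v j ≠ i) :
    FreeOf (pathDefect d v ℓ) i := by
  refine freeOf_prod _ fun j hj => ?_
  have hj' := Finset.mem_range.1 hj
  exact (freeOf_coord (h j hj'.le)).map₂ (freeOf_coord (h (j + 1) hj')) fun a b => d a b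

theorem avg_one_add_right (a : A) : avg (fun b => 1 + d a b) = 1 := by
  rw [avg_add (fun _ => (1 : ℝ)) (d a), avg_const, hd.avg_right, add_zero]

/-- A path all of whose points but the first are free integrates to `1`. -/
theorem avg_pathWeight {v : ℕ → I} {ℓ : ℕ} (hv : ∀ i, 1 ≤ i → i ≤ ℓ → ∀ j ≤ ℓ, v j = v i → j = i)
    {G : (I → A) → V} (hG : ∀ i, 1 ≤ i → i ≤ ℓ → FreeOf G (v i)) :
    avg (fun w => pathWeight d v ℓ w • G w) = avg G := by
  induction ℓ with
  | zero => simp [pathWeight]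
  | succ ℓ ih =>
    have e : (fun w => pathWeight d v (ℓ + 1) w • G w) = fun w =>
        (fun a b => 1 + d a b) (w (v ℓ)) (w (v (ℓ + 1))) • (pathWeight d v ℓ w • G w) := by
      funext w; rw [smul_smul, pathWeight, Finset.prod_range_succ, mul_comm]; rfl
    rw [e, avg_integrate_right (φ := fun a b => 1 + d a b) (avg_one_add_right hd), one_smul]
    · exact ih (fun i h1 h2 j hj => hv i h1 (by omega) j (by omega))
        fun i h1 h2 => hG i h1 (by omega)
    · intro h; have := hv (ℓ + 1) (by omega) le_rfl ℓ (by omega) h; omega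
    · refine FreeOf.map₂ (pathWeight_freeOf fun j hj h => ?_) (hG _ (by omega) le_rfl) _
      have := hv (ℓ + 1) (by omega) le_rfl j (by omega) h; omega

theorem avg_abs_pathDefect_le {v : ℕ → I} {ℓ : ℕ}
    (hv : ∀ i, 1 ≤ i → i ≤ ℓ → ∀ j ≤ ℓ, v j = v i → j = i)
    {G : (I → A) → ℝ} (hG : ∀ i, 1 ≤ i → i ≤ ℓ → FreeOf G (v i)) (hG0 : ∀ w, 0 ≤ G w) :
    avg (fun w => |pathDefect d v ℓ w| * G w) ≤ (1 / 2) ^ ℓ * avg G := by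
  induction ℓ with
  | zero => simp [pathDefect]
  | succ ℓ ih =>
    have e : (fun w => |pathDefect d v (ℓ + 1) w| * G w) = fun w =>
        (fun a b => |d a b|) (w (v ℓ)) (w (v (ℓ + 1))) * (|pathDefect d v ℓ w| * G w) := by
      funext w; rw [← mul_assoc, pathDefect, Finset.prod_range_succ, abs_mul, mul_comm |_| |_|]; rfl
    rw [e]
    refine (avg_integrate_right_le (φ := fun a b => |d a b|) hd.avg_abs ?_ ?_ ?_).trans ?_
    · intro h; have := hv (ℓ + 1) (by omega) le_rfl ℓ (by omega) h; omega
    · refine FreeOf.map₂ (pathDefect_freeOf fun j hj h => ?_) (hG _ (by omega) le_rfl)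
        fun a b => |a| * b
      have := hv (ℓ + 1) (by omega) le_rfl j (by omega) h; omega
    · exact fun w => mul_nonneg (abs_nonneg _) (hG0 w)
    · have := ih (fun i h1 h2 j hj => hv i h1 (by omega) j (by omega))
        fun i h1 h2 => hG i h1 (by omega)
      rw [pow_succ]
      linarith

/-- **Gap lemma.** When all interior points of a path are free, expanding the product of the
densities leaves only two terms: every other term contains a free point meeting exactly one
centred density, and integrates to zero. -/
theorem avg_gap {v : ℕ → I} {ℓ : ℕ}
    (hv : ∀ i, 1 ≤ i → i ≤ ℓ → ∀ j ≤ ℓ + 1, v j = v i → j = i)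
    {G : (I → A) → V} (hG : ∀ i, 1 ≤ i → i ≤ ℓ → FreeOf G (v i)) :
    avg (fun w => pathWeight d v (ℓ + 1) w • G w) =
      avg fun w => (1 + pathDefect d v (ℓ + 1) w) • G w := by
  induction ℓ generalizing G with
  | zero => simp [pathWeight, pathDefect]
  | succ ℓ ih =>
    have hne : ∀ j ≤ ℓ + 2, j ≠ ℓ + 1 → v j ≠ v (ℓ + 1) := fun j hj hne h =>
      hne (hv (ℓ + 1) (by omega) le_rfl j hj h)
    have e : (fun w => pathWeight d v (ℓ + 1 + 1) w • G w) = fun w =>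
        pathWeight d v (ℓ + 1) w • ((1 + d (w (v (ℓ + 1))) (w (v (ℓ + 2)))) • G w) := by
      funext w; rw [smul_smul, pathWeight, Finset.prod_range_succ]; rfl
    rw [e, ih]
    · have e2 : (fun w => (1 + pathDefect d v (ℓ + 1) w) •
          ((1 + d (w (v (ℓ + 1))) (w (v (ℓ + 2)))) • G w)) = fun w =>
          (1 + pathDefect d v (ℓ + 1 + 1) w) • G w +
            (d (w (v ℓ)) (w (v (ℓ + 1))) • (pathDefect d v ℓ w • G w) +
              d (w (v (ℓ + 1))) (w (v (ℓ + 2))) • G w) := by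
        funext w
        simp only [pathDefect, Finset.prod_range_succ]
        module
      have z1 : avg (fun w => d (w (v ℓ)) (w (v (ℓ + 1))) • (pathDefect d v ℓ w • G w)) = 0 := by
        rw [avg_integrate_right hd.avg_right (hne _ (by omega) (by omega)), zero_smul]
        exact FreeOf.map₂ (pathDefect_freeOf fun j hj => hne _ (by omega) (by omega))
          (hG _ (by omega) le_rfl) _
      have z2 : avg (fun w => d (w (v (ℓ + 1))) (w (v (ℓ + 2))) • G w) = 0 := by
        rw [avg_integrate_left hd.avg_left (hne _ (by omega) (by omega)) (hG _ (by omega) le_rfl),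
          zero_smul]
      rw [e2, avg_add, avg_add, z1, z2, add_zero, add_zero]
    · exact fun i h1 h2 j hj => hv i h1 (by omega) j (by omega)
    · refine fun i h1 h2 => FreeOf.map₂ ?_ (hG i h1 (by omega)) _
      have a1 : v (ℓ + 1) ≠ v i := fun h => by
        have := hv i h1 (by omega) (ℓ + 1) (by omega) h; omega
      have a2 : v (ℓ + 2) ≠ v i := fun h => by
        have := hv i h1 (by omega) (ℓ + 2) (by omega) h; omega
      exact (freeOf_coord a1).map₂ (freeOf_coord a2) fun a b => 1 + d a b

end Gaps

/-! ### Random cyclic words and their mixing -/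

section Cyclic

variable {A : Type*} [Fintype A] [Nonempty A] {n : ℕ} [NeZero n]
variable {V : Type*} [NormedAddCommGroup V] [NormedSpace ℝ V] {d : A → A → ℝ}

/-- The weight of a cyclic word. -/
def cycWeight (d : A → A → ℝ) (w : ZMod n → A) : ℝ := ∏ z, (1 + d (w z) (w (z + 1)))

/-- The mean of `F` over random cyclic words, drawn with probability proportional to
`cycWeight d`. -/
noncomputable def cycMean (d : A → A → ℝ) (F : (ZMod n → A) → V) : V :=
  (avg (cycWeight (n := n) d))⁻¹ • avg fun w => cycWeight d w • F w

omit [NeZero n] in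
theorem zmod_natCast_inj {i j : ℕ} (h1 : i < j + n) (h2 : j < i + n)
    (h : (i : ZMod n) = (j : ZMod n)) : i = j := by
  have h' := (ZMod.natCast_eq_natCast_iff i j n).1 h
  refine h'.eq_of_abs_lt ?_
  rw [abs_lt]; constructor <;> omega

/-- The positions `a, a + 1, …, b - 1` on the cycle. -/
def arc (n a b : ℕ) : Set (ZMod n) := {z | ∃ j, a ≤ j ∧ j < b ∧ (j : ZMod n) = z}

omit [NeZero n] in
theorem arc_disjoint {a b c e : ℕ} (h1 : b ≤ c) (h2 : e ≤ a + n) {z : ZMod n}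
    (hz : z ∈ arc n a b) : z ∉ arc n c e := by
  obtain ⟨j, hj1, hj2, rfl⟩ := hz
  rintro ⟨i, hi1, hi2, h⟩
  have := zmod_natCast_inj (by omega) (by omega) h
  omega

omit [NeZero n] in
theorem arc_mono {a b c e : ℕ} (h1 : c ≤ a) (h2 : b ≤ e) : arc n a b ⊆ arc n c e := by
  rintro _ ⟨j, hj1, hj2, rfl⟩
  exact ⟨j, by omega, by omega, rfl⟩

theorem prod_zmod_eq_range {M : Type*} [CommMonoid M] (f : ZMod n → M) :
    ∏ z, f z = ∏ j ∈ Finset.range n, f (j : ZMod n) := by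
  symm
  refine Finset.prod_bij (fun j _ => (j : ZMod n)) (fun _ _ => Finset.mem_univ _) ?_ ?_
    fun _ _ => rfl
  · intro i hi j hj h
    have := Finset.mem_range.1 hi
    have := Finset.mem_range.1 hj
    exact zmod_natCast_inj (by omega) (by omega) h
  · intro z _
    exact ⟨z.val, Finset.mem_range.2 (ZMod.val_lt z), by simp⟩

theorem sum_zmod_eq_range {M : Type*} [AddCommMonoid M] (f : ZMod n → M) :
    ∑ z, f z = ∑ j ∈ Finset.range n, f (j : ZMod n) := by
  symm
  refine Finset.sum_bij (fun j _ => (j : ZMod n)) (fun _ _ => Finset.mem_univ _) ?_ ?_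
    fun _ _ => rfl
  · intro i hi j hj h
    have := Finset.mem_range.1 hi
    have := Finset.mem_range.1 hj
    exact zmod_natCast_inj (by omega) (by omega) h
  · intro z _
    exact ⟨z.val, Finset.mem_range.2 (ZMod.val_lt z), by simp⟩

/-- Consecutive positions on the cycle, starting from `a`. -/
def cycPath (n a j : ℕ) : ZMod n := ((a + j : ℕ) : ZMod n)

omit [Fintype A] [Nonempty A] in
theorem cycWeight_eq_pathWeight (w : ZMod n → A) :
    cycWeight d w = pathWeight d (cycPath n 0) n w := by
  rw [cycWeight, prod_zmod_eq_range, pathWeight]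
  simp [cycPath]

omit [Fintype A] [Nonempty A] [NeZero n] in
theorem pathWeight_cycPath_add (a k l : ℕ) (w : ZMod n → A) :
    pathWeight d (cycPath n a) (k + l) w =
      pathWeight d (cycPath n a) k w * pathWeight d (cycPath n (a + k)) l w := by
  simp only [pathWeight, Finset.prod_range_add, cycPath, add_assoc]

omit [NeZero n] in
theorem cycPath_inj {a i j : ℕ} (h1 : i < j + n) (h2 : j < i + n)
    (h : cycPath n a i = cycPath n a j) : i = j := by
  have := zmod_natCast_inj (i := a + i) (j := a + j) (by omega) (by omega) h
  omega

omit [NeZero n] in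
theorem cycPath_mem_arc {a b e j : ℕ} (h1 : b ≤ a + j) (h2 : a + j < e) :
    cycPath n a j ∈ arc n b e := ⟨a + j, h1, h2, rfl⟩

omit [Fintype A] [Nonempty A] [NeZero n] in
theorem pathWeight_cycPath_freeOf {a k b e : ℕ} {i : ZMod n} (hi : i ∈ arc n b e)
    (h : (a + k < b ∧ e ≤ a + n) ∨ (e ≤ a ∧ a + k < b + n)) :
    FreeOf (pathWeight d (cycPath n a) k) i := by
  classical
  refine pathWeight_freeOf fun j hj hji => ?_
  subst hji
  obtain ⟨l, h1, h2, h3⟩ := hi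
  have := zmod_natCast_inj (n := n) (i := l) (j := a + j) (by omega) (by omega) h3
  omega

omit [Fintype A] [Nonempty A] [NeZero n] in
theorem pathDefect_cycPath_freeOf {a k b e : ℕ} {i : ZMod n} (hi : i ∈ arc n b e)
    (h : (a + k < b ∧ e ≤ a + n) ∨ (e ≤ a ∧ a + k < b + n)) :
    FreeOf (pathDefect d (cycPath n a) k) i := by
  classical
  refine pathDefect_freeOf fun j hj hji => ?_
  subst hji
  obtain ⟨l, h1, h2, h3⟩ := hi
  have := zmod_natCast_inj (n := n) (i := l) (j := a + j) (by omega) (by omega) h3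
  omega

omit [Fintype A] [Nonempty A] [NeZero n] in
theorem pathWeight_cycPath_dependsOn (a k : ℕ) :
    DependsOn (pathWeight d (cycPath n a) k) (arc n a (a + k + 1)) := by
  intro w w' h
  refine Finset.prod_congr rfl fun j hj => ?_
  have hj' := Finset.mem_range.1 hj
  rw [h _ (cycPath_mem_arc (by omega) (by omega)), h _ (cycPath_mem_arc (by omega) (by omega))]

variable (hd : IsChainDensity d)
include hd

theorem abs_avg_cycWeight_sub_one_le {l : ℕ} (hn : n = l + 1) :
    |avg (cycWeight (n := n) d) - 1| ≤ (1 / 2) ^ l := by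
  have h1 : avg (cycWeight (n := n) d) = avg fun w : ZMod n → A =>
      (1 + pathDefect d (cycPath n 0) (l + 1) w) • (1 : ℝ) := by
    rw [← avg_gap hd (v := cycPath n 0) (ℓ := l) _ (fun i _ _ _ _ => rfl)]
    · congr 1; funext w
      rw [cycWeight_eq_pathWeight, smul_eq_mul, mul_one]
      congr 1
    · exact fun i h1 h2 j hj h => cycPath_inj (by omega) (by omega) h
  rw [h1]
  simp only [smul_eq_mul, mul_one]
  rw [avg_add (fun _ => (1 : ℝ)), avg_const, add_sub_cancel_left, ← Real.norm_eq_abs]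
  refine (norm_avg_le _).trans ((avg_mono (g := fun w =>
    |pathDefect d (cycPath n 0) l w| * 1) fun w => ?_).trans ((avg_abs_pathDefect_le hd
      (fun i h1 h2 j hj h => cycPath_inj (by omega) (by omega) h) (fun i _ _ _ _ => rfl)
      fun _ => zero_le_one).trans ?_))
  · rw [Real.norm_eq_abs, pathDefect, Finset.prod_range_succ, abs_mul]
    exact mul_le_mul_of_nonneg_left (hd.abs_le _ _) (abs_nonneg _)
  · rw [avg_const, mul_one]

theorem half_le_avg_cycWeight (hn : 2 ≤ n) : 1 / 2 ≤ avg (cycWeight (n := n) d) := by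
  obtain ⟨l, rfl⟩ : ∃ l, n = l + 1 + 1 := ⟨n - 2, by omega⟩
  have h := abs_le.1 (abs_avg_cycWeight_sub_one_le (n := l + 1 + 1) hd rfl)
  have : ((1 : ℝ) / 2) ^ (l + 1) ≤ 1 / 2 := by
    rw [pow_succ]
    have : ((1 : ℝ) / 2) ^ l ≤ 1 := pow_le_one₀ (by norm_num) (by norm_num)
    linarith
  linarith

theorem avg_cycWeight_pos (hn : 2 ≤ n) : 0 < avg (cycWeight (n := n) d) :=
  lt_of_lt_of_le (by norm_num) (half_le_avg_cycWeight hd hn)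

omit [Nonempty A] in
theorem cycWeight_nonneg (w : ZMod n → A) : 0 ≤ cycWeight d w :=
  Finset.prod_nonneg fun _ _ => hd.one_add_nonneg _ _

omit hd [Nonempty A] in
theorem cycMean_add (F G : (ZMod n → A) → V) :
    cycMean d (fun w => F w + G w) = cycMean d F + cycMean d G := by
  simp only [cycMean, smul_add]; rw [avg_add, smul_add]

omit hd [Nonempty A] in
theorem cycMean_sub (F G : (ZMod n → A) → V) :
    cycMean d (fun w => F w - G w) = cycMean d F - cycMean d G := by
  simp only [cycMean, smul_sub]; rw [avg_sub, smul_sub]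

omit hd [Nonempty A] in
theorem cycMean_zero : cycMean d (fun _ : ZMod n → A => (0 : V)) = 0 := by
  simp [cycMean, avg]

omit hd [Nonempty A] in
theorem cycMean_sum {ι : Type*} (s : Finset ι) (F : ι → (ZMod n → A) → V) :
    cycMean d (fun w => ∑ i ∈ s, F i w) = ∑ i ∈ s, cycMean d (F i) := by
  classical
  induction s using Finset.induction_on with
  | empty => simpa using cycMean_zero
  | insert a s ha ih => simp only [Finset.sum_insert ha]; rw [cycMean_add, ih]

omit hd [Nonempty A] in
theorem cycMean_eq_sum (F : (ZMod n → A) → V) :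
    cycMean d F = ∑ w, ((∑ w' : ZMod n → A, cycWeight d w')⁻¹ * cycWeight d w) • F w := by
  simp only [cycMean, avg, smul_smul, smul_eq_mul, Finset.smul_sum]
  refine Finset.sum_congr rfl fun w _ => ?_
  by_cases h : (Fintype.card (ZMod n → A) : ℝ) = 0
  · rw [Nat.cast_eq_zero, Fintype.card_eq_zero_iff] at h
    exact (h.false w).elim
  · congr 1
    rw [mul_inv, inv_inv]
    field_simp

omit hd [Nonempty A] in
theorem cycMean_smul (c : ℝ) (F : (ZMod n → A) → V) :
    cycMean d (fun w => c • F w) = c • cycMean d F := by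
  simp only [cycMean_eq_sum, Finset.smul_sum]
  exact Finset.sum_congr rfl fun w _ => smul_comm _ _ _

omit hd [Nonempty A] in
theorem cycMean_const_mul (c : ℝ) (F : (ZMod n → A) → ℝ) :
    cycMean d (fun w => c * F w) = c * cycMean d F := cycMean_smul c F

omit hd [Nonempty A] in
theorem cycMean_mul_complex (c : ℂ) (F : (ZMod n → A) → ℂ) :
    cycMean d (fun w => c * F w) = c * cycMean d F := by
  simp only [cycMean_eq_sum, Finset.mul_sum]
  exact Finset.sum_congr rfl fun w _ => (mul_smul_comm _ _ _).symm

omit hd [Nonempty A] in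
theorem cycMean_complex_mul (c : ℂ) (F : (ZMod n → A) → ℂ) :
    cycMean d (fun w => F w * c) = cycMean d F * c := by
  simp only [mul_comm _ c, cycMean_mul_complex]

omit hd [Nonempty A] in
theorem cycMean_ofReal (F : (ZMod n → A) → ℝ) :
    cycMean d (fun w => (F w : ℂ)) = ((cycMean d F : ℝ) : ℂ) := by
  simp only [cycMean_eq_sum, Complex.ofReal_sum, smul_eq_mul, Complex.ofReal_mul,
    Complex.real_smul]

theorem cycMean_const (hn : 2 ≤ n) (x : V) : cycMean d (fun _ : ZMod n → A => x) = x := by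
  rw [cycMean, avg_smul_const, smul_smul, inv_mul_cancel₀ (avg_cycWeight_pos hd hn).ne', one_smul]

omit [Nonempty A] in
theorem cycMean_mono {F G : (ZMod n → A) → ℝ} (h : ∀ w, F w ≤ G w) :
    cycMean d F ≤ cycMean d G := by
  simp only [cycMean, smul_eq_mul]
  have h1 : avg (fun w => cycWeight d w * F w) ≤ avg fun w => cycWeight d w * G w :=
    avg_mono fun w => mul_le_mul_of_nonneg_left (h w) (cycWeight_nonneg hd w)
  have h2 : 0 ≤ avg (cycWeight (n := n) d) := avg_nonneg (cycWeight_nonneg hd)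
  exact mul_le_mul_of_nonneg_left h1 (inv_nonneg.2 h2)

omit [Nonempty A] in
theorem norm_cycMean_le (F : (ZMod n → A) → V) : ‖cycMean d F‖ ≤ cycMean d fun w => ‖F w‖ := by
  simp only [cycMean, norm_smul]
  have h2 : 0 ≤ avg (cycWeight (n := n) d) := avg_nonneg (cycWeight_nonneg hd)
  rw [Real.norm_of_nonneg (inv_nonneg.2 h2)]
  refine mul_le_mul_of_nonneg_left ((norm_avg_le _).trans (avg_mono fun w => ?_)) (inv_nonneg.2 h2)
  rw [norm_smul, Real.norm_of_nonneg (cycWeight_nonneg hd w), smul_eq_mul]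

theorem norm_cycMean_le_of_le (hn : 2 ≤ n) {F : (ZMod n → A) → V} {M : ℝ} (h : ∀ w, ‖F w‖ ≤ M) :
    ‖cycMean d F‖ ≤ M :=
  (norm_cycMean_le hd F).trans ((cycMean_mono hd h).trans (cycMean_const hd hn M).le)

omit hd [Nonempty A] in
/-- Rotation invariance. -/
theorem cycMean_rotate (s : ZMod n) (F : (ZMod n → A) → V) :
    cycMean d (fun w => F fun z => w (z + s)) = cycMean d F := by
  let e : (ZMod n → A) ≃ (ZMod n → A) := (Equiv.addRight s).symm.arrowCongr (Equiv.refl A)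
  have hW : ∀ w : ZMod n → A, cycWeight d (fun z => w (z + s)) = cycWeight d w := fun w => by
    rw [cycWeight, cycWeight,
      ← Equiv.prod_comp (Equiv.addRight s) fun z => 1 + d (w z) (w (z + 1))]
    exact Finset.prod_congr rfl fun z _ => by simp only [Equiv.coe_addRight, add_right_comm]
  simp only [cycMean]
  congr 1
  rw [← avg_equiv e fun w => cycWeight d w • F w]
  congr 1; funext w
  rw [← hW w]; rfl

/-- Two arcs of a cyclic word, separated on both sides by `L` letters, behave as if the two gaps
were cut open, up to an error exponentially small in `L`. -/
theorem norm_cycMean_sub_avg_le {p q L : ℕ} (hn : n = p + q + 2 * L + 2)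
    {F : (ZMod n → A) → V} {M : ℝ} (hM : ∀ w, ‖F w‖ ≤ M)
    (hF : DependsOn F (arc n 0 (p + 1) ∪ arc n (p + L + 1) (p + L + q + 2))) :
    ‖cycMean d F - avg fun w => (pathWeight d (cycPath n 0) p w *
      pathWeight d (cycPath n (p + L + 1)) q w) • F w‖ ≤ 6 * (1 / 2) ^ L * M := by
  set WA := pathWeight (I := ZMod n) d (cycPath n 0) p with hWA
  set WB := pathWeight (I := ZMod n) d (cycPath n (p + L + 1)) q with hWB
  set D1 := pathDefect (I := ZMod n) d (cycPath n p) (L + 1) with hD1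
  set D2 := pathDefect (I := ZMod n) d (cycPath n (p + L + 1 + q)) (L + 1) with hD2
  have hsplit : ∀ w : ZMod n → A, cycWeight d w = pathWeight d (cycPath n p) (L + 1) w *
      (pathWeight d (cycPath n (p + L + 1 + q)) (L + 1) w * (WA w * WB w)) := by
    intro w
    have e : n = p + ((L + 1) + (q + (L + 1))) := by omega
    have : cycWeight d w = pathWeight d (cycPath n 0) (p + ((L + 1) + (q + (L + 1)))) w := by
      rw [cycWeight_eq_pathWeight, ← e]
    rw [this, pathWeight_cycPath_add 0 p, zero_add, pathWeight_cycPath_add p (L + 1),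
      ← add_assoc p L 1, pathWeight_cycPath_add (p + L + 1) q, ← hWA, ← hWB]
    ring
  -- the interior points of the two gaps
  have i1 : ∀ i, 1 ≤ i → i ≤ L → cycPath n p i ∈ arc n (p + 1) (p + L + 1) :=
    fun i h1 h2 => cycPath_mem_arc (by omega) (by omega)
  have i2 : ∀ i, 1 ≤ i → i ≤ L → cycPath n (p + L + 1 + q) i ∈ arc n (p + L + q + 2) n :=
    fun i h1 h2 => cycPath_mem_arc (by omega) (by omega)
  have hWA1 : ∀ {i}, i ∈ arc n (p + 1) (p + L + 1) → FreeOf WA i := fun hi =>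
    pathWeight_cycPath_freeOf hi (by omega)
  have hWA2 : ∀ {i}, i ∈ arc n (p + L + q + 2) n → FreeOf WA i := fun hi =>
    pathWeight_cycPath_freeOf hi (by omega)
  have hWB1 : ∀ {i}, i ∈ arc n (p + 1) (p + L + 1) → FreeOf WB i := fun hi =>
    pathWeight_cycPath_freeOf hi (by omega)
  have hWB2 : ∀ {i}, i ∈ arc n (p + L + q + 2) n → FreeOf WB i := fun hi =>
    pathWeight_cycPath_freeOf hi (by omega)
  have hAB1 : ∀ {i}, i ∈ arc n (p + 1) (p + L + 1) → FreeOf (fun w => WA w * WB w) i :=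
    fun hi => (hWA1 hi).map₂ (hWB1 hi) _
  have hAB2 : ∀ {i}, i ∈ arc n (p + L + q + 2) n → FreeOf (fun w => WA w * WB w) i :=
    fun hi => (hWA2 hi).map₂ (hWB2 hi) _
  have inj : ∀ a, ∀ i, 1 ≤ i → i ≤ L → ∀ j ≤ L + 1, cycPath n a j = cycPath n a i → j = i :=
    fun a i h1 h2 j hj h => cycPath_inj (by omega) (by omega) h
  have main : ∀ G : (ZMod n → A) → V,
      DependsOn G (arc n 0 (p + 1) ∪ arc n (p + L + 1) (p + L + q + 2)) →
      avg (fun w => cycWeight d w • G w) =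
        avg fun w => (1 + D1 w) • (1 + D2 w) • (WA w * WB w) • G w := by
    intro G hG
    have hG1 : ∀ {i}, i ∈ arc n (p + 1) (p + L + 1) → FreeOf G i := fun hi =>
      hG.freeOf fun h => h.elim (fun h => arc_disjoint (by omega) (by omega) h hi)
        fun h => arc_disjoint (by omega) (by omega) hi h
    have hG2 : ∀ {i}, i ∈ arc n (p + L + q + 2) n → FreeOf G i := fun hi =>
      hG.freeOf fun h => h.elim (fun h => arc_disjoint (by omega) (by omega) h hi)
        fun h => arc_disjoint (by omega) (by omega) h hi
    have e1 : (fun w => cycWeight d w • G w) = fun w => pathWeight d (cycPath n p) (L + 1) w •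
        (pathWeight d (cycPath n (p + L + 1 + q)) (L + 1) w * (WA w * WB w)) • G w := by
      funext w; rw [hsplit, smul_smul]
    rw [e1, avg_gap hd (inj p)]
    · have e2 : (fun w => (1 + pathDefect d (cycPath n p) (L + 1) w) •
          (pathWeight d (cycPath n (p + L + 1 + q)) (L + 1) w * (WA w * WB w)) • G w) = fun w =>
          pathWeight d (cycPath n (p + L + 1 + q)) (L + 1) w •
            (((1 + D1 w) * (WA w * WB w)) • G w) := by
        funext w; simp only [smul_smul, hD1]; congr 1; ring
      rw [e2, avg_gap hd (inj _)]
      · congr 1; funext w; simp only [smul_smul, hD2]; congr 1; ring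
      · intro i h1 h2
        refine FreeOf.map₂ (FreeOf.map₂ (FreeOf.map ?_ fun a => 1 + a) (hAB2 (i2 i h1 h2)) _)
          (hG2 (i2 i h1 h2)) _
        exact pathDefect_cycPath_freeOf (i2 i h1 h2) (by omega)
    · intro i h1 h2
      refine FreeOf.map₂ (FreeOf.map₂ ?_ (hAB1 (i1 i h1 h2)) _) (hG1 (i1 i h1 h2)) _
      exact pathWeight_cycPath_freeOf (i1 i h1 h2) (by omega)
  have hAB0 : ∀ w, 0 ≤ WA w * WB w := fun w =>
    mul_nonneg (pathWeight_nonneg hd _ _ _) (pathWeight_nonneg hd _ _ _)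
  have hAB : avg (fun w => WA w * WB w) = 1 := by
    have := avg_pathWeight hd (v := cycPath n 0) (ℓ := p)
      (fun i h1 h2 j hj h => cycPath_inj (by omega) (by omega) h) (G := WB)
      (fun i h1 h2 => pathWeight_cycPath_freeOf (b := 1) (e := p + 1)
        (cycPath_mem_arc (by omega) (by omega)) (by omega))
    simp only [smul_eq_mul] at this
    rw [this]
    have := avg_pathWeight hd (v := cycPath n (p + L + 1)) (ℓ := q)
      (fun i h1 h2 j hj h => cycPath_inj (by omega) (by omega) h) (G := fun _ => (1 : ℝ))
      (fun i _ _ _ _ => rfl)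
    simpa only [smul_eq_mul, mul_one, avg_const] using this
  have hD : ∀ a, (∀ {i}, 1 ≤ i → i ≤ L → FreeOf (fun w => WA w * WB w) (cycPath n a i)) →
      avg (fun w => |pathDefect d (cycPath n a) (L + 1) w| * (WA w * WB w)) ≤ (1 / 2) ^ L := by
    intro a ha
    have := avg_abs_pathDefect_le hd (v := cycPath n a) (ℓ := L)
      (fun i h1 h2 j hj h => cycPath_inj (by omega) (by omega) h) (fun i h1 h2 => ha h1 h2) hAB0
    rw [hAB, mul_one] at this
    refine (avg_mono fun w => ?_).trans this
    refine mul_le_mul_of_nonneg_right ?_ (hAB0 w)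
    rw [pathDefect, Finset.prod_range_succ, abs_mul]
    exact mul_le_of_le_one_right (abs_nonneg _) (hd.abs_le _ _)
  have hD1' := hD p fun h1 h2 => hAB1 (i1 _ h1 h2)
  have hD2' := hD (p + L + 1 + q) fun h1 h2 => hAB2 (i2 _ h1 h2)
  have half : avg (fun w => |D1 w| * (WA w * WB w) + 2 * (|D2 w| * (WA w * WB w))) ≤
      3 * (1 / 2) ^ L := by
    have h2 := avg_smul (2 : ℝ) fun w => |D2 w| * (WA w * WB w)
    simp only [smul_eq_mul] at h2
    rw [avg_add, h2]
    linarith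
  have est : ∀ {V' : Type _} [NormedAddCommGroup V'] [NormedSpace ℝ V'] (G : (ZMod n → A) → V')
      (M' : ℝ), (∀ w, ‖G w‖ ≤ M') →
      ‖(avg fun w => (1 + D1 w) • (1 + D2 w) • (WA w * WB w) • G w) -
        avg fun w => (WA w * WB w) • G w‖ ≤ 3 * (1 / 2) ^ L * M' := by
    intro V' _ _ G M' hG
    have hM0 : 0 ≤ M' := (norm_nonneg _).trans (hG (Classical.arbitrary _))
    rw [← avg_sub]
    have e : (fun w => (1 + D1 w) • (1 + D2 w) • (WA w * WB w) • G w - (WA w * WB w) • G w) =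
        fun w => ((D1 w + (1 + D1 w) * D2 w) * (WA w * WB w)) • G w := by
      funext w; module
    rw [e]
    refine (norm_avg_le _).trans ((avg_mono (g := fun w =>
      M' • (|D1 w| * (WA w * WB w) + 2 * (|D2 w| * (WA w * WB w)))) fun w => ?_).trans ?_)
    · rw [norm_smul, norm_mul, Real.norm_of_nonneg (hAB0 w), smul_eq_mul]
      have h1 : ‖D1 w + (1 + D1 w) * D2 w‖ ≤ |D1 w| + 2 * |D2 w| := by
        have h3 := abs_add_le (D1 w) ((1 + D1 w) * D2 w)
        rw [abs_mul] at h3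
        have h4 : |1 + D1 w| ≤ 2 := by
          have := abs_add_le 1 (D1 w)
          have := abs_pathDefect_le hd (cycPath n p) (L + 1) w
          rw [abs_one] at *; linarith
        rw [Real.norm_eq_abs]
        nlinarith [abs_nonneg (D2 w)]
      have h2 : ‖D1 w + (1 + D1 w) * D2 w‖ * (WA w * WB w) ≤
          |D1 w| * (WA w * WB w) + 2 * (|D2 w| * (WA w * WB w)) := by
        nlinarith [hAB0 w]
      calc _ ≤ (|D1 w| * (WA w * WB w) + 2 * (|D2 w| * (WA w * WB w))) * ‖G w‖ := by gcongr
        _ ≤ _ := by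
          rw [mul_comm]
          refine mul_le_mul_of_nonneg_right (hG w) ?_
          have := hAB0 w
          positivity
    · rw [avg_smul, smul_eq_mul, mul_comm]
      exact mul_le_mul_of_nonneg_right half hM0
  have hMnn : 0 ≤ M := (norm_nonneg _).trans (hM (Classical.arbitrary _))
  have e1 := est F M hM
  rw [← main F hF] at e1
  -- the normalizing constant: the whole cycle is one gap
  have hZ : |avg (cycWeight (n := n) d) - 1| ≤ 3 * (1 / 2) ^ L := by
    refine (abs_avg_cycWeight_sub_one_le hd (l := p + q + 2 * L + 1) (by omega)).trans ?_
    have : ((1 : ℝ) / 2) ^ (p + q + 2 * L + 1) ≤ (1 / 2) ^ L :=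
      pow_le_pow_of_le_one (by norm_num) (by norm_num) (by omega)
    have h0 : (0 : ℝ) ≤ (1 / 2) ^ L := by positivity
    linarith
  have hn2 : 2 ≤ n := by omega
  have hZF : avg (fun w => cycWeight d w • F w) = avg (cycWeight (n := n) d) • cycMean d F := by
    rw [cycMean, smul_smul, mul_inv_cancel₀ (avg_cycWeight_pos hd hn2).ne', one_smul]
  rw [hZF] at e1
  have hF' := norm_cycMean_le_of_le hd hn2 hM
  have e2 : ‖cycMean d F - avg (cycWeight (n := n) d) • cycMean d F‖ ≤ 3 * (1 / 2) ^ L * M := by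
    have : cycMean d F - avg (cycWeight (n := n) d) • cycMean d F =
        -((avg (cycWeight (n := n) d) - 1) • cycMean d F) := by module
    rw [this, norm_neg, norm_smul, Real.norm_eq_abs]
    exact mul_le_mul hZ hF' (norm_nonneg _) (by positivity)
  refine (norm_sub_le_norm_sub_add_norm_sub _ (avg (cycWeight (n := n) d) • cycMean d F) _).trans ?_
  linarith

/-- **Mixing.** Two arcs of a random cyclic word, separated on both sides by `L` letters, are
independent up to an error exponentially small in `L`. -/
theorem norm_cycMean_sub_cycMean_cycMean_le {p q L : ℕ} (hn : n = p + q + 2 * L + 2)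
    {F : (ZMod n → A) → (ZMod n → A) → V} {M : ℝ} (hM : ∀ w w', ‖F w w'‖ ≤ M)
    (hF1 : ∀ w', DependsOn (fun w => F w w') (arc n 0 (p + 1)))
    (hF2 : ∀ w, DependsOn (F w) (arc n (p + L + 1) (p + L + q + 2))) :
    ‖cycMean d (fun w => F w w) - cycMean d fun w => cycMean d (F w)‖ ≤
      18 * (1 / 2) ^ L * M := by
  set WA := pathWeight (I := ZMod n) d (cycPath n 0) p with hWA
  set WB := pathWeight (I := ZMod n) d (cycPath n (p + L + 1)) q with hWB
  have hn2 : 2 ≤ n := by omega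
  have h1 := norm_cycMean_sub_avg_le hd hn (F := fun w => F w w) (fun w => hM w w)
    (fun w w' h => (hF1 w fun i hi => h i (Or.inl hi)).trans (hF2 w' fun i hi => h i (Or.inr hi)))
  have h2 := norm_cycMean_sub_avg_le hd hn (F := fun w => cycMean d (F w))
    (fun w => norm_cycMean_le_of_le hd hn2 (hM w))
    (fun w w' h => congrArg (cycMean d) (funext fun w'' => hF1 w'' fun i hi => h i (Or.inl hi)))
  have h3 := fun w => norm_cycMean_sub_avg_le hd hn (F := F w) (hM w)
    ((hF2 w).mono Set.subset_union_right)
  have hAB0 : ∀ w, 0 ≤ WA w * WB w := fun w =>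
    mul_nonneg (pathWeight_nonneg hd _ _ _) (pathWeight_nonneg hd _ _ _)
  have hAB : avg (fun w => WA w * WB w) = 1 := by
    have := avg_pathWeight hd (v := cycPath n 0) (ℓ := p)
      (fun i h1 h2 j hj h => cycPath_inj (by omega) (by omega) h) (G := WB)
      (fun i h1 h2 => pathWeight_cycPath_freeOf (b := 1) (e := p + 1)
        (cycPath_mem_arc (by omega) (by omega)) (by omega))
    simp only [smul_eq_mul] at this
    rw [this]
    have := avg_pathWeight hd (v := cycPath n (p + L + 1)) (ℓ := q)
      (fun i h1 h2 j hj h => cycPath_inj (by omega) (by omega) h) (G := fun _ => (1 : ℝ))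
      (fun i _ _ _ _ => rfl)
    simpa only [smul_eq_mul, mul_one, avg_const] using this
  have hdis : arc n (p + L + 1) (p + L + q + 2) ⊆ (arc n 0 (p + 1))ᶜ := fun z hz hz' =>
    arc_disjoint (by omega) (by omega) hz' hz
  -- once the gaps are cut open, the two arcs are exactly independent
  have key := avg_decouple (arc n 0 (p + 1)) (WA := WA) (WB := WB)
    (by simpa using pathWeight_cycPath_dependsOn (d := d) (n := n) 0 p)
    ((pathWeight_cycPath_dependsOn (d := d) (n := n) (p + L + 1) q).mono
      ((arc_mono le_rfl (by omega)).trans hdis)) hF1 (fun w => (hF2 w).mono hdis) hAB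
  have h4 : ‖(avg fun w => (WA w * WB w) • cycMean d (F w)) -
      avg fun w => (WA w * WB w) • F w w‖ ≤ 6 * (1 / 2) ^ L * M := by
    rw [← key, ← avg_sub]
    refine (norm_avg_le _).trans ((avg_mono (g := fun w =>
      (WA w * WB w) • (6 * (1 / 2) ^ L * M)) fun w => ?_).trans ?_)
    · rw [avg_smul, ← smul_sub, norm_smul, Real.norm_of_nonneg (hAB0 w), smul_eq_mul]
      exact mul_le_mul_of_nonneg_left (h3 w) (hAB0 w)
    · rw [avg_smul_const, hAB, one_smul]
  rw [norm_sub_rev] at h2 h4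
  refine (norm_sub_le_norm_sub_add_norm_sub _
    (avg fun w => (WA w * WB w) • cycMean d (F w)) _).trans ?_
  refine (add_le_add_left (norm_sub_le_norm_sub_add_norm_sub _
    (avg fun w => (WA w * WB w) • F w w) _) _).trans ?_
  linarith

end Cyclic

/-! ### Windows of cyclic words and the stationary chain -/

section Windows

variable {A : Type*} [Fintype A] [Nonempty A] {n : ℕ} [NeZero n]
variable {V : Type*} [NormedAddCommGroup V] [NormedSpace ℝ V] {d : A → A → ℝ}

/-- The infinite periodic sequence read off a cyclic word from position `z` on. -/
def win (w : ZMod n → A) (z : ZMod n) : ℕ → A := fun j => w (z + j)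

/-- The forward shift by `m` on sequences. -/
def seqShift (m : ℕ) (x : ℕ → A) : ℕ → A := fun j => x (m + j)

omit [Fintype A] [Nonempty A] [NeZero n] in
theorem win_rotate (w : ZMod n → A) (s z : ZMod n) :
    win (fun z => w (z + s)) z = win w (z + s) := by
  funext j; simp only [win]; congr 1; ring

omit [Fintype A] [Nonempty A] [NeZero n] in
theorem seqShift_win (w : ZMod n → A) (z : ZMod n) (m : ℕ) :
    seqShift m (win w z) = win w (z + m) := by
  funext j; simp only [win, seqShift, Nat.cast_add]; congr 1; ring

omit [Fintype A] [Nonempty A] in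
theorem seqShift_seqShift (m m' : ℕ) (x : ℕ → A) :
    seqShift m (seqShift m' x) = seqShift (m' + m) x := by
  funext j; simp only [seqShift, add_assoc]

omit [Fintype A] [Nonempty A] [NeZero n] in
theorem dependsOn_win {β : Type*} {F : (ℕ → A) → β} {K : ℕ} (hF : DependsOn F (Set.Iio K))
    (a : ℕ) : DependsOn (fun w => F (win w (a : ZMod n))) (arc n a (a + K)) := by
  intro w w' h
  refine hF fun j hj => h _ ⟨a + j, by omega, ?_, by push_cast; rfl⟩
  have : j < K := hj
  omega

omit [Fintype A] [Nonempty A] in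
theorem dependsOn_seqShift {β : Type*} {F : (ℕ → A) → β} {K : ℕ} (hF : DependsOn F (Set.Iio K))
    (m : ℕ) : DependsOn (fun x => F (seqShift m x)) (Set.Iio (m + K)) := by
  intro x y h
  refine hF fun j hj => h _ ?_
  have : j < K := hj
  exact Set.mem_Iio.2 (by omega)

omit [Fintype A] [Nonempty A] [NeZero n] in
theorem dependsOn_comp₂ {I β γ δ : Type*} {F : (I → A) → β} {G : (I → A) → γ} {s : Set I}
    (hF : DependsOn F s) (hG : DependsOn G s) (φ : β → γ → δ) :
    DependsOn (fun w => φ (F w) (G w)) s := fun w w' h => by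
  simp only [hF h, hG h]

/-- `ν` is the law of the chain with uniform initial distribution and transition densities
`1 + d`: the first `p + 1` letters have density `∏ (1 + d)` relative to uniform words. For later
use the uniform words are cyclic words of an arbitrary length `n > p`. -/
def IsChainLaw [MeasurableSpace A] (d : A → A → ℝ) (ν : Measure (ℕ → A)) : Prop :=
  ∀ (p : ℕ) (F : (ℕ → A) → ℝ), DependsOn F (Set.Iio (p + 1)) → ∀ (n : ℕ) [NeZero n], p < n →
    ∫ x, F x ∂ν = avg fun w : ZMod n → A => pathWeight d (cycPath n 0) p w * F (win w 0)

variable (hd : IsChainDensity d)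
include hd

theorem norm_cycMean_mixing {m L : ℕ} (hm : 1 ≤ m) (hn : m + 2 * L + 1 ≤ n)
    {F : (ZMod n → A) → (ZMod n → A) → V} {M : ℝ} (hM : ∀ w w', ‖F w w'‖ ≤ M)
    (hF1 : ∀ w', DependsOn (fun w => F w w') (arc n 0 m))
    (hF2 : ∀ w, DependsOn (F w) (arc n (m + L) (n - L))) :
    ‖cycMean d (fun w => F w w) - cycMean d fun w => cycMean d (F w)‖ ≤
      18 * (1 / 2) ^ L * M := by
  obtain ⟨p, rfl⟩ : ∃ p, m = p + 1 := ⟨m - 1, by omega⟩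
  obtain ⟨q, hq⟩ : ∃ q, n = p + q + 2 * L + 2 := ⟨n - (p + 2 * L + 2), by omega⟩
  refine norm_cycMean_sub_cycMean_cycMean_le hd hq hM hF1 fun w => (hF2 w).mono ?_
  exact arc_mono (by omega) (by omega)

variable [MeasurableSpace A] {ν : Measure (ℕ → A)} (hν : IsChainLaw d ν)
include hν

theorem abs_cycMean_sub_integral_le {m L : ℕ} (hm : 1 ≤ m) (hn : m + 2 * L + 1 ≤ n)
    {F : (ℕ → A) → ℝ} {M : ℝ} (hM : ∀ x, |F x| ≤ M) (hF : DependsOn F (Set.Iio m)) :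
    |cycMean d (fun w : ZMod n → A => F (win w 0)) - ∫ x, F x ∂ν| ≤ 6 * (1 / 2) ^ L * M := by
  obtain ⟨p, rfl⟩ : ∃ p, m = p + 1 := ⟨m - 1, by omega⟩
  obtain ⟨q, hq⟩ : ∃ q, n = p + q + 2 * L + 2 := ⟨n - (p + 2 * L + 2), by omega⟩
  have hF' : DependsOn (fun w : ZMod n → A => F (win w 0)) (arc n 0 (p + 1)) := by
    simpa using dependsOn_win (n := n) hF 0
  have h := norm_cycMean_sub_avg_le hd hq (F := fun w => F (win w 0)) (fun w => hM _)
    (hF'.mono Set.subset_union_left)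
  rw [hν p F hF n (by omega)]
  have e : (fun w : ZMod n → A => (pathWeight d (cycPath n 0) p w *
      pathWeight d (cycPath n (p + L + 1)) q w) • F (win w 0)) = fun w =>
      pathWeight d (cycPath n (p + L + 1)) q w •
        (pathWeight d (cycPath n 0) p w * F (win w 0)) := by
    funext w; simp only [smul_eq_mul]; ring
  rw [e, avg_pathWeight hd (fun i h1 h2 j hj h => cycPath_inj (by omega) (by omega) h)] at h
  · exact h
  · intro i h1 h2
    have hi : cycPath n (p + L + 1) i ∈ arc n (p + L + 1) (p + L + 1 + q + 1) :=
      cycPath_mem_arc (by omega) (by omega)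
    exact FreeOf.map₂ (pathWeight_cycPath_freeOf hi (by omega))
      (hF'.freeOf fun h => arc_disjoint (by omega) (by omega) h hi) _

omit [NeZero n] in
theorem tendsto_cycMean_integral {m : ℕ} {F : (ℕ → A) → ℝ} {M : ℝ} (hM : ∀ x, |F x| ≤ M)
    (hF : DependsOn F (Set.Iio m)) :
    Tendsto (fun N : ℕ => cycMean d (fun w : ZMod (N + 1) → A => F (win w 0))) atTop
      (𝓝 (∫ x, F x ∂ν)) := by
  have hM0 : 0 ≤ M := (abs_nonneg _).trans (hM fun _ => Classical.arbitrary A)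
  have hF' : DependsOn F (Set.Iio (m + 1)) := hF.mono (Set.Iio_subset_Iio (by omega))
  rw [tendsto_iff_dist_tendsto_zero]
  have h0 : Tendsto (fun L : ℕ => 6 * (1 / 2 : ℝ) ^ L * M) atTop (𝓝 0) := by
    have := (tendsto_pow_atTop_nhds_zero_of_lt_one (r := (1 / 2 : ℝ)) (by norm_num)
      (by norm_num)).const_mul 6 |>.mul_const M
    simpa using this
  rw [Metric.tendsto_atTop] at h0 ⊢
  intro ε hε
  obtain ⟨L, hL⟩ := h0 ε hε
  refine ⟨m + 2 * L + 1, fun N hN => ?_⟩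
  have h1 := abs_cycMean_sub_integral_le (n := N + 1) hd hν (m := m + 1) (L := L) (by omega)
    (by omega) hM hF'
  have h2 := hL L le_rfl
  rw [Real.dist_eq, sub_zero] at h2 ⊢
  rw [Real.dist_eq, abs_abs]
  exact h1.trans_lt (lt_of_abs_lt h2)

omit [NeZero n] in
/-- Stationarity, inherited from the rotation invariance of random cyclic words. -/
theorem integral_seqShift_of_dependsOn {m : ℕ} {F : (ℕ → A) → ℝ} {M : ℝ} (hM : ∀ x, |F x| ≤ M)
    (hF : DependsOn F (Set.Iio m)) (s : ℕ) : ∫ x, F (seqShift s x) ∂ν = ∫ x, F x ∂ν := by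
  refine tendsto_nhds_unique (tendsto_cycMean_integral hd hν (fun x => hM _)
    (dependsOn_seqShift hF s)) ?_
  convert! tendsto_cycMean_integral hd hν hM hF using 2 with N
  rw [← cycMean_rotate (s : ZMod (N + 1)) fun w : ZMod (N + 1) → A => F (win w 0)]
  simp only [win_rotate, seqShift_win]

omit [NeZero n] in
/-- Mixing of the stationary chain. -/
theorem abs_integral_mul_seqShift_sub_le {K L : ℕ} (hK : 1 ≤ K) {F G : (ℕ → A) → ℝ} {M M' : ℝ}
    (hM : ∀ x, |F x| ≤ M) (hM' : ∀ x, |G x| ≤ M') (hF : DependsOn F (Set.Iio K))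
    (hG : DependsOn G (Set.Iio K)) :
    |∫ x, F x * G (seqShift (K + L) x) ∂ν - (∫ x, F x ∂ν) * ∫ x, G x ∂ν| ≤
      18 * (1 / 2) ^ L * (M * M') := by
  have hM0 : 0 ≤ M := (abs_nonneg _).trans (hM fun _ => Classical.arbitrary A)
  have hFG : ∀ x y, |F x * G y| ≤ M * M' := fun x y => by
    rw [abs_mul]; exact mul_le_mul (hM _) (hM' _) (abs_nonneg _) hM0
  have t1 := tendsto_cycMean_integral hd hν (F := fun x => F x * G (seqShift (K + L) x))
    (fun x => hFG _ _) (m := K + L + K)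
    (dependsOn_comp₂ (hF.mono (Set.Iio_subset_Iio (by omega))) (dependsOn_seqShift hG _) _)
  have t2 := (tendsto_cycMean_integral hd hν hM hF).mul (tendsto_cycMean_integral hd hν hM' hG)
  refine le_of_tendsto (t1.sub t2).abs ?_
  filter_upwards [eventually_ge_atTop (K + L + K + L + 1)] with N hN
  have h := norm_cycMean_mixing (n := N + 1) hd (m := K) (L := L) hK (by omega)
    (F := fun w w' => F (win w 0) * G (win w' ((K + L : ℕ) : ZMod (N + 1))))
    (fun w w' => hFG _ _) (fun w' => by
      have := dependsOn_win (n := N + 1) hF 0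
      simp only [Nat.cast_zero, zero_add] at this
      exact fun w1 w2 h => by simp only [this h])
    (fun w => by
      have := dependsOn_win (n := N + 1) hG (K + L)
      exact fun w1 w2 h => by
        simp only [this fun i hi => h i (arc_mono le_rfl (by omega) hi)])
  have e1 : cycMean d (fun w : ZMod (N + 1) → A => G (win w ((K + L : ℕ) : ZMod (N + 1)))) =
      cycMean d (fun w : ZMod (N + 1) → A => G (win w 0)) := by
    rw [← cycMean_rotate ((K + L : ℕ) : ZMod (N + 1)) fun w : ZMod (N + 1) → A => G (win w 0)]
    simp only [win_rotate, zero_add]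
  have e2 : cycMean d (fun w : ZMod (N + 1) → A => cycMean d fun w' : ZMod (N + 1) → A =>
      F (win w 0) * G (win w' ((K + L : ℕ) : ZMod (N + 1)))) =
      cycMean d (fun w : ZMod (N + 1) → A => F (win w 0)) *
        cycMean d (fun w : ZMod (N + 1) → A => G (win w 0)) := by
    simp only [cycMean_const_mul, e1]
    simp only [mul_comm _ (cycMean d fun w : ZMod (N + 1) → A => G (win w 0)), cycMean_const_mul]
  rw [e2] at h
  simpa only [seqShift_win, zero_add, Real.norm_eq_abs] using h

end Windows

/-! ### The characteristic function of a sum over a random cyclic word -/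

section CharFun

theorem norm_cexp_I_sub_le (x y : ℝ) :
    ‖Complex.exp (Complex.I * x) - Complex.exp (Complex.I * y)‖ ≤ |x - y| := by
  have e : Complex.exp (Complex.I * x) - Complex.exp (Complex.I * y) =
      Complex.exp (Complex.I * y) * (Complex.exp (Complex.I * ((x - y : ℝ) : ℂ)) - 1) := by
    rw [mul_sub, ← Complex.exp_add]; push_cast; ring_nf
  rw [e, norm_mul, mul_comm Complex.I, Complex.norm_exp_ofReal_mul_I, one_mul]
  exact Real.norm_exp_I_mul_ofReal_sub_one_le

theorem norm_cexp_I_taylor (x : ℝ) :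
    ‖Complex.exp (Complex.I * x) - 1 - Complex.I * x‖ ≤ 2 * x ^ 2 := by
  have hx : ‖Complex.I * (x : ℂ)‖ = |x| := by simp
  rcases le_total |x| 1 with h | h
  · have := Complex.norm_exp_sub_one_sub_id_le (x := Complex.I * x) (by rwa [hx])
    rw [hx, sq_abs] at this
    nlinarith [sq_nonneg x]
  · have h1 := norm_sub_le (Complex.exp (Complex.I * x) - 1) (Complex.I * x)
    have h2 : ‖Complex.exp (Complex.I * x) - 1‖ ≤ |x| := Real.norm_exp_I_mul_ofReal_sub_one_le
    rw [hx] at h1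
    nlinarith [sq_abs x]

variable {A : Type*} [Fintype A] [Nonempty A] {n : ℕ} [NeZero n] {d : A → A → ℝ}

/-- The sum of `f` over the windows starting at the positions `a, …, b - 1`. -/
noncomputable def arcSum (f : (ℕ → A) → ℝ) (a b : ℕ) (w : ZMod n → A) : ℝ :=
  ∑ j ∈ Finset.Ico a b, f (win w (j : ZMod n))

/-- The sum of `f` over all windows of a cyclic word. -/
noncomputable def cycSum (f : (ℕ → A) → ℝ) (w : ZMod n → A) : ℝ := ∑ z, f (win w z)

/-- The local variance: the sum of the covariances of one term with its neighbours at distance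
at most `2 K`. -/
noncomputable def localVar (n : ℕ) [NeZero n] (d : A → A → ℝ) (K : ℕ) (f : (ℕ → A) → ℝ) : ℝ :=
  cycMean d fun w : ZMod n → A => f (win w ((2 * K : ℕ) : ZMod n)) * arcSum f 0 (4 * K) w

/-- The characteristic function of `cycSum f`. -/
noncomputable def cycChar (n : ℕ) [NeZero n] (d : A → A → ℝ) (f : (ℕ → A) → ℝ) (s : ℝ) : ℂ :=
  cycMean d fun w : ZMod n → A => Complex.exp (Complex.I * ((s * cycSum f w : ℝ) : ℂ))

variable {f : (ℕ → A) → ℝ} {b : ℝ} {K : ℕ}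

omit [Fintype A] [Nonempty A] [NeZero n] in
theorem abs_arcSum_le (hb : ∀ x, |f x| ≤ b) {a c m : ℕ} (hm : c = a + m) (w : ZMod n → A) :
    |arcSum f a c w| ≤ m * b := by
  refine (Finset.abs_sum_le_sum_abs _ _).trans ((Finset.sum_le_card_nsmul _ _ b
    fun j _ => hb _).trans ?_)
  simp [hm]

omit [Fintype A] [Nonempty A] in
theorem cycSum_eq_arcSum (w : ZMod n → A) : cycSum f w = arcSum f 0 n w := by
  rw [cycSum, sum_zmod_eq_range, arcSum, Finset.range_eq_Ico]

omit [Fintype A] [Nonempty A] [NeZero n] in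
theorem arcSum_add {a c e : ℕ} (h1 : a ≤ c) (h2 : c ≤ e) (w : ZMod n → A) :
    arcSum f a c w + arcSum f c e w = arcSum f a e w :=
  Finset.sum_Ico_consecutive _ h1 h2

omit [Fintype A] [Nonempty A] [NeZero n] in
theorem arcSum_rotate (s a c : ℕ) (w : ZMod n → A) :
    arcSum f a c (fun z => w (z + (s : ZMod n))) = arcSum f (a + s) (c + s) w := by
  simp only [arcSum, win_rotate]
  rw [← Finset.sum_Ico_add' (fun j : ℕ => f (win w (j : ZMod n)))]
  simp

omit [Fintype A] [Nonempty A] in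
theorem cycSum_rotate (s : ZMod n) (w : ZMod n → A) :
    cycSum f (fun z => w (z + s)) = cycSum f w := by
  simp only [cycSum, win_rotate]
  exact Equiv.sum_comp (Equiv.addRight s) fun z => f (win w z)

omit [Fintype A] [Nonempty A] [NeZero n] in
theorem arcSum_dependsOn (hf : DependsOn f (Set.Iio K)) {a c p q : ℕ} (h1 : p ≤ a)
    (h2 : c + K ≤ q + 1) : DependsOn (arcSum (n := n) f a c) (arc n p q) := by
  intro w w' h
  refine Finset.sum_congr rfl fun j hj => ?_
  have hj' := Finset.mem_Ico.1 hj
  exact dependsOn_win hf j fun i hi => h i (arc_mono (by omega) (by omega) hi)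

omit [Nonempty A] in
theorem hasDerivAt_cycChar (s : ℝ) :
    HasDerivAt (cycChar n d f)
      (cycMean d fun w : ZMod n → A => Complex.I * ((cycSum f w : ℝ) : ℂ) *
        Complex.exp (Complex.I * ((s * cycSum f w : ℝ) : ℂ))) s := by
  have e : cycChar n d f = fun s => ∑ w : ZMod n → A,
      ((∑ w' : ZMod n → A, cycWeight d w')⁻¹ * cycWeight d w) •
        Complex.exp (Complex.I * ((s * cycSum f w : ℝ) : ℂ)) := by
    funext s; rw [cycChar, cycMean_eq_sum]
  rw [e, cycMean_eq_sum]
  refine HasDerivAt.fun_sum fun w _ => HasDerivAt.fun_const_smul _ ?_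
  have h1 : HasDerivAt (fun s : ℝ => Complex.I * ((s * cycSum f w : ℝ) : ℂ))
      (Complex.I * ((cycSum f w : ℝ) : ℂ)) s := by
    refine HasDerivAt.const_mul _ ?_
    have := ((hasDerivAt_id s).mul_const (cycSum f w)).ofReal_comp
    simpa using this
  have := h1.cexp
  rwa [mul_comm] at this

variable (hd : IsChainDensity d)
include hd

omit hd [Nonempty A] in
/-- By rotation invariance all terms of the sum contribute equally to the derivative of the
characteristic function. -/
theorem cycMean_cycSum_mul_exp (c : ℕ) (s : ℝ) :
    (cycMean d fun w : ZMod n → A => Complex.I * ((cycSum f w : ℝ) : ℂ) *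
        Complex.exp (Complex.I * ((s * cycSum f w : ℝ) : ℂ))) =
      Complex.I * (n * cycMean d fun w : ZMod n → A => ((f (win w (c : ZMod n)) : ℝ) : ℂ) *
        Complex.exp (Complex.I * ((s * cycSum f w : ℝ) : ℂ))) := by
  have e : (fun w : ZMod n → A => Complex.I * ((cycSum f w : ℝ) : ℂ) *
        Complex.exp (Complex.I * ((s * cycSum f w : ℝ) : ℂ))) = fun w =>
      Complex.I * ∑ z, ((f (win w z) : ℝ) : ℂ) *
        Complex.exp (Complex.I * ((s * cycSum f w : ℝ) : ℂ)) := by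
    funext w
    rw [← Finset.sum_mul, mul_assoc]
    simp [cycSum]
  rw [e, cycMean_mul_complex, cycMean_sum]
  congr 1
  have h : ∀ z : ZMod n, (cycMean d fun w : ZMod n → A => ((f (win w z) : ℝ) : ℂ) *
        Complex.exp (Complex.I * ((s * cycSum f w : ℝ) : ℂ))) =
      cycMean d fun w : ZMod n → A => ((f (win w (c : ZMod n)) : ℝ) : ℂ) *
        Complex.exp (Complex.I * ((s * cycSum f w : ℝ) : ℂ)) := by
    intro z
    rw [← cycMean_rotate (z - (c : ZMod n)) fun w : ZMod n → A =>
      ((f (win w (c : ZMod n)) : ℝ) : ℂ) *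
        Complex.exp (Complex.I * ((s * cycSum f w : ℝ) : ℂ))]
    simp only [win_rotate, cycSum_rotate, add_sub_cancel]
  simp only [h, Finset.sum_const, Finset.card_univ, ZMod.card, nsmul_eq_mul]

variable [MeasurableSpace A] {ν : Measure (ℕ → A)} (hν : IsChainLaw d ν)

omit hd [Fintype A] [Nonempty A] [NeZero n] [MeasurableSpace A] in
theorem norm_cexp_I (x : ℝ) : ‖Complex.exp (Complex.I * (x : ℂ))‖ = 1 := by
  rw [mul_comm, Complex.norm_exp_ofReal_mul_I]

include hν in
/-- The far part of the sum is nearly independent of the term at position `2 K`, which is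
centred. -/
theorem norm_cycMean_term_mul_far_le (hf : DependsOn f (Set.Iio K)) (hK : 1 ≤ K)
    (hb : ∀ x, |f x| ≤ b) (h0 : ∫ x, f x ∂ν = 0) (hn : 16 * K ≤ n) (s : ℝ) :
    ‖cycMean d fun w : ZMod n → A => ((f (win w ((2 * K : ℕ) : ZMod n)) : ℝ) : ℂ) *
      Complex.exp (Complex.I * ((s * arcSum f (4 * K) n w : ℝ) : ℂ))‖ ≤
      24 * (1 / 2) ^ K * b := by
  have hb0 : 0 ≤ b := (abs_nonneg _).trans (hb fun _ => Classical.arbitrary A)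
  have hn2 : 2 ≤ n := by omega
  have e : (cycMean d fun w : ZMod n → A => ((f (win w ((2 * K : ℕ) : ZMod n)) : ℝ) : ℂ) *
      Complex.exp (Complex.I * ((s * arcSum f (4 * K) n w : ℝ) : ℂ))) =
      cycMean d fun w : ZMod n → A => ((f (win w 0) : ℝ) : ℂ) *
      Complex.exp (Complex.I * ((s * arcSum f (2 * K) (n - 2 * K) w : ℝ) : ℂ)) := by
    rw [← cycMean_rotate ((2 * K : ℕ) : ZMod n) fun w : ZMod n → A => ((f (win w 0) : ℝ) : ℂ) *
      Complex.exp (Complex.I * ((s * arcSum f (2 * K) (n - 2 * K) w : ℝ) : ℂ))]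
    simp only [win_rotate, arcSum_rotate, zero_add]
    rw [show 2 * K + 2 * K = 4 * K by ring, show n - 2 * K + 2 * K = n by omega]
  rw [e]
  have mix := norm_cycMean_mixing hd (n := n) (m := K) (L := K) hK (by omega) (M := b)
    (F := fun w w' : ZMod n → A => ((f (win w 0) : ℝ) : ℂ) *
      Complex.exp (Complex.I * ((s * arcSum f (2 * K) (n - 2 * K) w' : ℝ) : ℂ)))
    (fun w w' => by rw [norm_mul, norm_cexp_I, mul_one, Complex.norm_real]; exact hb _)
    (fun w' w1 w2 h => by
      have := dependsOn_win (n := n) hf 0 (x := w1) (y := w2)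
        (fun i hi => h i (by simpa using hi))
      simp only [Nat.cast_zero] at this
      simp only [this])
    (fun w w1 w2 h => by
      have := arcSum_dependsOn hf (n := n) (a := 2 * K) (c := n - 2 * K) (p := K + K)
        (q := n - K) (by omega) (by omega) h
      simp only [this])
  simp only [cycMean_mul_complex] at mix
  have e2 : (cycMean d fun w : ZMod n → A => ((f (win w 0) : ℝ) : ℂ) *
      cycMean d fun w' : ZMod n → A =>
        Complex.exp (Complex.I * ((s * arcSum f (2 * K) (n - 2 * K) w' : ℝ) : ℂ))) =
      ((cycMean d fun w : ZMod n → A => f (win w 0) : ℝ) : ℂ) * cycMean d fun w' : ZMod n → A =>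
        Complex.exp (Complex.I * ((s * arcSum f (2 * K) (n - 2 * K) w' : ℝ) : ℂ)) := by
    rw [← cycMean_ofReal, ← cycMean_complex_mul]
  rw [e2] at mix
  have h1 := abs_cycMean_sub_integral_le (n := n) hd hν (m := K) (L := K) hK (by omega) hb hf
  rw [h0, sub_zero] at h1
  have h2 : ‖cycMean d fun w' : ZMod n → A =>
      Complex.exp (Complex.I * ((s * arcSum f (2 * K) (n - 2 * K) w' : ℝ) : ℂ))‖ ≤ 1 :=
    norm_cycMean_le_of_le hd hn2 fun w => (norm_cexp_I _).le
  have h3 : ‖((cycMean d fun w : ZMod n → A => f (win w 0) : ℝ) : ℂ) *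
      cycMean d fun w' : ZMod n → A =>
      Complex.exp (Complex.I * ((s * arcSum f (2 * K) (n - 2 * K) w' : ℝ) : ℂ))‖ ≤
      6 * (1 / 2) ^ K * b := by
    rw [norm_mul, Complex.norm_real]
    exact (mul_le_of_le_one_right (norm_nonneg _) h2).trans h1
  have := norm_add_le_of_le mix h3
  rw [sub_add_cancel] at this
  linarith

omit [MeasurableSpace A] in
/-- The product of the term at position `2 K` with the near part of the sum is nearly independent
of the part of the sum that is still farther away. -/
theorem norm_cycMean_near_mul_far_le (hf : DependsOn f (Set.Iio K)) (hK : 1 ≤ K)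
    (hb : ∀ x, |f x| ≤ b) (hn : 16 * K ≤ n) (s : ℝ) :
    ‖(cycMean d fun w : ZMod n → A =>
      ((f (win w ((2 * K : ℕ) : ZMod n)) * arcSum f 0 (4 * K) w : ℝ) : ℂ) *
        Complex.exp (Complex.I * ((s * arcSum f (6 * K) (n - 2 * K) w : ℝ) : ℂ))) -
      localVar n d K f * cycChar n d f s‖ ≤
      18 * (1 / 2) ^ K * (4 * K * b ^ 2) + |s| * (4 * K * b ^ 2) * (8 * K * b) := by
  have hb0 : 0 ≤ b := (abs_nonneg _).trans (hb fun _ => Classical.arbitrary A)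
  have hn2 : 2 ≤ n := by omega
  have hXR : ∀ w : ZMod n → A, |f (win w ((2 * K : ℕ) : ZMod n)) * arcSum f 0 (4 * K) w| ≤
      4 * K * b ^ 2 := fun w => by
    have h1 := abs_arcSum_le hb (a := 0) (c := 4 * K) (m := 4 * K) (by omega) w
    push_cast at h1
    rw [abs_mul]
    calc _ ≤ b * (4 * K * b) := mul_le_mul (hb _) h1 (abs_nonneg _) hb0
      _ = _ := by ring
  have mix := norm_cycMean_mixing hd (n := n) (m := 5 * K) (L := K) (by omega) (by omega)
    (M := 4 * K * b ^ 2)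
    (F := fun w w' : ZMod n → A =>
      ((f (win w ((2 * K : ℕ) : ZMod n)) * arcSum f 0 (4 * K) w : ℝ) : ℂ) *
      Complex.exp (Complex.I * ((s * arcSum f (6 * K) (n - 2 * K) w' : ℝ) : ℂ)))
    (fun w w' => by rw [norm_mul, norm_cexp_I, mul_one, Complex.norm_real]; exact hXR _)
    (fun w' w1 w2 h => by
      have h1 := dependsOn_win (n := n) hf (2 * K) (x := w1) (y := w2)
        (fun i hi => h i (arc_mono (by omega) (by omega) hi))
      have h2 := arcSum_dependsOn hf (n := n) (a := 0) (c := 4 * K) (p := 0)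
        (q := 5 * K) (by omega) (by omega) h
      simp only [h1, h2])
    (fun w w1 w2 h => by
      have := arcSum_dependsOn hf (n := n) (a := 6 * K) (c := n - 2 * K) (p := 5 * K + K)
        (q := n - K) (by omega) (by omega) h
      simp only [this])
  simp only [cycMean_mul_complex] at mix
  set T := cycMean d fun w' : ZMod n → A =>
        Complex.exp (Complex.I * ((s * arcSum f (6 * K) (n - 2 * K) w' : ℝ) : ℂ)) with hT
  have e2 : (cycMean d fun w : ZMod n → A =>
      ((f (win w ((2 * K : ℕ) : ZMod n)) * arcSum f 0 (4 * K) w : ℝ) : ℂ) * T) =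
      localVar n d K f * T := by
    rw [localVar, ← cycMean_ofReal, ← cycMean_complex_mul]
  rw [e2] at mix
  have hv : ‖((localVar n d K f : ℝ) : ℂ)‖ ≤ 4 * K * b ^ 2 := by
    rw [Complex.norm_real]
    exact norm_cycMean_le_of_le hd hn2 hXR
  have hTφ : ‖T - cycChar n d f s‖ ≤ |s| * (8 * K * b) := by
    rw [hT, cycChar, ← cycMean_sub]
    refine norm_cycMean_le_of_le hd hn2 fun w => (norm_cexp_I_sub_le _ _).trans ?_
    rw [← mul_sub, abs_mul]
    refine mul_le_mul_of_nonneg_left ?_ (abs_nonneg s)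
    have h1 := arcSum_add (f := f) (a := 0) (c := 6 * K) (e := n) (by omega) (by omega) w
    have h2 := arcSum_add (f := f) (a := 6 * K) (c := n - 2 * K) (e := n) (by omega) (by omega) w
    have h3 := abs_arcSum_le hb (a := 0) (c := 6 * K) (m := 6 * K) (by omega) w
    have h4 := abs_arcSum_le hb (a := n - 2 * K) (c := n) (m := 2 * K) (by omega) w
    push_cast at h3 h4
    rw [cycSum_eq_arcSum, ← h1, ← h2, abs_le]
    rw [abs_le] at h3 h4
    constructor <;> linarith [h3.1, h3.2, h4.1, h4.2]
  have h5 : ‖(localVar n d K f : ℂ) * T - localVar n d K f * cycChar n d f s‖ ≤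
      |s| * (4 * K * b ^ 2) * (8 * K * b) := by
    rw [← mul_sub, norm_mul]
    calc _ ≤ (4 * K * b ^ 2) * (|s| * (8 * K * b)) :=
          mul_le_mul hv hTφ (norm_nonneg _) (by positivity)
      _ = _ := by ring
  exact (norm_sub_le_norm_sub_add_norm_sub _ _ _).trans (add_le_add mix h5)

include hν in
/-- One step of Stein's method: the exponential is expanded to first order in the near part `R` of
the sum around the term at position `2 K`. The zeroth order term is small since this term is
centred, and the first order term gives the local variance. -/
theorem norm_cycMean_term_mul_exp_sub_le (hf : DependsOn f (Set.Iio K)) (hK : 1 ≤ K)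
    (hb : ∀ x, |f x| ≤ b) (h0 : ∫ x, f x ∂ν = 0) (hn : 16 * K ≤ n) (s : ℝ) :
    ‖(cycMean d fun w : ZMod n → A => ((f (win w ((2 * K : ℕ) : ZMod n)) : ℝ) : ℂ) *
        Complex.exp (Complex.I * ((s * cycSum f w : ℝ) : ℂ))) -
      Complex.I * s * (localVar n d K f * cycChar n d f s)‖ ≤
      80 * s ^ 2 * K ^ 2 * b ^ 3 + (1 / 2) ^ K * b * (24 + 72 * |s| * K * b) := by
  have hb0 : 0 ≤ b := (abs_nonneg _).trans (hb fun _ => Classical.arbitrary A)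
  have hn2 : 2 ≤ n := by omega
  have h1 := norm_cycMean_term_mul_far_le hd hν hf hK hb h0 hn s
  have h2 := norm_cycMean_near_mul_far_le hd hf hK hb hn s
  set X : (ZMod n → A) → ℝ := fun w => f (win w ((2 * K : ℕ) : ZMod n)) with hX
  set R : (ZMod n → A) → ℝ := arcSum f 0 (4 * K) with hR
  set T : (ZMod n → A) → ℝ := arcSum f (4 * K) n with hT
  set T2 : (ZMod n → A) → ℝ := arcSum f (6 * K) (n - 2 * K) with hT2
  have hS : ∀ w, cycSum f w = R w + T w := fun w => by
    rw [cycSum_eq_arcSum, hR, hT, arcSum_add (by omega) (by omega)]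
  have hRb : ∀ w, |R w| ≤ 4 * K * b := fun w => by
    have := abs_arcSum_le hb (a := 0) (c := 4 * K) (m := 4 * K) (by omega) w
    push_cast at this; exact this
  have hTb : ∀ w, |T w - T2 w| ≤ 4 * K * b := fun w => by
    have h1 := arcSum_add (f := f) (a := 4 * K) (c := 6 * K) (e := n) (by omega) (by omega) w
    have h2 := arcSum_add (f := f) (a := 6 * K) (c := n - 2 * K) (e := n) (by omega) (by omega) w
    have h3 := abs_arcSum_le hb (a := 4 * K) (c := 6 * K) (m := 2 * K) (by omega) w
    have h4 := abs_arcSum_le hb (a := n - 2 * K) (c := n) (m := 2 * K) (by omega) w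
    push_cast at h3 h4
    rw [hT, hT2, ← h1, ← h2, abs_le]
    rw [abs_le] at h3 h4
    constructor <;> linarith [h3.1, h3.2, h4.1, h4.2]
  -- the Taylor remainder, and the effect of widening the gap between `R` and the far part
  set e1 : (ZMod n → A) → ℂ := fun w => (X w : ℂ) *
    (Complex.exp (Complex.I * ((s * cycSum f w : ℝ) : ℂ)) -
      Complex.exp (Complex.I * ((s * T w : ℝ) : ℂ)) * (1 + Complex.I * ((s * R w : ℝ) : ℂ)))
    with he1
  set e2 : (ZMod n → A) → ℂ := fun w => Complex.I * s * ((X w * R w : ℝ) : ℂ) *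
    (Complex.exp (Complex.I * ((s * T w : ℝ) : ℂ)) -
      Complex.exp (Complex.I * ((s * T2 w : ℝ) : ℂ))) with he2
  have dec : (fun w => (X w : ℂ) * Complex.exp (Complex.I * ((s * cycSum f w : ℝ) : ℂ))) =
      fun w => ((X w : ℂ) * Complex.exp (Complex.I * ((s * T w : ℝ) : ℂ)) +
        Complex.I * s * (((X w * R w : ℝ) : ℂ) *
          Complex.exp (Complex.I * ((s * T2 w : ℝ) : ℂ)))) + (e1 w + e2 w) := by
    funext w
    simp only [he1, he2]
    push_cast
    ring
  have hexp : ∀ w, ‖Complex.exp (Complex.I * ((s * cycSum f w : ℝ) : ℂ)) -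
      Complex.exp (Complex.I * ((s * T w : ℝ) : ℂ)) * (1 + Complex.I * ((s * R w : ℝ) : ℂ))‖ ≤
      2 * (s * R w) ^ 2 := fun w => by
    have : Complex.exp (Complex.I * ((s * cycSum f w : ℝ) : ℂ)) -
        Complex.exp (Complex.I * ((s * T w : ℝ) : ℂ)) * (1 + Complex.I * ((s * R w : ℝ) : ℂ)) =
        Complex.exp (Complex.I * ((s * T w : ℝ) : ℂ)) *
          (Complex.exp (Complex.I * ((s * R w : ℝ) : ℂ)) - 1 -
            Complex.I * ((s * R w : ℝ) : ℂ)) := by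
      rw [hS, mul_sub, mul_sub, ← Complex.exp_add]
      push_cast
      ring_nf
    rw [this, norm_mul, norm_cexp_I, one_mul]
    exact norm_cexp_I_taylor _
  have b1 : ‖cycMean d e1‖ ≤ 32 * s ^ 2 * K ^ 2 * b ^ 3 := by
    refine norm_cycMean_le_of_le hd hn2 fun w => ?_
    rw [he1, norm_mul, Complex.norm_real]
    have : (s * R w) ^ 2 ≤ s ^ 2 * (4 * K * b) ^ 2 := by
      rw [mul_pow]
      refine mul_le_mul_of_nonneg_left ?_ (sq_nonneg s)
      rw [← sq_abs (R w)]
      exact pow_le_pow_left₀ (abs_nonneg _) (hRb w) 2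
    calc _ ≤ b * (2 * (s ^ 2 * (4 * K * b) ^ 2)) :=
          mul_le_mul (hb _) ((hexp w).trans (by linarith)) (norm_nonneg _) hb0
      _ = _ := by ring
  have b2 : ‖cycMean d e2‖ ≤ 16 * s ^ 2 * K ^ 2 * b ^ 3 := by
    refine norm_cycMean_le_of_le hd hn2 fun w => ?_
    rw [he2, norm_mul, norm_mul, norm_mul, Complex.norm_I, one_mul, Complex.norm_real,
      Complex.norm_real, Real.norm_eq_abs, Real.norm_eq_abs, abs_mul]
    have h3 : ‖Complex.exp (Complex.I * ((s * T w : ℝ) : ℂ)) -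
        Complex.exp (Complex.I * ((s * T2 w : ℝ) : ℂ))‖ ≤ |s| * (4 * K * b) := by
      refine (norm_cexp_I_sub_le _ _).trans ?_
      rw [← mul_sub, abs_mul]
      exact mul_le_mul_of_nonneg_left (hTb w) (abs_nonneg s)
    calc _ ≤ |s| * (b * (4 * K * b)) * (|s| * (4 * K * b)) := by
          refine mul_le_mul (mul_le_mul_of_nonneg_left ?_ (abs_nonneg s)) h3 (norm_nonneg _)
            (by positivity)
          exact mul_le_mul (hb _) (hRb w) (abs_nonneg _) hb0
      _ = 16 * |s| ^ 2 * K ^ 2 * b ^ 3 := by ring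
      _ = _ := by rw [sq_abs]
  rw [dec, cycMean_add, cycMean_add, cycMean_add, cycMean_mul_complex]
  have e : ∀ a b c v x : ℂ, a + x * b + c - x * v = a + x * (b - v) + c := fun a b c v x => by ring
  rw [e]
  have h4 : ‖Complex.I * (s : ℂ) * ((cycMean d fun w => ((X w * R w : ℝ) : ℂ) *
          Complex.exp (Complex.I * ((s * T2 w : ℝ) : ℂ))) - localVar n d K f * cycChar n d f s)‖ ≤
      |s| * (18 * (1 / 2) ^ K * (4 * K * b ^ 2) + |s| * (4 * K * b ^ 2) * (8 * K * b)) := by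
    rw [norm_mul, norm_mul, Complex.norm_I, one_mul, Complex.norm_real]
    exact mul_le_mul_of_nonneg_left h2 (abs_nonneg s)
  have h6 := norm_add₃_le (a := cycMean d fun w : ZMod n → A =>
      (X w : ℂ) * Complex.exp (Complex.I * ((s * T w : ℝ) : ℂ)))
    (b := Complex.I * (s : ℂ) * ((cycMean d fun w => ((X w * R w : ℝ) : ℂ) *
      Complex.exp (Complex.I * ((s * T2 w : ℝ) : ℂ))) - localVar n d K f * cycChar n d f s))
    (c := cycMean d e1 + cycMean d e2)
  have h7 := norm_add_le_of_le b1 b2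
  have h8 : |s| * (|s| * (4 * K * b ^ 2) * (8 * K * b)) = 32 * s ^ 2 * K ^ 2 * b ^ 3 := by
    rw [← sq_abs s]; ring
  rw [mul_add, h8] at h4
  refine h6.trans ((add_le_add (add_le_add h1 h4) h7).trans (le_of_eq ?_))
  ring

include hν in
/-- **Quantitative central limit theorem** for local functions of random cyclic words: the
characteristic function nearly solves `φ' = - n v s φ`, where `v` is the local variance. -/
theorem norm_cycChar_sub_le (hf : DependsOn f (Set.Iio K)) (hK : 1 ≤ K)
    (hb : ∀ x, |f x| ≤ b) (h0 : ∫ x, f x ∂ν = 0) (hn : 16 * K ≤ n) (s : ℝ) :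
    ‖cycChar n d f s - Complex.exp ((-(n * localVar n d K f * s ^ 2 / 2) : ℝ) : ℂ)‖ ≤
      |s| * n * (80 * s ^ 2 * K ^ 2 * b ^ 3 + (1 / 2) ^ K * b * (24 + 72 * |s| * K * b)) *
        Real.exp (n * |localVar n d K f| * s ^ 2) := by
  have hb0 : 0 ≤ b := (abs_nonneg _).trans (hb fun _ => Classical.arbitrary A)
  have hn2 : 2 ≤ n := by omega
  set v := localVar n d K f with hv
  -- the integrating factor of the limiting equation `φ' = - n v r φ`
  set E : ℝ → ℂ := fun r => Complex.exp ((n * v * r ^ 2 / 2 : ℝ) : ℂ) with hE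
  set err : ℝ := 80 * s ^ 2 * K ^ 2 * b ^ 3 + (1 / 2) ^ K * b * (24 + 72 * |s| * K * b) with herr
  have hEn : ∀ r : ℝ, ‖E r‖ = Real.exp (n * v * r ^ 2 / 2) := fun r => by
    rw [hE, Complex.norm_exp_ofReal]
  set D : ℝ → ℂ := fun r => (cycMean d fun w : ZMod n → A =>
    ((f (win w ((2 * K : ℕ) : ZMod n)) : ℝ) : ℂ) *
        Complex.exp (Complex.I * ((r * cycSum f w : ℝ) : ℂ))) with hD
  have der : ∀ r : ℝ, HasDerivAt (fun r => cycChar n d f r * E r)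
      (Complex.I * n * (D r - Complex.I * r * (v * cycChar n d f r)) * E r) r := by
    intro r
    have h1 := hasDerivAt_cycChar (n := n) (d := d) (f := f) r
    rw [cycMean_cycSum_mul_exp (2 * K)] at h1
    have h2 : HasDerivAt E (E r * (((n * v * r : ℝ)) : ℂ)) r := by
      have h3 : HasDerivAt (fun r : ℝ => n * v * r ^ 2 / 2) (n * v * r) r := by
        have := ((hasDerivAt_pow 2 r).const_mul (n * v)).div_const 2
        convert! this using 1
        push_cast; ring
      exact h3.ofReal_comp.cexp
    convert! h1.mul h2 using 1
    simp only [hD]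
    push_cast
    linear_combination (-(n : ℂ) * r * v * cycChar n d f r * E r) * Complex.I_mul_I
  have hbound : ∀ r ∈ Metric.closedBall (0 : ℝ) |s|,
      ‖Complex.I * n * (D r - Complex.I * r * (v * cycChar n d f r)) * E r‖ ≤
        n * err * Real.exp (n * |v| * s ^ 2 / 2) := by
    intro r hr
    have hr' : |r| ≤ |s| := by simpa using hr
    have hr2 : r ^ 2 ≤ s ^ 2 := sq_le_sq.2 hr'
    rw [norm_mul, norm_mul, norm_mul, Complex.norm_I, one_mul, hEn, Complex.norm_natCast]
    have h1 := norm_cycMean_term_mul_exp_sub_le hd hν hf hK hb h0 hn r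
    have h2 : 80 * r ^ 2 * K ^ 2 * b ^ 3 + (1 / 2) ^ K * b * (24 + 72 * |r| * K * b) ≤ err := by
      rw [herr]; gcongr
    have h3 : n * v * r ^ 2 / 2 ≤ n * |v| * s ^ 2 / 2 := by
      have : n * v * r ^ 2 ≤ n * |v| * s ^ 2 := by
        gcongr
        exact le_abs_self v
      linarith
    exact mul_le_mul (mul_le_mul_of_nonneg_left (h1.trans h2) (Nat.cast_nonneg n))
      (Real.exp_le_exp.2 h3) (Real.exp_pos _).le (by positivity)
  -- `φ E` is nearly constant, and equals `1` at `0`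
  have mv := (convex_closedBall (0 : ℝ) |s|).norm_image_sub_le_of_norm_hasDerivWithin_le
    (fun r _ => (der r).hasDerivWithinAt) hbound (x := 0) (y := s) (by simp) (by simp)
  have hφ0 : cycChar n d f 0 = 1 := by
    simp only [cycChar, zero_mul, Complex.ofReal_zero, mul_zero, Complex.exp_zero]
    exact cycMean_const hd hn2 1
  have hE0 : E 0 = 1 := by simp [hE]
  rw [hφ0, hE0, mul_one, sub_zero, Real.norm_eq_abs] at mv
  have hE' : Complex.exp ((-(n * v * s ^ 2 / 2) : ℝ) : ℂ) * E s = 1 := by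
    rw [hE, ← Complex.exp_add]; push_cast; simp
  have e : cycChar n d f s - Complex.exp ((-(n * v * s ^ 2 / 2) : ℝ) : ℂ) =
      Complex.exp ((-(n * v * s ^ 2 / 2) : ℝ) : ℂ) * (cycChar n d f s * E s - 1) := by
    linear_combination (-cycChar n d f s) * hE'
  rw [e, norm_mul, Complex.norm_exp_ofReal]
  have h4 : Real.exp (-(n * v * s ^ 2 / 2)) ≤ Real.exp (n * |v| * s ^ 2 / 2) := by
    refine Real.exp_le_exp.2 ?_
    have : -(n * v * s ^ 2) ≤ n * |v| * s ^ 2 := by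
      have : n * s ^ 2 * (-v) ≤ n * s ^ 2 * |v| :=
        mul_le_mul_of_nonneg_left (neg_le_abs v) (by positivity)
      linarith
    linarith
  refine (mul_le_mul h4 mv (norm_nonneg _) (Real.exp_pos _).le).trans (le_of_eq ?_)
  have h5 : Real.exp (n * |v| * s ^ 2) =
      Real.exp (n * |v| * s ^ 2 / 2) * Real.exp (n * |v| * s ^ 2 / 2) := by
    rw [← Real.exp_add]; congr 1; ring
  rw [h5]; ring

end CharFun

/-! ### The degenerate part of the U-statistic -/

section Degenerate

variable {A : Type*} [Fintype A] [Nonempty A] {n : ℕ} [NeZero n] {d : A → A → ℝ}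

/-- The indicator that the cyclic distance of two positions is less than `2 K`. -/
def nearInd (K : ℕ) (z z' : ZMod n) : ℝ :=
  if (z' - z).val < 2 * K ∨ n - 2 * K < (z' - z).val then 1 else 0

omit [NeZero n] in
theorem nearInd_nonneg (K : ℕ) (z z' : ZMod n) : 0 ≤ nearInd K z z' := by
  rw [nearInd]; split_ifs <;> norm_num

theorem sum_val_near_le (K : ℕ) :
    ∑ t : ZMod n, (if t.val < 2 * K ∨ n - 2 * K < t.val then (1 : ℝ) else 0) ≤ 4 * K := by
  rw [Finset.sum_boole]
  have : (Finset.univ.filter fun t : ZMod n => t.val < 2 * K ∨ n - 2 * K < t.val).card ≤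
      4 * K := by
    have h1 : ((Finset.univ.filter fun t : ZMod n => t.val < 2 * K ∨ n - 2 * K < t.val).image
        ZMod.val) ⊆ Finset.range (2 * K) ∪ Finset.Ico (n - 2 * K) n := by
      intro j hj
      obtain ⟨t, ht, rfl⟩ := Finset.mem_image.1 hj
      have h2 := (Finset.mem_filter.1 ht).2
      have h3 := ZMod.val_lt t
      simp only [Finset.mem_union, Finset.mem_range, Finset.mem_Ico]
      omega
    rw [← Finset.card_image_of_injective _ (ZMod.val_injective n)]
    refine (Finset.card_le_card h1).trans ((Finset.card_union_le _ _).trans ?_)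
    simp only [Finset.card_range, Nat.card_Ico]
    omega
  exact_mod_cast this

theorem sum_nearInd_right_le (K : ℕ) (z : ZMod n) : ∑ z', nearInd K z z' ≤ 4 * K := by
  refine le_trans (le_of_eq ?_) (sum_val_near_le (n := n) K)
  exact Equiv.sum_comp (Equiv.subRight z)
    fun t : ZMod n => if t.val < 2 * K ∨ n - 2 * K < t.val then (1 : ℝ) else 0

theorem sum_nearInd_left_le (K : ℕ) (z' : ZMod n) : ∑ z, nearInd K z z' ≤ 4 * K := by
  refine le_trans (le_of_eq ?_) (sum_val_near_le (n := n) K)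
  exact Equiv.sum_comp (Equiv.subLeft z')
    fun t : ZMod n => if t.val < 2 * K ∨ n - 2 * K < t.val then (1 : ℝ) else 0

theorem sum_four_le {Z : Type*} [Fintype Z] {f : Z → Z → Z → Z → ℝ} {u : Z → Z → Z → ℝ}
    {v : Z → Z → ℝ} {α β γ : ℝ} (hβ : 0 ≤ β) (hγ : 0 ≤ γ)
    (h1 : ∀ a b c, ∑ e, f a b c e ≤ γ * u a b c) (h2 : ∀ a b, ∑ c, u a b c ≤ β * v a b)
    (h3 : ∀ a, ∑ b, v a b ≤ α) :
    ∑ a, ∑ b, ∑ c, ∑ e, f a b c e ≤ Fintype.card Z * (α * β * γ) := by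
  have e3 : ∀ a b, ∑ c, ∑ e, f a b c e ≤ γ * (β * v a b) := fun a b => by
    refine (Finset.sum_le_sum fun c _ => h1 a b c).trans ?_
    rw [← Finset.mul_sum]
    exact mul_le_mul_of_nonneg_left (h2 a b) hγ
  have e2 : ∀ a, ∑ b, ∑ c, ∑ e, f a b c e ≤ α * β * γ := fun a => by
    refine (Finset.sum_le_sum fun b _ => e3 a b).trans ?_
    rw [← Finset.mul_sum, ← Finset.mul_sum]
    have := mul_le_mul_of_nonneg_left (mul_le_mul_of_nonneg_left (h3 a) hβ) hγ
    linarith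
  refine (Finset.sum_le_card_nsmul _ _ _ fun a _ => e2 a).trans (le_of_eq ?_)
  rw [nsmul_eq_mul, Finset.card_univ]

/-- The sum bounds the number of quadruples of positions in which each of `a`, `c`, `e` is near one
of the other three: there are only `O(n ^ 2)` of these, since near pairs leave two free choices. -/
theorem sum_near_pairs_le (K : ℕ) :
    ∑ a : ZMod n, ∑ b, ∑ c, ∑ e,
      (nearInd K a b * (nearInd K c a + nearInd K c b + nearInd K c e) +
        nearInd K a c * (nearInd K e a + nearInd K e b + nearInd K e c) +
        nearInd K a e * (nearInd K c a + nearInd K c b + nearInd K c e)) ≤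
      144 * (n : ℝ) ^ 2 * K ^ 2 := by
  have hr := sum_nearInd_right_le (n := n) K
  have hl := sum_nearInd_left_le (n := n) K
  have hK : (0 : ℝ) ≤ 4 * K := by positivity
  have hn0 : (0 : ℝ) ≤ n := by positivity
  have cst : ∀ x : ℝ, ∑ _z : ZMod n, x = n * x := fun x => by
    rw [Finset.sum_const, Finset.card_univ, ZMod.card, nsmul_eq_mul]
  have hN := nearInd_nonneg (n := n) K
  have hmulr : ∀ x : ℝ, 0 ≤ x → ∀ z : ZMod n, ∑ z', x * nearInd K z z' ≤ 4 * K * x :=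
    fun x hx z => by
      rw [← Finset.mul_sum, mul_comm _ x]
      exact mul_le_mul_of_nonneg_left (hr z) hx
  have hmull : ∀ x : ℝ, 0 ≤ x → ∀ z' : ZMod n, ∑ z, x * nearInd K z z' ≤ 4 * K * x :=
    fun x hx z => by
      rw [← Finset.mul_sum, mul_comm _ x]
      exact mul_le_mul_of_nonneg_left (hl z) hx
  have c1 := sum_four_le (Z := ZMod n) (f := fun a b c e => nearInd K a b * nearInd K c a)
    (u := fun a b c => nearInd K a b * nearInd K c a) (v := fun a b => nearInd K a b)
    (α := 4 * K) (β := 4 * K) (γ := n) hK hn0 (fun a b c => (cst _).le)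
    (fun a b => hmull _ (hN _ _) a) hr
  have c2 := sum_four_le (Z := ZMod n) (f := fun a b c e => nearInd K a b * nearInd K c b)
    (u := fun a b c => nearInd K a b * nearInd K c b) (v := fun a b => nearInd K a b)
    (α := 4 * K) (β := 4 * K) (γ := n) hK hn0 (fun a b c => (cst _).le)
    (fun a b => hmull _ (hN _ _) b) hr
  have c3 := sum_four_le (Z := ZMod n) (f := fun a b c e => nearInd K a b * nearInd K c e)
    (u := fun a b c => nearInd K a b) (v := fun a b => nearInd K a b)
    (α := 4 * K) (β := n) (γ := 4 * K) hn0 hK (fun a b c => hmulr _ (hN _ _) c)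
    (fun a b => (cst _).le) hr
  have c4 := sum_four_le (Z := ZMod n) (f := fun a b c e => nearInd K a c * nearInd K e a)
    (u := fun a b c => nearInd K a c) (v := fun a b => 1)
    (α := n * 1) (β := 4 * K) (γ := 4 * K) hK hK (fun a b c => hmull _ (hN _ _) a)
    (fun a b => by simpa using hr a) (fun a => (cst 1).le)
  have c5 := sum_four_le (Z := ZMod n) (f := fun a b c e => nearInd K a c * nearInd K e b)
    (u := fun a b c => nearInd K a c) (v := fun a b => 1)
    (α := n * 1) (β := 4 * K) (γ := 4 * K) hK hK (fun a b c => hmull _ (hN _ _) b)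
    (fun a b => by simpa using hr a) (fun a => (cst 1).le)
  have c6 := sum_four_le (Z := ZMod n) (f := fun a b c e => nearInd K a c * nearInd K e c)
    (u := fun a b c => nearInd K a c) (v := fun a b => 1)
    (α := n * 1) (β := 4 * K) (γ := 4 * K) hK hK (fun a b c => hmull _ (hN _ _) c)
    (fun a b => by simpa using hr a) (fun a => (cst 1).le)
  have sw : ∑ a : ZMod n, ∑ b, ∑ c, ∑ e,
      nearInd K a e * (nearInd K c a + nearInd K c b + nearInd K c e) =
      ∑ a : ZMod n, ∑ b, ∑ c, ∑ e,
        nearInd K a c * (nearInd K e a + nearInd K e b + nearInd K e c) :=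
    Finset.sum_congr rfl fun a _ => Finset.sum_congr rfl fun b _ => Finset.sum_comm
  simp only [Finset.sum_add_distrib, mul_add] at sw ⊢
  rw [ZMod.card] at c1 c2 c3 c4 c5 c6
  have : 144 * (n : ℝ) ^ 2 * K ^ 2 = 9 * (n * (n * (4 * K) * (4 * K))) := by ring
  rw [this]
  have r1 : (n : ℝ) * (4 * K * (4 * K) * n) = n * (n * (4 * K) * (4 * K)) := by ring
  have r2 : (n : ℝ) * (4 * K * n * (4 * K)) = n * (n * (4 * K) * (4 * K)) := by ring
  rw [r1] at c1 c2
  rw [r2] at c3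
  rw [mul_one] at c4 c5 c6
  linarith

variable {g : (ℕ → A) → (ℕ → A) → ℝ} {b : ℝ} {K : ℕ}

/-- The full double sum of a kernel over the windows of a cyclic word. -/
noncomputable def cycSum₂ (g : (ℕ → A) → (ℕ → A) → ℝ) (w : ZMod n → A) : ℝ :=
  ∑ z, ∑ z', g (win w z) (win w z')

variable (hd : IsChainDensity d) [MeasurableSpace A] {ν : Measure (ℕ → A)} (hν : IsChainLaw d ν)
include hd hν

/-- If the position `z₁` is far from the others, it can be integrated out, which gives zero. -/
theorem abs_cycMean_degenerate_le (hg : ∀ y, DependsOn (fun x => g x y) (Set.Iio K))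
    (hs : ∀ x y, g x y = g y x) (hK : 1 ≤ K) (hb : ∀ x y, |g x y| ≤ b)
    (h0 : ∀ y, ∫ x, g x y ∂ν = 0) (hn : 16 * K ≤ n) {z₁ z₂ z₃ z₄ : ZMod n}
    (h2 : nearInd K z₁ z₂ = 0) (h3 : nearInd K z₁ z₃ = 0) (h4 : nearInd K z₁ z₄ = 0) :
    |cycMean d fun w : ZMod n → A =>
      g (win w z₁) (win w z₂) * g (win w z₃) (win w z₄)| ≤ 24 * (1 / 2) ^ K * b ^ 2 := by
  have hb0 : 0 ≤ b := (abs_nonneg _).trans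
    (hb (fun _ => Classical.arbitrary A) fun _ => Classical.arbitrary A)
  have hn2 : 2 ≤ n := by omega
  have far : ∀ z : ZMod n, nearInd K z₁ z = 0 →
      2 * K ≤ (z - z₁).val ∧ (z - z₁).val ≤ n - 2 * K := by
    intro z hz
    rw [nearInd] at hz
    split_ifs at hz with h
    · norm_num at hz
    · omega
  have hwin : ∀ (z : ZMod n) (w : ZMod n → A),
      win w z = win (fun t => w (t + z₁)) (((z - z₁).val : ℕ) : ZMod n) := fun z w => by
    rw [win_rotate]; simp
  have hwin1 : ∀ (w : ZMod n → A), win w z₁ = win (fun t => w (t + z₁)) 0 := fun w => by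
    rw [win_rotate]; simp
  obtain ⟨a2, b2⟩ := far z₂ h2
  obtain ⟨a3, b3⟩ := far z₃ h3
  obtain ⟨a4, b4⟩ := far z₄ h4
  simp only [hwin1, hwin z₂, hwin z₃, hwin z₄]
  generalize (z₂ - z₁).val = j2 at *
  generalize (z₃ - z₁).val = j3 at *
  generalize (z₄ - z₁).val = j4 at *
  rw [cycMean_rotate z₁ fun w : ZMod n → A =>
    g (win w 0) (win w (j2 : ZMod n)) * g (win w (j3 : ZMod n)) (win w (j4 : ZMod n))]
  have hgg : ∀ x y x' y', |g x y * g x' y'| ≤ b ^ 2 := fun x y x' y' => by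
    rw [abs_mul, sq]; exact mul_le_mul (hb _ _) (hb _ _) (abs_nonneg _) hb0
  have hg' : ∀ x, DependsOn (fun y => g x y) (Set.Iio K) := fun x => by
    simpa only [hs x] using hg x
  have mix := norm_cycMean_mixing hd (n := n) (m := K) (L := K) hK (by omega) (M := b ^ 2)
    (F := fun w w' : ZMod n → A =>
      g (win w 0) (win w' (j2 : ZMod n)) * g (win w' (j3 : ZMod n)) (win w' (j4 : ZMod n)))
    (fun w w' => hgg _ _ _ _)
    (fun w' w1 w2 h => by
      have := dependsOn_win (n := n) (hg (win w' (j2 : ZMod n))) 0 (x := w1) (y := w2)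
        (fun i hi => h i (by simpa using hi))
      simp only [Nat.cast_zero] at this
      simp only [this])
    (fun w w1 w2 h => by
      have e2 : g (win w 0) (win w1 (j2 : ZMod n)) = g (win w 0) (win w2 (j2 : ZMod n)) :=
        dependsOn_win (n := n) (hg' (win w 0)) j2
          (fun i hi => h i (arc_mono (by omega) (by omega) hi))
      have e3 : g (win w1 (j3 : ZMod n)) (win w1 (j4 : ZMod n)) =
          g (win w2 (j3 : ZMod n)) (win w1 (j4 : ZMod n)) :=
        dependsOn_win (n := n) (hg (win w1 (j4 : ZMod n))) j3
          (fun i hi => h i (arc_mono (by omega) (by omega) hi))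
      have e4 : g (win w2 (j3 : ZMod n)) (win w1 (j4 : ZMod n)) =
          g (win w2 (j3 : ZMod n)) (win w2 (j4 : ZMod n)) :=
        dependsOn_win (n := n) (hg' (win w2 (j3 : ZMod n))) j4
          (fun i hi => h i (arc_mono (by omega) (by omega) hi))
      simp only [e2, e3, e4])
  -- for a fixed second argument the mean over the first is nearly the integral against `ν`
  have inner : |cycMean d fun w : ZMod n → A => cycMean d fun w' : ZMod n → A =>
      g (win w 0) (win w' (j2 : ZMod n)) * g (win w' (j3 : ZMod n)) (win w' (j4 : ZMod n))| ≤
      6 * (1 / 2) ^ K * b ^ 2 := by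
    have sw : (cycMean d fun w : ZMod n → A => cycMean d fun w' : ZMod n → A =>
        g (win w 0) (win w' (j2 : ZMod n)) * g (win w' (j3 : ZMod n)) (win w' (j4 : ZMod n))) =
        cycMean d fun w' : ZMod n → A => cycMean d fun w : ZMod n → A =>
        g (win w 0) (win w' (j2 : ZMod n)) * g (win w' (j3 : ZMod n)) (win w' (j4 : ZMod n)) := by
      simp only [cycMean_eq_sum, Finset.smul_sum]
      rw [Finset.sum_comm]
      exact Finset.sum_congr rfl fun w' _ => Finset.sum_congr rfl fun w _ => smul_comm _ _ _
    rw [sw, ← Real.norm_eq_abs]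
    refine norm_cycMean_le_of_le hd hn2 fun w' => ?_
    simp only [mul_comm _ (g (win w' (j3 : ZMod n)) (win w' (j4 : ZMod n))), cycMean_const_mul]
    have h1 := abs_cycMean_sub_integral_le (n := n) hd hν (m := K) (L := K) hK (by omega)
      (fun x => hb x (win w' (j2 : ZMod n))) (hg (win w' (j2 : ZMod n)))
    rw [h0, sub_zero] at h1
    rw [norm_mul, Real.norm_eq_abs, Real.norm_eq_abs]
    calc _ ≤ b * (6 * (1 / 2) ^ K * b) := mul_le_mul (hb _ _) h1 (abs_nonneg _) hb0
      _ = _ := by ring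
  have := norm_add_le_of_le mix inner
  rw [sub_add_cancel] at this
  exact this.trans (le_of_eq (by ring))

/-- The double sum of a degenerate kernel has standard deviation of order `n`, up to powers of the
range `K` of the kernel. -/
theorem cycMean_sq_cycSum₂_le (hg : ∀ y, DependsOn (fun x => g x y) (Set.Iio K))
    (hs : ∀ x y, g x y = g y x) (hK : 1 ≤ K) (hb : ∀ x y, |g x y| ≤ b)
    (h0 : ∀ y, ∫ x, g x y ∂ν = 0) (hn : 16 * K ≤ n) :
    cycMean d (fun w : ZMod n → A => cycSum₂ g w ^ 2) ≤
      144 * (n : ℝ) ^ 2 * K ^ 2 * b ^ 2 + (n : ℝ) ^ 4 * (24 * (1 / 2) ^ K * b ^ 2) := by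
  have hb0 : 0 ≤ b := (abs_nonneg _).trans
    (hb (fun _ => Classical.arbitrary A) fun _ => Classical.arbitrary A)
  have hn2 : 2 ≤ n := by omega
  have e : (fun w : ZMod n → A => cycSum₂ g w ^ 2) = fun w =>
      ∑ z₁, ∑ z₂, ∑ z₃, ∑ z₄, g (win w z₁) (win w z₂) * g (win w z₃) (win w z₄) := by
    funext w
    simp only [cycSum₂, sq, Finset.sum_mul, Finset.mul_sum]
    exact Finset.sum_congr rfl fun z₁ _ => Finset.sum_congr rfl fun z₂ _ =>
      Finset.sum_congr rfl fun z₃ _ => Finset.sum_congr rfl fun z₄ _ => mul_comm _ _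
  rw [e]
  simp only [cycMean_sum]
  have hgg : ∀ x y x' y', |g x y * g x' y'| ≤ b ^ 2 := fun x y x' y' => by
    rw [abs_mul, sq]; exact mul_le_mul (hb _ _) (hb _ _) (abs_nonneg _) hb0
  have key : ∀ z₁ z₂ z₃ z₄ : ZMod n, (cycMean d fun w : ZMod n → A =>
      g (win w z₁) (win w z₂) * g (win w z₃) (win w z₄)) ≤ 24 * (1 / 2) ^ K * b ^ 2 + b ^ 2 *
      (nearInd K z₁ z₂ * (nearInd K z₃ z₁ + nearInd K z₃ z₂ + nearInd K z₃ z₄) +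
        nearInd K z₁ z₃ * (nearInd K z₄ z₁ + nearInd K z₄ z₂ + nearInd K z₄ z₃) +
        nearInd K z₁ z₄ * (nearInd K z₃ z₁ + nearInd K z₃ z₂ + nearInd K z₃ z₄)) := by
    intro z₁ z₂ z₃ z₄
    have hN := nearInd_nonneg (n := n) K
    have h01 : ∀ z z' : ZMod n, nearInd K z z' = 0 ∨ nearInd K z z' = 1 := fun z z' => by
      rw [nearInd]; split_ifs <;> simp
    -- a position far from the three others can be moved to the front by symmetry
    have iso : ∀ {y₁ y₂ y₃ y₄ : ZMod n}, nearInd K y₁ y₂ = 0 → nearInd K y₁ y₃ = 0 →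
        nearInd K y₁ y₄ = 0 → (cycMean d fun w : ZMod n → A =>
          g (win w z₁) (win w z₂) * g (win w z₃) (win w z₄)) = (cycMean d fun w : ZMod n → A =>
          g (win w y₁) (win w y₂) * g (win w y₃) (win w y₄)) →
        (cycMean d fun w : ZMod n → A =>
          g (win w z₁) (win w z₂) * g (win w z₃) (win w z₄)) ≤ 24 * (1 / 2) ^ K * b ^ 2 :=
      fun h2 h3 h4 h => h ▸ (le_abs_self _).trans
        (abs_cycMean_degenerate_le hd hν hg hs hK hb h0 hn h2 h3 h4)
    have i1 := iso (y₁ := z₁) (y₂ := z₂) (y₃ := z₃) (y₄ := z₄)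
    have i3 := iso (y₁ := z₃) (y₂ := z₄) (y₃ := z₁) (y₄ := z₂)
    have i4 := iso (y₁ := z₄) (y₂ := z₃) (y₃ := z₁) (y₄ := z₂)
    have m3 : (cycMean d fun w : ZMod n → A =>
          g (win w z₁) (win w z₂) * g (win w z₃) (win w z₄)) = (cycMean d fun w : ZMod n → A =>
          g (win w z₃) (win w z₄) * g (win w z₁) (win w z₂)) := by
      simp only [mul_comm]
    have m4 : (cycMean d fun w : ZMod n → A =>
          g (win w z₁) (win w z₂) * g (win w z₃) (win w z₄)) = (cycMean d fun w : ZMod n → A =>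
          g (win w z₄) (win w z₃) * g (win w z₁) (win w z₂)) := by
      rw [m3]; simp only [hs]
    have trivial_bound : (cycMean d fun w : ZMod n → A =>
        g (win w z₁) (win w z₂) * g (win w z₃) (win w z₄)) ≤ b ^ 2 :=
      (Real.le_norm_self _).trans (norm_cycMean_le_of_le hd hn2 fun w => hgg _ _ _ _)
    have hε : 0 ≤ 24 * (1 / 2 : ℝ) ^ K * b ^ 2 := by positivity
    set S3 := nearInd K z₃ z₁ + nearInd K z₃ z₂ + nearInd K z₃ z₄ with hS3
    set S4 := nearInd K z₄ z₁ + nearInd K z₄ z₂ + nearInd K z₄ z₃ with hS4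
    have n3 : 0 ≤ S3 := by have := hN z₃ z₁; have := hN z₃ z₂; have := hN z₃ z₄; linarith
    have n4 : 0 ≤ S4 := by have := hN z₄ z₁; have := hN z₄ z₂; have := hN z₄ z₃; linarith
    have p1 := mul_nonneg (hN z₁ z₂) n3
    have p2 := mul_nonneg (hN z₁ z₃) n4
    have p3 := mul_nonneg (hN z₁ z₄) n3
    have small : (cycMean d fun w : ZMod n → A =>
        g (win w z₁) (win w z₂) * g (win w z₃) (win w z₄)) ≤ 24 * (1 / 2) ^ K * b ^ 2 →
        (cycMean d fun w : ZMod n → A =>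
        g (win w z₁) (win w z₂) * g (win w z₃) (win w z₄)) ≤ 24 * (1 / 2) ^ K * b ^ 2 +
          b ^ 2 * (nearInd K z₁ z₂ * S3 + nearInd K z₁ z₃ * S4 + nearInd K z₁ z₄ * S3) :=
      fun h => by
        have : 0 ≤ b ^ 2 * (nearInd K z₁ z₂ * S3 + nearInd K z₁ z₃ * S4 + nearInd K z₁ z₄ * S3) :=
          mul_nonneg (sq_nonneg b) (by linarith)
        linarith
    have big : 1 ≤ nearInd K z₁ z₂ * S3 + nearInd K z₁ z₃ * S4 + nearInd K z₁ z₄ * S3 →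
        (cycMean d fun w : ZMod n → A =>
        g (win w z₁) (win w z₂) * g (win w z₃) (win w z₄)) ≤ 24 * (1 / 2) ^ K * b ^ 2 +
          b ^ 2 * (nearInd K z₁ z₂ * S3 + nearInd K z₁ z₃ * S4 + nearInd K z₁ z₄ * S3) :=
      fun h => by
        have := mul_le_mul_of_nonneg_left h (sq_nonneg b)
        linarith
    have s3 : (cycMean d fun w : ZMod n → A =>
        g (win w z₁) (win w z₂) * g (win w z₃) (win w z₄)) ≤ 24 * (1 / 2) ^ K * b ^ 2 ∨
        1 ≤ S3 := by
      rcases h01 z₃ z₁ with h | h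
      · rcases h01 z₃ z₂ with h' | h'
        · rcases h01 z₃ z₄ with h'' | h''
          · exact Or.inl (i3 h'' h h' m3)
          · right; linarith
        · right; have := hN z₃ z₄; linarith
      · right; have := hN z₃ z₂; have := hN z₃ z₄; linarith
    have s4 : (cycMean d fun w : ZMod n → A =>
        g (win w z₁) (win w z₂) * g (win w z₃) (win w z₄)) ≤ 24 * (1 / 2) ^ K * b ^ 2 ∨
        1 ≤ S4 := by
      rcases h01 z₄ z₁ with h | h
      · rcases h01 z₄ z₂ with h' | h'
        · rcases h01 z₄ z₃ with h'' | h''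
          · exact Or.inl (i4 h'' h h' m4)
          · right; linarith
        · right; have := hN z₄ z₃; linarith
      · right; have := hN z₄ z₂; have := hN z₄ z₃; linarith
    rcases s3 with s3 | s3
    · exact small s3
    rcases s4 with s4 | s4
    · exact small s4
    rcases h01 z₁ z₂ with h12 | h12
    · rcases h01 z₁ z₃ with h13 | h13
      · rcases h01 z₁ z₄ with h14 | h14
        · exact small (i1 h12 h13 h14 rfl)
        · exact big (by rw [h14] at *; linarith)
      · exact big (by rw [h13] at *; linarith)
    · exact big (by rw [h12] at *; linarith)
  refine (Finset.sum_le_sum fun z₁ _ => Finset.sum_le_sum fun z₂ _ => Finset.sum_le_sum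
    fun z₃ _ => Finset.sum_le_sum fun z₄ _ => key z₁ z₂ z₃ z₄).trans ?_
  have cnt := mul_le_mul_of_nonneg_left (sum_near_pairs_le (n := n) K) (sq_nonneg b)
  simp only [Finset.sum_add_distrib, ← Finset.mul_sum, Finset.sum_const, Finset.card_univ,
    ZMod.card, nsmul_eq_mul] at cnt ⊢
  nlinarith [cnt]

end Degenerate

/-! ### Square integrability of exponentially decaying series -/

section SquareIntegrable

variable {Ω : Type*} [MeasurableSpace Ω] {μ : Measure Ω} [IsProbabilityMeasure μ]
variable {a : ℕ → Ω → ℝ} {B β : ℝ}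

/-- A uniformly bounded sequence of random variables with exponentially small first absolute
moments. -/
structure IsDecayingSeq (μ : Measure Ω) (a : ℕ → Ω → ℝ) (B β : ℝ) : Prop where
  pos : 0 < β
  lt_one : β < 1
  measurable : ∀ k, Measurable (a k)
  abs_le : ∀ k x, |a k x| ≤ B
  integral_abs_le : ∀ k, ∫ x, |a k x| ∂μ ≤ B * β ^ k

/-- The bound `B ρ ^ K / (1 - ρ)`, with `ρ = √β`, for the `L²` norm of the tail of the series. -/
noncomputable def tailBound (B β : ℝ) (K : ℕ) : ℝ := B * √β ^ K / (1 - √β)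

theorem tailBound_eq (B β : ℝ) (K : ℕ) : tailBound B β K = tailBound B β 0 * √β ^ K := by
  rw [tailBound, tailBound]; ring

namespace IsDecayingSeq

variable (ha : IsDecayingSeq μ a B β)
include ha

omit [IsProbabilityMeasure μ] in
theorem sqrt_lt_one : √β < 1 := by
  rw [Real.sqrt_lt' one_pos]; simpa using ha.lt_one

omit [IsProbabilityMeasure μ] in
theorem sqrt_pos : 0 < √β := Real.sqrt_pos.2 ha.pos

theorem integrable (k : ℕ) : Integrable (a k) μ :=
  Integrable.of_bound (ha.measurable k).aestronglyMeasurable B (ae_of_all _ (ha.abs_le k))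

theorem bound_nonneg : 0 ≤ B := by
  obtain ⟨x⟩ : Nonempty Ω := μ.nonempty_of_neZero
  exact (abs_nonneg _).trans (ha.abs_le 0 x)

theorem integral_abs_mul_le (j k : ℕ) :
    ∫ x, |a j x * a k x| ∂μ ≤ (B * √β ^ j) * (B * √β ^ k) := by
  have hB := ha.bound_nonneg
  have h0 := ha.sqrt_pos.le
  have h1 := ha.sqrt_lt_one.le
  -- bound the factor of smaller index by `B`, and split the decay of the other one evenly
  have key : ∀ j k : ℕ, k ≤ j → ∫ x, |a j x * a k x| ∂μ ≤ (B * √β ^ j) * (B * √β ^ k) := by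
    intro j k hkj
    have hint : Integrable (fun x => B * |a j x|) μ := (ha.integrable j).abs.const_mul B
    calc ∫ x, |a j x * a k x| ∂μ ≤ ∫ x, B * |a j x| ∂μ := by
          refine integral_mono_of_nonneg (ae_of_all _ fun x => abs_nonneg _) hint
            (ae_of_all _ fun x => ?_)
          simp only [abs_mul]
          rw [mul_comm]
          exact mul_le_mul_of_nonneg_right (ha.abs_le k x) (abs_nonneg _)
      _ = B * ∫ x, |a j x| ∂μ := integral_const_mul _ _
      _ ≤ B * (B * β ^ j) := mul_le_mul_of_nonneg_left (ha.integral_abs_le j) hB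
      _ = B * (B * (√β ^ j * √β ^ j)) := by
          rw [← mul_pow, Real.mul_self_sqrt ha.pos.le]
      _ ≤ B * (B * (√β ^ j * √β ^ k)) := by
          have := pow_le_pow_of_le_one h0 h1 hkj
          gcongr
      _ = _ := by ring
  rcases le_total k j with h | h
  · exact key j k h
  · have := key k j h
    simp only [mul_comm (a j _)]
    rw [mul_comm (B * √β ^ j)]
    exact this

theorem lintegral_sq_tsum_le (K : ℕ) :
    ∫⁻ x, (∑' k, ‖a (K + k) x‖ₑ) ^ 2 ∂μ ≤ ENNReal.ofReal (tailBound B β K ^ 2) := by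
  have hB := ha.bound_nonneg
  have h0 := ha.sqrt_pos.le
  have h1 := ha.sqrt_lt_one
  have hm : ∀ k, Measurable fun x => ‖a k x‖ₑ := fun k => (ha.measurable k).enorm
  have hmm : ∀ j k, Measurable fun x => ‖a (K + j) x‖ₑ * ‖a (K + k) x‖ₑ :=
    fun j k => (hm _).mul (hm _)
  have hpair : ∀ j k, ∫⁻ x, ‖a (K + j) x‖ₑ * ‖a (K + k) x‖ₑ ∂μ ≤
      ENNReal.ofReal (B * √β ^ (K + j)) * ENNReal.ofReal (B * √β ^ (K + k)) := by
    intro j k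
    rw [← ENNReal.ofReal_mul (by positivity)]
    refine le_trans (le_of_eq ?_) (ENNReal.ofReal_le_ofReal (ha.integral_abs_mul_le _ _))
    rw [ofReal_integral_eq_lintegral_ofReal]
    · refine lintegral_congr fun x => ?_
      rw [← enorm_mul, Real.enorm_eq_ofReal_abs]
    · refine (Integrable.of_bound (C := B * B)
        ((ha.measurable _).mul (ha.measurable _)).aestronglyMeasurable
        (ae_of_all _ fun x => ?_)).abs
      rw [Pi.mul_apply, norm_mul]
      exact mul_le_mul (ha.abs_le _ x) (ha.abs_le _ x) (norm_nonneg _) hB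
    · exact ae_of_all _ fun x => abs_nonneg _
  have hgeo : HasSum (fun j : ℕ => B * √β ^ (K + j)) (tailBound B β K) := by
    have := (hasSum_geometric_of_lt_one h0 h1).mul_left (B * √β ^ K)
    convert! this using 2 with j
    rw [pow_add, mul_assoc]
  have hsum : ∑' j, ENNReal.ofReal (B * √β ^ (K + j)) = ENNReal.ofReal (tailBound B β K) := by
    rw [← hgeo.tsum_eq, ENNReal.ofReal_tsum_of_nonneg (fun j => by positivity) hgeo.summable]
  calc ∫⁻ x, (∑' k, ‖a (K + k) x‖ₑ) ^ 2 ∂μ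
      = ∫⁻ x, ∑' j, ∑' k, ‖a (K + j) x‖ₑ * ‖a (K + k) x‖ₑ ∂μ := by
        refine lintegral_congr fun x => ?_
        simp only [ENNReal.tsum_mul_left, ENNReal.tsum_mul_right, sq]
    _ = ∑' j, ∑' k, ∫⁻ x, ‖a (K + j) x‖ₑ * ‖a (K + k) x‖ₑ ∂μ := by
        rw [lintegral_tsum fun j => (Measurable.tsum (hmm j)).aemeasurable]
        exact tsum_congr fun j => lintegral_tsum fun k => (hmm j k).aemeasurable
    _ ≤ ∑' j, ∑' k, ENNReal.ofReal (B * √β ^ (K + j)) * ENNReal.ofReal (B * √β ^ (K + k)) :=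
        ENNReal.tsum_le_tsum fun j => ENNReal.tsum_le_tsum fun k => hpair j k
    _ = ENNReal.ofReal (tailBound B β K) * ENNReal.ofReal (tailBound B β K) := by
        simp only [ENNReal.tsum_mul_left, ENNReal.tsum_mul_right, hsum]
    _ = _ := by
        rw [sq, ENNReal.ofReal_mul (by
          rw [tailBound]; exact div_nonneg (by positivity) (by linarith))]

theorem ae_summable : ∀ᵐ x ∂μ, Summable fun k => a k x := by
  have h := ha.lintegral_sq_tsum_le 0
  have hm : Measurable fun x => (∑' k, ‖a (0 + k) x‖ₑ) ^ 2 :=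
    (Measurable.tsum fun k => (ha.measurable _).enorm).pow_const 2
  filter_upwards [ae_lt_top hm (h.trans_lt ENNReal.ofReal_lt_top).ne] with x hx
  have hx' : ∑' k, ‖a k x‖ₑ ≠ ⊤ := by
    intro h
    simp [h] at hx
  simp only [enorm_eq_nnnorm] at hx'
  exact Summable.of_nnnorm (ENNReal.tsum_coe_ne_top_iff_summable.1 hx')

theorem aestronglyMeasurable_tsum : AEStronglyMeasurable (fun x => ∑' k, a k x) μ := by
  refine aestronglyMeasurable_of_tendsto_ae atTop (f := fun (K : ℕ) x =>
    ∑ k ∈ Finset.range K, a k x) (fun K => ?_) ?_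
  · exact (Finset.measurable_fun_sum _ fun k _ => ha.measurable k).aestronglyMeasurable
  · filter_upwards [ha.ae_summable] with x hx
    exact hx.hasSum.tendsto_sum_nat

theorem lintegral_sq_sub_le (K : ℕ) :
    ∫⁻ x, ‖(∑' k, a k x - ∑ k ∈ Finset.range K, a k x) ^ 2‖ₑ ∂μ ≤
      ENNReal.ofReal (tailBound B β K ^ 2) := by
  refine (lintegral_mono_ae ?_).trans (ha.lintegral_sq_tsum_le K)
  filter_upwards [ha.ae_summable] with x hx
  rw [← hx.sum_add_tsum_nat_add K, add_sub_cancel_left, enorm_pow]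
  gcongr
  simp only [add_comm _ K]
  exact enorm_tsum_le_tsum_enorm

theorem integrable_sq_sub (K : ℕ) :
    Integrable (fun x => (∑' k, a k x - ∑ k ∈ Finset.range K, a k x) ^ 2) μ :=
  ⟨(ha.aestronglyMeasurable_tsum.sub (Finset.measurable_fun_sum _
    fun k _ => ha.measurable k).aestronglyMeasurable).pow 2,
    (ha.lintegral_sq_sub_le K).trans_lt ENNReal.ofReal_lt_top⟩

theorem integral_sq_sub_le (K : ℕ) :
    ∫ x, (∑' k, a k x - ∑ k ∈ Finset.range K, a k x) ^ 2 ∂μ ≤ tailBound B β K ^ 2 := by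
  have h := ha.lintegral_sq_sub_le K
  rw [integral_eq_lintegral_of_nonneg_ae (ae_of_all _ fun x => sq_nonneg _)
    (ha.integrable_sq_sub K).aestronglyMeasurable]
  refine ENNReal.toReal_le_of_le_ofReal (sq_nonneg _) (le_trans (le_of_eq ?_) h)
  refine lintegral_congr fun x => ?_
  rw [Real.enorm_eq_ofReal (sq_nonneg _)]

theorem memLp_tsum : MemLp (fun x => ∑' k, a k x) 2 μ := by
  rw [memLp_two_iff_integrable_sq ha.aestronglyMeasurable_tsum]
  simpa using ha.integrable_sq_sub 0

end IsDecayingSeq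

end SquareIntegrable

/-! ### Kernels and their Hoeffding projections -/

section Kernels

variable {A : Type*} [Fintype A] [Nonempty A] [MeasurableSpace A] [DiscreteMeasurableSpace A]
variable {d : A → A → ℝ}

omit [Fintype A] [DiscreteMeasurableSpace A] in
/-- A function of finitely many letters is measurable. -/
theorem DependsOn.measurable_of_finite [Finite A] [DiscreteMeasurableSpace A] {F : (ℕ → A) → ℝ}
    {K : ℕ} (hF : DependsOn F (Set.Iio K)) : Measurable F := by
  let a₀ : A := Classical.arbitrary A
  let ext : (Fin K → A) → (ℕ → A) := fun p j => if h : j < K then p ⟨j, h⟩ else a₀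
  have e : F = fun x => (fun p => F (ext p)) fun i : Fin K => x i := by
    funext x
    refine hF fun j hj => ?_
    have hj' : j < K := hj
    simp [ext, hj']
  rw [e]
  exact (measurable_of_countable fun p : Fin K → A => F (ext p)).comp
    (measurable_pi_lambda (fun (x : ℕ → A) (i : Fin K) => x i) fun i => measurable_pi_apply _)

omit [Nonempty A] [DiscreteMeasurableSpace A] [Fintype A] in
theorem measurable_seqShift (m : ℕ) : Measurable (seqShift (A := A) m) :=
  measurable_pi_lambda _ fun j => measurable_pi_apply (m + j)

variable (hd : IsChainDensity d) {ν : Measure (ℕ → A)} [IsProbabilityMeasure ν]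
  (hν : IsChainLaw d ν)

include hd hν in
omit [DiscreteMeasurableSpace A] in
theorem measurePreserving_seqShift (m : ℕ) : MeasurePreserving (seqShift m) ν ν := by
  refine ⟨measurable_seqShift m, ?_⟩
  have hmp : IsProbabilityMeasure (ν.map (seqShift m)) :=
    Measure.isProbabilityMeasure_map (measurable_seqShift m).aemeasurable
  refine ext_of_generate_finite _ (generateFrom_measurableCylinders (α := fun _ : ℕ => A)).symm
    isPiSystem_measurableCylinders (fun s hs => ?_) (by simp)
  obtain ⟨I, S, hS, rfl⟩ := (mem_measurableCylinders _).1 hs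
  have hmeas : MeasurableSet (cylinder (α := fun _ : ℕ => A) I S) :=
    MeasurableSet.cylinder (α := fun _ : ℕ => A) I hS
  rw [Measure.map_apply (measurable_seqShift m) hmeas]
  have hF : DependsOn (Set.indicator (cylinder (α := fun _ : ℕ => A) I S) fun _ => (1 : ℝ))
      (Set.Iio (I.sup id + 1)) := by
    intro x y h
    have : x ∈ cylinder (α := fun _ : ℕ => A) I S ↔ y ∈ cylinder (α := fun _ : ℕ => A) I S := by
      rw [mem_cylinder, mem_cylinder]
      have : I.restrict x = I.restrict y := funext fun i =>
        h _ (Nat.lt_succ_of_le (Finset.le_sup (f := id) i.2))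
      rw [this]
    by_cases hx : x ∈ cylinder (α := fun _ : ℕ => A) I S
    · rw [Set.indicator_of_mem hx, Set.indicator_of_mem (this.1 hx)]
    · rw [Set.indicator_of_notMem hx, Set.indicator_of_notMem (mt this.2 hx)]
  have h := integral_seqShift_of_dependsOn hd hν (M := 1) (fun x => by
    by_cases hx : x ∈ cylinder (α := fun _ : ℕ => A) I S <;> simp [hx]) hF m
  have e : (fun x => Set.indicator (cylinder (α := fun _ : ℕ => A) I S) (fun _ => (1 : ℝ))
        (seqShift m x)) =
      Set.indicator (seqShift m ⁻¹' cylinder (α := fun _ : ℕ => A) I S) fun _ => (1 : ℝ) := rfl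
  rw [e, integral_indicator_const _ (measurable_seqShift m hmeas),
    integral_indicator_const _ hmeas, smul_eq_mul, smul_eq_mul, mul_one, mul_one] at h
  exact (measureReal_eq_measureReal_iff).1 h

/-- A sequence of bounded symmetric kernels, the `k`-th one depending on the first `k + 1` letters
of its arguments, which are exponentially small in mean along two windows of a random cyclic
word. -/
structure IsKernelSeq (d : A → A → ℝ) (v : ℕ → (ℕ → A) → (ℕ → A) → ℝ) (C β : ℝ) : Prop where
  pos : 0 < β
  lt_one : β < 1
  symm : ∀ k x y, v k x y = v k y x
  abs_le : ∀ k x y, |v k x y| ≤ C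
  dependsOn : ∀ k y, DependsOn (fun x => v k x y) (Set.Iio (k + 1))
  decay : ∀ (n : ℕ) [NeZero n] (k i : ℕ), k + 1 ≤ n → 1 ≤ i → i < n →
    cycMean d (fun w : ZMod n → A => |v k (win w 0) (win w (i : ZMod n))|) ≤ C * β ^ k

/-- The Hoeffding projection of the `k`-th kernel. -/
noncomputable def proj (v : ℕ → (ℕ → A) → (ℕ → A) → ℝ) (ν : Measure (ℕ → A)) (k : ℕ)
    (x : ℕ → A) : ℝ := ∫ y, v k x y ∂ν

/-- The mean of the `k`-th kernel at two independent sequences. -/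
noncomputable def projMean (v : ℕ → (ℕ → A) → (ℕ → A) → ℝ) (ν : Measure (ℕ → A)) (k : ℕ) : ℝ :=
  ∫ x, proj v ν k x ∂ν

/-- The centred Hoeffding projection. -/
noncomputable def cproj (v : ℕ → (ℕ → A) → (ℕ → A) → ℝ) (ν : Measure (ℕ → A)) (k : ℕ)
    (x : ℕ → A) : ℝ := proj v ν k x - projMean v ν k

/-- The centred Hoeffding projection of the sum of the first `K` kernels. -/
noncomputable def linPart (v : ℕ → (ℕ → A) → (ℕ → A) → ℝ) (ν : Measure (ℕ → A)) (K : ℕ)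
    (x : ℕ → A) : ℝ := ∑ k ∈ Finset.range K, cproj v ν k x

/-- The degenerate part of the sum of the first `K` kernels. -/
noncomputable def degPart (v : ℕ → (ℕ → A) → (ℕ → A) → ℝ) (ν : Measure (ℕ → A)) (K : ℕ)
    (x y : ℕ → A) : ℝ :=
  ∑ k ∈ Finset.range K, (v k x y - proj v ν k x - proj v ν k y + projMean v ν k)

omit [DiscreteMeasurableSpace A] [Fintype A] [Nonempty A] in
theorem abs_integral_le_of_abs_le {F : (ℕ → A) → ℝ} {M : ℝ} (h : ∀ x, |F x| ≤ M) :
    |∫ x, F x ∂ν| ≤ M := by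
  have := norm_integral_le_of_norm_le_const (μ := ν) (C := M)
    (ae_of_all _ fun x => (Real.norm_eq_abs _).le.trans (h x))
  simpa using this

namespace IsKernelSeq

variable {v : ℕ → (ℕ → A) → (ℕ → A) → ℝ} {C β : ℝ} (hv : IsKernelSeq d v C β)
include hv

omit [DiscreteMeasurableSpace A] [MeasurableSpace A] in
theorem bound_nonneg : 0 ≤ C :=
  (abs_nonneg _).trans (hv.abs_le 0 (fun _ => Classical.arbitrary A) fun _ => Classical.arbitrary A)

omit [DiscreteMeasurableSpace A] [Nonempty A] [MeasurableSpace A] in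
theorem dependsOn_right (k : ℕ) (x : ℕ → A) : DependsOn (v k x) (Set.Iio (k + 1)) := by
  intro y y' h
  rw [hv.symm k x y, hv.symm k x y']
  exact hv.dependsOn k x h

theorem integrable_right (k : ℕ) (x : ℕ → A) : Integrable (v k x) ν :=
  Integrable.of_bound (hv.dependsOn_right k x).measurable_of_finite.aestronglyMeasurable C
    (ae_of_all _ (hv.abs_le k x))

omit [DiscreteMeasurableSpace A] [Nonempty A] [IsProbabilityMeasure ν] in
theorem dependsOn_proj (k : ℕ) : DependsOn (proj v ν k) (Set.Iio (k + 1)) := by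
  intro x x' h
  exact congrArg (integral ν) (funext fun y => hv.dependsOn k y h)

omit [DiscreteMeasurableSpace A] [Nonempty A] in
theorem abs_proj_le (k : ℕ) (x : ℕ → A) : |proj v ν k x| ≤ C :=
  abs_integral_le_of_abs_le (hv.abs_le k x)

omit [DiscreteMeasurableSpace A] [Nonempty A] in
theorem abs_projMean_le' (k : ℕ) : |projMean v ν k| ≤ C :=
  abs_integral_le_of_abs_le (hv.abs_proj_le k)

include hd hν in
omit [DiscreteMeasurableSpace A] in
/-- The exponential decay passes from cyclic words to independent stationary sequences, since
two windows far apart on a long cycle are nearly independent. -/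
theorem integral_integral_abs_le (k : ℕ) :
    ∫ x, ∫ y, |v k x y| ∂ν ∂ν ≤ C * β ^ k := by
  have hC := hv.bound_nonneg
  -- two windows at distance `L` on either side of a cycle; the gap `L` then tends to infinity
  have main : ∀ L : ℕ, ∫ x, ∫ y, |v k x y| ∂ν ∂ν ≤ C * β ^ k + 30 * (1 / 2) ^ L * C := by
    intro L
    obtain ⟨n, hn⟩ : ∃ n, n = 2 * (k + 1) + 2 * L := ⟨_, rfl⟩
    have : NeZero n := ⟨by omega⟩
    have hn2 : 2 ≤ n := by omega
    have habs : ∀ x y, |(|v k x y|)| ≤ C := fun x y => by rw [abs_abs]; exact hv.abs_le k x y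
    have dl : ∀ y, DependsOn (fun x => |v k x y|) (Set.Iio (k + 1)) := fun y x x' h => by
      simp only [hv.dependsOn k y h]
    have dr : ∀ x, DependsOn (fun y => |v k x y|) (Set.Iio (k + 1)) := fun x y y' h => by
      simp only [hv.dependsOn_right k x h]
    have mix := norm_cycMean_mixing hd (n := n) (m := k + 1) (L := L) (by omega) (by omega)
      (M := C) (F := fun w w' : ZMod n → A =>
        |v k (win w 0) (win w' ((k + 1 + L : ℕ) : ZMod n))|)
      (fun w w' => habs _ _)
      (fun w' w1 w2 h => by
        have := dependsOn_win (n := n) (dl (win w' ((k + 1 + L : ℕ) : ZMod n))) 0 (x := w1)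
          (y := w2) (fun i hi => h i (by simpa using hi))
        simpa only [Nat.cast_zero] using this)
      (fun w w1 w2 h => dependsOn_win (n := n) (dr (win w 0)) (k + 1 + L)
          (fun i hi => h i (arc_mono (by omega) (by omega) hi)))
    have hdec := hv.decay n k (k + 1 + L) (by omega) (by omega) (by omega)
    have rot : ∀ x, (cycMean d fun w' : ZMod n → A =>
        |v k x (win w' ((k + 1 + L : ℕ) : ZMod n))|) =
        cycMean d fun w' : ZMod n → A => |v k x (win w' 0)| := fun x => by
      rw [← cycMean_rotate ((k + 1 + L : ℕ) : ZMod n) fun w' : ZMod n → A => |v k x (win w' 0)|]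
      simp only [win_rotate, zero_add]
    simp only [rot] at mix
    have e1 : ∀ x, |(cycMean d fun w' : ZMod n → A => |v k x (win w' 0)|) -
        ∫ y, |v k x y| ∂ν| ≤ 6 * (1 / 2) ^ L * C := fun x =>
      abs_cycMean_sub_integral_le (n := n) hd hν (m := k + 1) (L := L) (by omega) (by omega)
        (F := fun y => |v k x y|) (habs x) (dr x)
    have e2 : |(cycMean d fun w : ZMod n → A => cycMean d fun w' : ZMod n → A =>
          |v k (win w 0) (win w' 0)|) - cycMean d fun w : ZMod n → A =>
          ∫ y, |v k (win w 0) y| ∂ν| ≤ 6 * (1 / 2) ^ L * C := by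
      rw [← cycMean_sub, ← Real.norm_eq_abs]
      exact norm_cycMean_le_of_le hd hn2 fun w => e1 _
    have e3 := abs_cycMean_sub_integral_le (n := n) hd hν (m := k + 1) (L := L) (by omega)
      (by omega) (F := fun x => ∫ y, |v k x y| ∂ν) (M := C)
      (fun x => abs_integral_le_of_abs_le (habs x))
      (fun x x' h => congrArg (integral ν) (funext fun y => dl y h))
    rw [Real.norm_eq_abs] at mix
    have := (_root_.abs_le.1 mix).2
    have := (_root_.abs_le.1 mix).1
    have := (_root_.abs_le.1 e2).1
    have := (_root_.abs_le.1 e2).2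
    have := (_root_.abs_le.1 e3).1
    linarith
  have lim : Tendsto (fun L : ℕ => C * β ^ k + 30 * (1 / 2 : ℝ) ^ L * C) atTop
      (𝓝 (C * β ^ k + 30 * 0 * C)) :=
    (((tendsto_pow_atTop_nhds_zero_of_lt_one (by norm_num) (by norm_num)).const_mul 30).mul_const
      C).const_add _
  rw [mul_zero, zero_mul, add_zero] at lim
  exact ge_of_tendsto' lim main

include hd hν in
theorem isDecayingSeq_proj : IsDecayingSeq ν (proj v ν) C β where
  pos := hv.pos
  lt_one := hv.lt_one
  measurable k := (hv.dependsOn_proj k).measurable_of_finite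
  abs_le := hv.abs_proj_le
  integral_abs_le k := by
    refine le_trans ?_ (hv.integral_integral_abs_le hd hν k)
    refine integral_mono_of_nonneg (ae_of_all _ fun x => abs_nonneg _) ?_
      (ae_of_all _ fun x => abs_integral_le_integral_abs)
    refine Integrable.of_bound (C := C) (DependsOn.measurable_of_finite (K := k + 1) ?_
      ).aestronglyMeasurable (ae_of_all _ fun x => abs_integral_le_of_abs_le fun y => by
        rw [abs_abs]; exact hv.abs_le k x y)
    exact fun x x' h => congrArg (integral ν) (funext fun y => congrArg abs (hv.dependsOn k y h))

include hd hν in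
theorem abs_projMean_le (k : ℕ) : |projMean v ν k| ≤ C * β ^ k :=
  abs_integral_le_integral_abs.trans ((hv.isDecayingSeq_proj hd hν).integral_abs_le k)

include hd hν in
theorem isDecayingSeq_cproj : IsDecayingSeq ν (cproj v ν) (2 * C) β where
  pos := hv.pos
  lt_one := hv.lt_one
  measurable k := (hv.dependsOn_proj k).measurable_of_finite.sub_const _
  abs_le k x := by
    have := abs_sub (proj v ν k x) (projMean v ν k)
    have := hv.abs_proj_le (ν := ν) k x
    have := hv.abs_projMean_le' (ν := ν) k
    rw [cproj]; linarith
  integral_abs_le k := by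
    have hp := hv.isDecayingSeq_proj hd hν
    have hi : Integrable (fun x => |proj v ν k x| + |projMean v ν k|) ν :=
      (hp.integrable k).abs.add (integrable_const _)
    have h1 : ∫ x, |cproj v ν k x| ∂ν ≤ ∫ x, (|proj v ν k x| + |projMean v ν k|) ∂ν :=
      integral_mono_of_nonneg (ae_of_all _ fun x => abs_nonneg _) hi
        (ae_of_all _ fun x => abs_sub _ _)
    rw [integral_add (hp.integrable k).abs (integrable_const _)] at h1
    have := hp.integral_abs_le k
    have := hv.abs_projMean_le hd hν k
    simp only [integral_const, probReal_univ, one_smul] at h1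
    linarith

omit [DiscreteMeasurableSpace A] [Nonempty A] [IsProbabilityMeasure ν] in
theorem dependsOn_linPart (K : ℕ) : DependsOn (linPart v ν K) (Set.Iio K) := by
  intro x x' h
  refine Finset.sum_congr rfl fun k hk => ?_
  have hk' := Finset.mem_range.1 hk
  rw [cproj, cproj, hv.dependsOn_proj k fun i hi => h i (by
    have : i < k + 1 := hi
    exact Set.mem_Iio.2 (by omega))]

omit [DiscreteMeasurableSpace A] [Nonempty A] in
theorem abs_linPart_le (K : ℕ) (x : ℕ → A) : |linPart v ν K x| ≤ 2 * K * C := by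
  refine (Finset.abs_sum_le_sum_abs _ _).trans ((Finset.sum_le_card_nsmul _ _ (2 * C)
    fun k _ => ?_).trans ?_)
  · have := abs_sub (proj v ν k x) (projMean v ν k)
    have := hv.abs_proj_le (ν := ν) k x
    have := hv.abs_projMean_le' (ν := ν) k
    rw [cproj]; linarith
  · rw [Finset.card_range, nsmul_eq_mul]; linarith

theorem integrable_proj (k : ℕ) : Integrable (proj v ν k) ν :=
  Integrable.of_bound (hv.dependsOn_proj k).measurable_of_finite.aestronglyMeasurable C
    (ae_of_all _ (hv.abs_proj_le k))

theorem integral_linPart (K : ℕ) : ∫ x, linPart v ν K x ∂ν = 0 := by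
  have hi : ∀ k, Integrable (fun x => proj v ν k x - projMean v ν k) ν := fun k =>
    (hv.integrable_proj k).sub (integrable_const _)
  simp only [linPart, cproj]
  rw [integral_finsetSum _ fun k _ => hi k]
  refine Finset.sum_eq_zero fun k _ => ?_
  rw [integral_sub (hv.integrable_proj k) (integrable_const _)]
  simp [projMean]

omit [DiscreteMeasurableSpace A] [Nonempty A] [IsProbabilityMeasure ν] in
theorem dependsOn_degPart (K : ℕ) (y : ℕ → A) :
    DependsOn (fun x => degPart v ν K x y) (Set.Iio K) := by
  intro x x' h
  refine Finset.sum_congr rfl fun k hk => ?_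
  have hk' := Finset.mem_range.1 hk
  have h' : ∀ i ∈ Set.Iio (k + 1), x i = x' i := fun i hi => h i (by
    have : i < k + 1 := hi
    exact Set.mem_Iio.2 (by omega))
  have e1 := hv.dependsOn_proj (ν := ν) k h'
  have e2 := hv.dependsOn k y h'
  simp only at e2
  rw [e1, e2]

omit [DiscreteMeasurableSpace A] [Nonempty A] [IsProbabilityMeasure ν] in
theorem degPart_symm (K : ℕ) (x y : ℕ → A) : degPart v ν K x y = degPart v ν K y x := by
  refine Finset.sum_congr rfl fun k _ => ?_
  rw [hv.symm k x y]; ring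

omit [DiscreteMeasurableSpace A] [Nonempty A] in
theorem abs_degPart_le (K : ℕ) (x y : ℕ → A) : |degPart v ν K x y| ≤ 4 * K * C := by
  refine (Finset.abs_sum_le_sum_abs _ _).trans ((Finset.sum_le_card_nsmul _ _ (4 * C)
    fun k _ => ?_).trans ?_)
  · have h1 := _root_.abs_le.1 (hv.abs_le k x y)
    have h2 := _root_.abs_le.1 (hv.abs_proj_le (ν := ν) k x)
    have h3 := _root_.abs_le.1 (hv.abs_proj_le (ν := ν) k y)
    have h4 := _root_.abs_le.1 (hv.abs_projMean_le' (ν := ν) k)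
    rw [_root_.abs_le]; constructor <;> linarith [h1.1, h1.2, h2.1, h2.2, h3.1, h3.2, h4.1, h4.2]
  · rw [Finset.card_range, nsmul_eq_mul]; linarith

theorem integral_degPart (K : ℕ) (y : ℕ → A) : ∫ x, degPart v ν K x y ∂ν = 0 := by
  have hi : ∀ k, Integrable (fun x => v k x y) ν := fun k => by
    simp only [hv.symm k _ y]; exact hv.integrable_right k y
  have hi1 : ∀ k, Integrable (fun x => v k x y - proj v ν k x) ν := fun k =>
    (hi k).sub (hv.integrable_proj k)
  have hi2 : ∀ k, Integrable (fun x => v k x y - proj v ν k x - proj v ν k y) ν := fun k =>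
    (hi1 k).sub (integrable_const _)
  have hi3 : ∀ k, Integrable (fun x => v k x y - proj v ν k x - proj v ν k y + projMean v ν k) ν :=
    fun k => (hi2 k).add (integrable_const _)
  simp only [degPart]
  rw [integral_finsetSum _ fun k _ => hi3 k]
  refine Finset.sum_eq_zero fun k _ => ?_
  have h1 : ∫ x, v k x y ∂ν = proj v ν k y := by
    rw [proj]; exact integral_congr_ae (ae_of_all _ fun x => hv.symm k x y)
  rw [integral_add (hi2 k) (integrable_const _), integral_sub (hi1 k) (integrable_const _),
    integral_sub (hi k) (hv.integrable_proj k), h1]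
  simp [projMean]

end IsKernelSeq

end Kernels

/-! ### Autocovariances and the asymptotic variance -/

section Autocovariance

theorem integral_abs_mul_le_of_sq {Ω : Type*} [MeasurableSpace Ω] {μ : Measure Ω} {a b : Ω → ℝ}
    (ha : MemLp a 2 μ) (hb : MemLp b 2 μ) {p : ℝ} (hp : 0 < p) :
    |∫ x, a x * b x ∂μ| ≤ (p * ∫ x, a x ^ 2 ∂μ + p⁻¹ * ∫ x, b x ^ 2 ∂μ) / 2 := by
  have hi : Integrable (fun x => (p * a x ^ 2 + p⁻¹ * b x ^ 2) / 2) μ :=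
    ((ha.integrable_sq.const_mul p).add (hb.integrable_sq.const_mul p⁻¹)).div_const 2
  refine (abs_integral_le_integral_abs.trans (integral_mono_of_nonneg
    (ae_of_all _ fun x => abs_nonneg _) hi (ae_of_all _ fun x => ?_))).trans (le_of_eq ?_)
  · have h1 : p * a x ^ 2 + p⁻¹ * b x ^ 2 - 2 * |a x * b x| = p⁻¹ * (p * |a x| - |b x|) ^ 2 := by
      rw [abs_mul, ← sq_abs (a x), ← sq_abs (b x)]
      field_simp
      ring
    have h2 : 0 ≤ p⁻¹ * (p * |a x| - |b x|) ^ 2 := by positivity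
    simp only
    linarith
  · rw [integral_div, integral_add (ha.integrable_sq.const_mul p)
      (hb.integrable_sq.const_mul p⁻¹), integral_const_mul, integral_const_mul]

theorem summable_comp_half {f : ℕ → ℝ} (hf : Summable f) : Summable fun m : ℕ => f (m / 2) := by
  obtain ⟨s, hs⟩ := hf
  have h1 : HasSum (fun k : ℕ => f (2 * k / 2)) s := by simpa using hs
  have h2 : HasSum (fun k : ℕ => f ((2 * k + 1) / 2)) s := by
    have : ∀ k : ℕ, (2 * k + 1) / 2 = k := fun k => by omega
    simpa only [this] using hs
  exact (HasSum.even_add_odd (f := fun m : ℕ => f (m / 2)) h1 h2).summable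

variable {A : Type*} [Fintype A] [Nonempty A] [MeasurableSpace A] [DiscreteMeasurableSpace A]
variable {d : A → A → ℝ}
variable (hd : IsChainDensity d) {ν : Measure (ℕ → A)} [IsProbabilityMeasure ν]
  (hν : IsChainLaw d ν)

/-- The centred Hoeffding projection of the sum of all kernels. -/
noncomputable def fullPart (v : ℕ → (ℕ → A) → (ℕ → A) → ℝ) (ν : Measure (ℕ → A))
    (x : ℕ → A) : ℝ := ∑' k, cproj v ν k x

/-- The autocovariances of the stationary sequence `F (τ ^ m x)`. -/
noncomputable def autocov (F : (ℕ → A) → ℝ) (ν : Measure (ℕ → A)) (m : ℕ) : ℝ :=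
  ∫ x, F x * F (seqShift m x) ∂ν

namespace IsKernelSeq

variable {v : ℕ → (ℕ → A) → (ℕ → A) → ℝ} {C β : ℝ} (hv : IsKernelSeq d v C β)
include hv hd hν

theorem memLp_fullPart : MemLp (fullPart v ν) 2 ν := (hv.isDecayingSeq_cproj hd hν).memLp_tsum

omit hd hν in
theorem memLp_linPart (K : ℕ) : MemLp (linPart v ν K) 2 ν :=
  MemLp.of_bound (hv.dependsOn_linPart K).measurable_of_finite.aestronglyMeasurable (2 * K * C)
    (ae_of_all _ (hv.abs_linPart_le K))

theorem integral_sq_fullPart_sub_linPart_le (K : ℕ) :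
    ∫ x, (fullPart v ν x - linPart v ν K x) ^ 2 ∂ν ≤ tailBound (2 * C) β K ^ 2 :=
  (hv.isDecayingSeq_cproj hd hν).integral_sq_sub_le K

theorem tailBound_le (K : ℕ) : tailBound (2 * C) β K ^ 2 ≤ tailBound (2 * C) β 0 ^ 2 := by
  have h := hv.isDecayingSeq_cproj hd hν
  rw [tailBound_eq _ _ K, mul_pow]
  refine mul_le_of_le_one_right (sq_nonneg _) ?_
  exact pow_le_one₀ (pow_nonneg h.sqrt_pos.le K) (pow_le_one₀ h.sqrt_pos.le h.sqrt_lt_one.le)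

theorem integral_sq_fullPart_le : ∫ x, fullPart v ν x ^ 2 ∂ν ≤ tailBound (2 * C) β 0 ^ 2 := by
  simpa [linPart] using hv.integral_sq_fullPart_sub_linPart_le hd hν 0

theorem integral_sq_linPart_le (K : ℕ) :
    ∫ x, linPart v ν K x ^ 2 ∂ν ≤ 4 * tailBound (2 * C) β 0 ^ 2 := by
  have h1 := hv.integral_sq_fullPart_sub_linPart_le hd hν K
  have h2 := hv.integral_sq_fullPart_le hd hν
  have h3 := hv.tailBound_le hd hν K
  have i1 : Integrable (fun x => (fullPart v ν x - linPart v ν K x) ^ 2) ν :=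
    ((hv.memLp_fullPart hd hν).sub (hv.memLp_linPart K)).integrable_sq
  have i2 := (hv.memLp_fullPart hd hν).integrable_sq
  have h4 : ∫ x, linPart v ν K x ^ 2 ∂ν ≤
      ∫ x, (2 * (fullPart v ν x - linPart v ν K x) ^ 2 + 2 * fullPart v ν x ^ 2) ∂ν := by
    refine integral_mono (hv.memLp_linPart K).integrable_sq
      ((i1.const_mul 2).add (i2.const_mul 2)) fun x => ?_
    simp only
    nlinarith [sq_nonneg (2 * fullPart v ν x - linPart v ν K x)]
  rw [integral_add (i1.const_mul 2) (i2.const_mul 2), integral_const_mul, integral_const_mul] at h4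
  linarith

omit [DiscreteMeasurableSpace A] hv in
theorem integral_comp_seqShift {G : (ℕ → A) → ℝ} (hG : AEStronglyMeasurable G ν) (m : ℕ) :
    ∫ x, G (seqShift m x) ∂ν = ∫ x, G x ∂ν := by
  have h := measurePreserving_seqShift hd hν m
  rw [← integral_map (φ := seqShift m) h.measurable.aemeasurable (by rwa [h.map_eq]), h.map_eq]

/-- The autocovariances of the full sum are approximated, uniformly in the lag, by those of the
partial sums. -/
theorem abs_autocov_sub_le (K m : ℕ) :
    |autocov (fullPart v ν) ν m - autocov (linPart v ν K) ν m| ≤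
      4 * tailBound (2 * C) β 0 ^ 2 * √β ^ K := by
  have hs := measurePreserving_seqShift hd hν m
  have hF := hv.memLp_fullPart hd hν
  have hL := hv.memLp_linPart (ν := ν) K
  have hD : MemLp (fun x => fullPart v ν x - linPart v ν K x) 2 ν := hF.sub hL
  have hF' : MemLp (fun x => fullPart v ν (seqShift m x)) 2 ν := hF.comp_measurePreserving hs
  have hL' : MemLp (fun x => linPart v ν K (seqShift m x)) 2 ν := hL.comp_measurePreserving hs
  have hD' : MemLp (fun x => fullPart v ν (seqShift m x) - linPart v ν K (seqShift m x)) 2 ν :=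
    hD.comp_measurePreserving hs
  set T := tailBound (2 * C) β 0 with hT
  have hp : 0 < √β ^ K := pow_pos (hv.isDecayingSeq_cproj hd hν).sqrt_pos K
  have e : autocov (fullPart v ν) ν m - autocov (linPart v ν K) ν m =
      ∫ x, (fullPart v ν x - linPart v ν K x) * fullPart v ν (seqShift m x) ∂ν +
      ∫ x, linPart v ν K x * (fullPart v ν (seqShift m x) - linPart v ν K (seqShift m x)) ∂ν := by
    have i1 : Integrable (fun x => (fullPart v ν x - linPart v ν K x) *
        fullPart v ν (seqShift m x)) ν := hD.integrable_mul hF'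
    have i2 : Integrable (fun x => linPart v ν K x *
        (fullPart v ν (seqShift m x) - linPart v ν K (seqShift m x))) ν := hL.integrable_mul hD'
    have i3 : Integrable (fun x => fullPart v ν x * fullPart v ν (seqShift m x)) ν :=
      hF.integrable_mul hF'
    have i4 : Integrable (fun x => linPart v ν K x * linPart v ν K (seqShift m x)) ν :=
      hL.integrable_mul hL'
    rw [autocov, autocov, ← integral_sub i3 i4, ← integral_add i1 i2]
    congr 1; funext x; ring
  have q1 := hv.integral_sq_fullPart_sub_linPart_le hd hν K
  have q2 := hv.integral_sq_fullPart_le hd hν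
  have q3 := hv.integral_sq_linPart_le hd hν K
  rw [tailBound_eq _ _ K, ← hT] at q1
  have q2' : ∫ x, fullPart v ν (seqShift m x) ^ 2 ∂ν ≤ T ^ 2 := by
    rw [integral_comp_seqShift hd hν (G := fun x => fullPart v ν x ^ 2)
      (hF.aestronglyMeasurable.pow 2)]
    exact q2
  have q1' : ∫ x, (fullPart v ν (seqShift m x) - linPart v ν K (seqShift m x)) ^ 2 ∂ν ≤
      (T * √β ^ K) ^ 2 := by
    rw [integral_comp_seqShift hd hν (G := fun x => (fullPart v ν x - linPart v ν K x) ^ 2)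
      (hD.aestronglyMeasurable.pow 2)]
    exact q1
  -- the weights balance the small and the large factor in `2 a b ≤ p a ^ 2 + b ^ 2 / p`
  have b1 := integral_abs_mul_le_of_sq hD hF' (inv_pos.2 hp)
  have b2 := integral_abs_mul_le_of_sq hL hD' hp
  rw [inv_inv] at b1
  have c1 : (√β ^ K)⁻¹ * ∫ x, (fullPart v ν x - linPart v ν K x) ^ 2 ∂ν ≤ T ^ 2 * √β ^ K := by
    refine (mul_le_mul_of_nonneg_left q1 (inv_pos.2 hp).le).trans (le_of_eq ?_)
    field_simp
  have c2 : √β ^ K * ∫ x, fullPart v ν (seqShift m x) ^ 2 ∂ν ≤ √β ^ K * T ^ 2 :=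
    mul_le_mul_of_nonneg_left q2' hp.le
  have c3 : √β ^ K * ∫ x, linPart v ν K x ^ 2 ∂ν ≤ √β ^ K * (4 * T ^ 2) :=
    mul_le_mul_of_nonneg_left q3 hp.le
  have c4 : (√β ^ K)⁻¹ * ∫ x, (fullPart v ν (seqShift m x) - linPart v ν K (seqShift m x)) ^ 2 ∂ν
      ≤ T ^ 2 * √β ^ K := by
    refine (mul_le_mul_of_nonneg_left q1' (inv_pos.2 hp).le).trans (le_of_eq ?_)
    field_simp
  rw [e]
  refine (abs_add_le _ _).trans ?_
  have : 0 ≤ √β ^ K * T ^ 2 := by positivity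
  linarith

theorem abs_autocov_linPart_le (K L : ℕ) :
    |autocov (linPart v ν K) ν (K + L)| ≤ 18 * (1 / 2) ^ L * (2 * K * C) ^ 2 := by
  rcases Nat.eq_zero_or_pos K with rfl | hK
  · simp [autocov, linPart]
  have := abs_integral_mul_seqShift_sub_le hd hν (L := L) hK (hv.abs_linPart_le (ν := ν) K)
    (hv.abs_linPart_le (ν := ν) K) (hv.dependsOn_linPart K) (hv.dependsOn_linPart K)
  rw [hv.integral_linPart, zero_mul, sub_zero] at this
  rw [autocov, sq]
  exact this

theorem summable_autocov : Summable (autocov (fullPart v ν) ν) := by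
  set T := tailBound (2 * C) β 0 with hT
  have hseq := hv.isDecayingSeq_cproj hd hν
  have h1 : Summable fun K : ℕ => 4 * T ^ 2 * √β ^ K +
      72 * C ^ 2 * ((K : ℝ) ^ 2 * (1 / 2) ^ K) := by
    refine ((summable_geometric_of_lt_one hseq.sqrt_pos.le hseq.sqrt_lt_one).mul_left _).add
      (Summable.mul_left _ ?_)
    exact summable_pow_mul_geometric_of_norm_lt_one 2 (by norm_num)
  -- at lag `m` compare with the partial sum of the first `m / 2` kernels, whose terms at this lag
  -- are separated by at least `m / 2` letters
  refine Summable.of_norm_bounded (summable_comp_half h1) fun m => ?_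
  have h2 := hv.abs_autocov_sub_le hd hν (m / 2) m
  have h3 := hv.abs_autocov_linPart_le hd hν (m / 2) (m - m / 2)
  rw [show m / 2 + (m - m / 2) = m by omega] at h3
  have h4 : ((1 : ℝ) / 2) ^ (m - m / 2) ≤ (1 / 2) ^ (m / 2) :=
    pow_le_pow_of_le_one (by norm_num) (by norm_num) (by omega)
  have h5 : 18 * (1 / 2 : ℝ) ^ (m - m / 2) * (2 * ((m / 2 : ℕ) : ℝ) * C) ^ 2 ≤
      18 * (1 / 2 : ℝ) ^ (m / 2) * (2 * ((m / 2 : ℕ) : ℝ) * C) ^ 2 := by gcongr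
  have h6 := abs_add_le (autocov (fullPart v ν) ν m - autocov (linPart v ν (m / 2)) ν m)
    (autocov (linPart v ν (m / 2)) ν m)
  rw [sub_add_cancel] at h6
  rw [Real.norm_eq_abs]
  refine h6.trans ((add_le_add h2 (h3.trans h5)).trans (le_of_eq ?_))
  ring

/-- The variance of the partial sums grows at an asymptotically constant rate. -/
theorem tendsto_variance :
    Tendsto (fun n : ℕ => 1 / (n : ℝ) *
      ∫ x, (∑ i ∈ Finset.Icc 1 n, fullPart v ν (seqShift i x)) ^ 2 ∂ν) atTop
      (𝓝 (∑' m, autocov (fullPart v ν) ν m + ∑' m, autocov (fullPart v ν) ν (m + 1))) := by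
  set γ := autocov (fullPart v ν) ν with hγ
  have hF := hv.memLp_fullPart hd hν
  have hFi : ∀ i, MemLp (fun x => fullPart v ν (seqShift i x)) 2 ν := fun i =>
    hF.comp_measurePreserving (measurePreserving_seqShift hd hν i)
  have hsum := hv.summable_autocov hd hν
  have hsum' : Summable fun m => γ (m + 1) := (summable_nat_add_iff 1).2 hsum
  have step : ∀ n : ℕ, ∫ x, (∑ i ∈ Finset.Icc 1 (n + 1), fullPart v ν (seqShift i x)) ^ 2 ∂ν =
      ∫ x, (∑ i ∈ Finset.Icc 1 n, fullPart v ν (seqShift i x)) ^ 2 ∂ν +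
      (∑ m ∈ Finset.range (n + 1), γ m + ∑ m ∈ Finset.range n, γ (m + 1)) := by
    intro n
    have hS : MemLp (fun x => ∑ i ∈ Finset.Icc 1 n, fullPart v ν (seqShift i x)) 2 ν :=
      memLp_finsetSum _ fun i _ => hFi i
    have i1 := hS.integrable_sq
    have i2 : Integrable (fun x => (∑ i ∈ Finset.Icc 1 n, fullPart v ν (seqShift i x)) *
        fullPart v ν (seqShift (n + 1) x)) ν := hS.integrable_mul (hFi (n + 1))
    have i3 := (hFi (n + 1)).integrable_sq
    have e : ∀ x, (∑ i ∈ Finset.Icc 1 (n + 1), fullPart v ν (seqShift i x)) ^ 2 =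
        (∑ i ∈ Finset.Icc 1 n, fullPart v ν (seqShift i x)) ^ 2 +
        (2 * ((∑ i ∈ Finset.Icc 1 n, fullPart v ν (seqShift i x)) *
          fullPart v ν (seqShift (n + 1) x)) + fullPart v ν (seqShift (n + 1) x) ^ 2) := by
      intro x
      rw [Finset.sum_Icc_succ_top (by omega)]
      ring
    have cross : ∀ i ∈ Finset.Icc 1 n, ∫ x, fullPart v ν (seqShift i x) *
        fullPart v ν (seqShift (n + 1) x) ∂ν = γ (n + 1 - i) := by
      intro i hi
      have hi' := Finset.mem_Icc.1 hi
      have h := integral_comp_seqShift hd hν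
        (G := fun x => fullPart v ν x * fullPart v ν (seqShift (n + 1 - i) x))
        (hF.integrable_mul (hFi (n + 1 - i))).aestronglyMeasurable i
      rw [hγ, autocov, ← h]
      simp only [seqShift_seqShift]
      rw [show i + (n + 1 - i) = n + 1 by omega]
    have c1 : ∫ x, (∑ i ∈ Finset.Icc 1 n, fullPart v ν (seqShift i x)) *
        fullPart v ν (seqShift (n + 1) x) ∂ν = ∑ m ∈ Finset.range n, γ (m + 1) := by
      have i4 : ∀ i, Integrable (fun x => fullPart v ν (seqShift i x) *
          fullPart v ν (seqShift (n + 1) x)) ν := fun i => (hFi i).integrable_mul (hFi (n + 1))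
      simp only [Finset.sum_mul]
      rw [integral_finsetSum _ fun i _ => i4 i, Finset.sum_congr rfl cross]
      refine Finset.sum_bij' (fun i _ => n - i) (fun m _ => n - m) ?_ ?_ ?_ ?_ ?_ <;>
        intro i hi <;> simp only [Finset.mem_Icc, Finset.mem_range] at hi ⊢
      · omega
      · omega
      · omega
      · omega
      · congr 1; omega
    have c2 : ∫ x, fullPart v ν (seqShift (n + 1) x) ^ 2 ∂ν = γ 0 := by
      rw [integral_comp_seqShift hd hν (G := fun x => fullPart v ν x ^ 2)
        (hF.aestronglyMeasurable.pow 2), hγ, autocov]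
      congr 1; funext x
      rw [sq]; congr 2; funext j; simp [seqShift]
    simp only [e]
    have i23 : Integrable (fun x => 2 * ((∑ i ∈ Finset.Icc 1 n, fullPart v ν (seqShift i x)) *
        fullPart v ν (seqShift (n + 1) x)) + fullPart v ν (seqShift (n + 1) x) ^ 2) ν :=
      (i2.const_mul 2).add i3
    rw [integral_add i1 i23, integral_add (i2.const_mul 2) i3, integral_const_mul, c1, c2,
      Finset.sum_range_succ']
    ring
  have closed : ∀ n : ℕ, ∫ x, (∑ i ∈ Finset.Icc 1 n, fullPart v ν (seqShift i x)) ^ 2 ∂ν =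
      ∑ l ∈ Finset.range n,
        (∑ m ∈ Finset.range (l + 1), γ m + ∑ m ∈ Finset.range l, γ (m + 1)) := by
    intro n
    induction n with
    | zero => simp
    | succ n ih => rw [step, ih]; exact (Finset.sum_range_succ _ n).symm
  have lim : Tendsto (fun l => ∑ m ∈ Finset.range (l + 1), γ m + ∑ m ∈ Finset.range l, γ (m + 1))
      atTop (𝓝 (∑' m, γ m + ∑' m, γ (m + 1))) :=
    ((tendsto_add_atTop_iff_nat 1).2 hsum.hasSum.tendsto_sum_nat).add
      hsum'.hasSum.tendsto_sum_nat
  -- the increments of the variance converge, hence so do their averages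
  convert! lim.cesaro using 2 with n
  rw [closed, one_div]

/-- The local variance on long cyclic words, in terms of the autocovariances. -/
theorem abs_localVar_sub_le {n : ℕ} [NeZero n] {K : ℕ} (hK : 1 ≤ K) (hn : 16 * K ≤ n) :
    |localVar n d K (linPart v ν K) -
      (∑ m ∈ Finset.range (2 * K), autocov (fullPart v ν) ν (m + 1) +
        ∑ m ∈ Finset.range (2 * K), autocov (fullPart v ν) ν m)| ≤
      4 * K * (6 * (1 / 2) ^ K * (2 * K * C) ^ 2 + 4 * tailBound (2 * C) β 0 ^ 2 * √β ^ K) := by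
  set γ := autocov (fullPart v ν) ν with hγ
  set f := linPart v ν K with hf
  set ε := 6 * (1 / 2) ^ K * (2 * K * C) ^ 2 + 4 * tailBound (2 * C) β 0 ^ 2 * √β ^ K with hε
  have hfd : DependsOn f (Set.Iio K) := hv.dependsOn_linPart K
  have hfb : ∀ x, |f x| ≤ 2 * K * C := hv.abs_linPart_le K
  have lag : ∀ m ≤ 2 * K, |(cycMean d fun w : ZMod n → A => f (win w 0) * f (win w (m : ZMod n))) -
      γ m| ≤ ε := by
    intro m hm
    have h1 := abs_cycMean_sub_integral_le (n := n) hd hν (m := 3 * K) (L := K) (by omega)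
      (by omega) (F := fun x => f x * f (seqShift m x)) (M := (2 * K * C) ^ 2)
      (fun x => by
        rw [abs_mul, sq]
        exact mul_le_mul (hfb _) (hfb _) (abs_nonneg _) ((abs_nonneg _).trans (hfb x)))
      (dependsOn_comp₂ (hfd.mono (Set.Iio_subset_Iio (by omega)))
        ((dependsOn_seqShift hfd m).mono (Set.Iio_subset_Iio (by omega))) _)
    simp only [seqShift_win, zero_add] at h1
    have h2 := hv.abs_autocov_sub_le hd hν K m
    rw [abs_sub_comm] at h2
    exact (abs_sub_le _ _ _).trans (add_le_add h1 h2)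
  have e : localVar n d K f =
      ∑ m ∈ Finset.range (2 * K), (cycMean d fun w : ZMod n → A =>
        f (win w 0) * f (win w ((m + 1 : ℕ) : ZMod n))) +
      ∑ m ∈ Finset.range (2 * K), cycMean d fun w : ZMod n → A =>
        f (win w 0) * f (win w (m : ZMod n)) := by
    have e1 : localVar n d K f = ∑ j ∈ Finset.range (4 * K), cycMean d fun w : ZMod n → A =>
        f (win w ((2 * K : ℕ) : ZMod n)) * f (win w (j : ZMod n)) := by
      rw [localVar]
      simp only [arcSum, Finset.mul_sum, cycMean_sum, Finset.range_eq_Ico]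
    have r : ∀ (a c : ℕ), (cycMean d fun w : ZMod n → A =>
        f (win w (c : ZMod n)) * f (win w ((c + a : ℕ) : ZMod n))) =
        cycMean d fun w : ZMod n → A => f (win w 0) * f (win w (a : ZMod n)) := fun a c => by
      rw [← cycMean_rotate (c : ZMod n) fun w : ZMod n → A => f (win w 0) * f (win w (a : ZMod n))]
      simp only [win_rotate, zero_add, Nat.cast_add, add_comm (c : ZMod n) (a : ZMod n)]
    rw [e1, show 4 * K = 2 * K + 2 * K by ring, Finset.sum_range_add]
    congr 1
    · rw [← Finset.sum_range_reflect]
      refine Finset.sum_congr rfl fun m hm => ?_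
      have hm' := Finset.mem_range.1 hm
      rw [← r (m + 1) (2 * K - 1 - m), show 2 * K - 1 - m + (m + 1) = 2 * K by omega]
      simp only [mul_comm]
    · exact Finset.sum_congr rfl fun m _ => r m (2 * K)
  rw [e, add_sub_add_comm, ← Finset.sum_sub_distrib, ← Finset.sum_sub_distrib]
  have s1 : |∑ m ∈ Finset.range (2 * K), ((cycMean d fun w : ZMod n → A =>
        f (win w 0) * f (win w ((m + 1 : ℕ) : ZMod n))) - γ (m + 1))| ≤ 2 * K * ε := by
    refine (Finset.abs_sum_le_sum_abs _ _).trans ((Finset.sum_le_card_nsmul _ _ ε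
      fun m hm => lag (m + 1) (Finset.mem_range.1 hm)).trans ?_)
    rw [Finset.card_range, nsmul_eq_mul]; push_cast; exact le_rfl
  have s2 : |∑ m ∈ Finset.range (2 * K), ((cycMean d fun w : ZMod n → A =>
        f (win w 0) * f (win w (m : ZMod n))) - γ m)| ≤ 2 * K * ε := by
    refine (Finset.abs_sum_le_sum_abs _ _).trans ((Finset.sum_le_card_nsmul _ _ ε
      fun m hm => lag m (Finset.mem_range.1 hm).le).trans ?_)
    rw [Finset.card_range, nsmul_eq_mul]; push_cast; exact le_rfl
  refine (abs_add_le _ _).trans ((add_le_add s1 s2).trans (le_of_eq ?_))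
  ring

end IsKernelSeq

end Autocovariance

/-! ### The limit law for random cyclic words -/

section Limit

/-- The sum over pairs `i < j`, counted twice, and the diagonal make up the full double sum. -/
theorem two_mul_sum_lt_add_sum_diag {f : ℕ → ℕ → ℝ} (hf : ∀ i j, f i j = f j i) (n : ℕ) :
    2 * ∑ i ∈ Finset.Icc 1 n, ∑ j ∈ Finset.Icc (i + 1) n, f i j + ∑ i ∈ Finset.Icc 1 n, f i i =
      ∑ i ∈ Finset.Icc 1 n, ∑ j ∈ Finset.Icc 1 n, f i j := by
  induction n with
  | zero => simp
  | succ n ih =>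
    have e1 : ∑ i ∈ Finset.Icc 1 (n + 1), ∑ j ∈ Finset.Icc (i + 1) (n + 1), f i j =
        ∑ i ∈ Finset.Icc 1 n, ∑ j ∈ Finset.Icc (i + 1) n, f i j +
          ∑ i ∈ Finset.Icc 1 n, f i (n + 1) := by
      rw [Finset.sum_Icc_succ_top (by omega), ← Finset.sum_add_distrib]
      simp only [Finset.Icc_eq_empty_of_lt (Nat.lt_succ_self (n + 1)), Finset.sum_empty, add_zero]
      refine Finset.sum_congr rfl fun i hi => ?_
      rw [Finset.sum_Icc_succ_top (by have := (Finset.mem_Icc.1 hi).2; omega)]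
    have e2 : ∑ i ∈ Finset.Icc 1 (n + 1), ∑ j ∈ Finset.Icc 1 (n + 1), f i j =
        ∑ i ∈ Finset.Icc 1 n, ∑ j ∈ Finset.Icc 1 n, f i j + ∑ i ∈ Finset.Icc 1 n, f i (n + 1) +
          (∑ i ∈ Finset.Icc 1 n, f i (n + 1) + f (n + 1) (n + 1)) := by
      rw [Finset.sum_Icc_succ_top (by omega), Finset.sum_Icc_succ_top (by omega),
        ← Finset.sum_add_distrib]
      congr 1
      · exact Finset.sum_congr rfl fun i _ => Finset.sum_Icc_succ_top (by omega) _
      · simp only [hf (n + 1)]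
    rw [e1, e2, Finset.sum_Icc_succ_top (by omega), ← ih]
    ring

theorem sum_Icc_eq_sum_zmod {n : ℕ} [NeZero n] (f : ZMod n → ℝ) :
    ∑ i ∈ Finset.Icc 1 n, f (i : ZMod n) = ∑ z, f z := by
  rw [← Equiv.sum_comp (Equiv.addRight (1 : ZMod n)), sum_zmod_eq_range]
  refine Finset.sum_bij' (fun i _ => i - 1) (fun j _ => j + 1) ?_ ?_ ?_ ?_ ?_ <;>
    intro i hi <;> simp only [Finset.mem_Icc, Finset.mem_range] at hi ⊢
  · omega
  · omega
  · omega
  · omega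
  · obtain ⟨j, rfl⟩ : ∃ j, i = j + 1 := ⟨i - 1, by omega⟩
    simp

theorem sum_Ico_geometric_le {C β : ℝ} (hC : 0 ≤ C) (h0 : 0 < β) (h1 : β < 1) (K n : ℕ) :
    ∑ k ∈ Finset.Ico K n, C * β ^ k ≤ C * β ^ K / (1 - β) := by
  have hs := (summable_geometric_of_lt_one h0.le h1)
  rw [← Finset.mul_sum, mul_div_assoc]
  refine mul_le_mul_of_nonneg_left ?_ hC
  rw [Finset.sum_Ico_eq_sum_range]
  simp only [pow_add, ← Finset.mul_sum]
  rw [div_eq_mul_inv, ← tsum_geometric_of_lt_one h0.le h1]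
  exact mul_le_mul_of_nonneg_left (hs.sum_le_tsum _ fun i _ => by positivity) (by positivity)

variable {A : Type*} [Fintype A] [Nonempty A] [MeasurableSpace A] [DiscreteMeasurableSpace A]
variable {d : A → A → ℝ}
variable (hd : IsChainDensity d) {ν : Measure (ℕ → A)} [IsProbabilityMeasure ν]
  (hν : IsChainLaw d ν)

/-- The U-statistic of a cyclic word of length `n`: the sum of the first `n` kernels over all pairs
of positions. -/
noncomputable def kernelCount {n : ℕ} (v : ℕ → (ℕ → A) → (ℕ → A) → ℝ) (w : ZMod n → A) : ℝ :=
  ∑ i ∈ Finset.Icc 1 n, ∑ j ∈ Finset.Icc (i + 1) n, ∑ k ∈ Finset.range n,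
    v k (win w (i : ZMod n)) (win w (j : ZMod n))

omit [DiscreteMeasurableSpace A] [Fintype A] [Nonempty A] [IsProbabilityMeasure ν] in
/-- The Hoeffding decomposition. -/
theorem sum_kernel_eq (v : ℕ → (ℕ → A) → (ℕ → A) → ℝ) (K : ℕ) (x y : ℕ → A) :
    ∑ k ∈ Finset.range K, v k x y = degPart v ν K x y + linPart v ν K x + linPart v ν K y +
      ∑ k ∈ Finset.range K, projMean v ν k := by
  simp only [degPart, linPart, ← Finset.sum_add_distrib, cproj]
  exact Finset.sum_congr rfl fun k _ => by ring

namespace IsKernelSeq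

variable {v : ℕ → (ℕ → A) → (ℕ → A) → ℝ} {C β : ℝ} (hv : IsKernelSeq d v C β)
include hv

omit [DiscreteMeasurableSpace A] [MeasurableSpace A] in
include hd in
/-- The kernels of large index contribute little, by the exponential decay. -/
theorem cycMean_abs_tail_le {n : ℕ} [NeZero n] (K : ℕ) :
    (cycMean d fun w : ZMod n → A => |∑ i ∈ Finset.Icc 1 n, ∑ j ∈ Finset.Icc (i + 1) n,
      ∑ k ∈ Finset.Ico K n, v k (win w (i : ZMod n)) (win w (j : ZMod n))|) ≤
      (n : ℝ) ^ 2 * (C * β ^ K / (1 - β)) := by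
  have hC := hv.bound_nonneg
  have hβ : 0 < 1 - β := by linarith [hv.lt_one]
  have hB : 0 ≤ C * β ^ K / (1 - β) := by
    have := hv.pos
    positivity
  have h1 : (cycMean d fun w : ZMod n → A => |∑ i ∈ Finset.Icc 1 n, ∑ j ∈ Finset.Icc (i + 1) n,
      ∑ k ∈ Finset.Ico K n, v k (win w (i : ZMod n)) (win w (j : ZMod n))|) ≤
      cycMean d fun w : ZMod n → A => ∑ i ∈ Finset.Icc 1 n, ∑ j ∈ Finset.Icc (i + 1) n,
      ∑ k ∈ Finset.Ico K n, |v k (win w (i : ZMod n)) (win w (j : ZMod n))| := by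
    refine cycMean_mono hd fun w => ?_
    refine (Finset.abs_sum_le_sum_abs _ _).trans (Finset.sum_le_sum fun i _ => ?_)
    refine (Finset.abs_sum_le_sum_abs _ _).trans (Finset.sum_le_sum fun j _ => ?_)
    exact Finset.abs_sum_le_sum_abs _ _
  refine h1.trans ?_
  simp only [cycMean_sum]
  have h2 : ∀ i ∈ Finset.Icc 1 n, ∀ j ∈ Finset.Icc (i + 1) n, ∑ k ∈ Finset.Ico K n,
      (cycMean d fun w : ZMod n → A => |v k (win w (i : ZMod n)) (win w (j : ZMod n))|) ≤
      C * β ^ K / (1 - β) := by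
    intro i hi j hj
    have hi' := Finset.mem_Icc.1 hi
    have hj' := Finset.mem_Icc.1 hj
    refine (Finset.sum_le_sum fun k hk => ?_).trans
      (sum_Ico_geometric_le hC hv.pos hv.lt_one K n)
    have hk' := Finset.mem_Ico.1 hk
    refine le_trans (le_of_eq ?_) (hv.decay n k (j - i) (by omega) (by omega) (by omega))
    rw [← cycMean_rotate (i : ZMod n) fun w : ZMod n → A =>
      |v k (win w 0) (win w ((j - i : ℕ) : ZMod n))|]
    simp only [win_rotate, zero_add]
    rw [Nat.cast_sub (by omega), sub_add_cancel]
  refine (Finset.sum_le_card_nsmul _ _ (n * (C * β ^ K / (1 - β))) fun i hi => ?_).trans ?_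
  · refine (Finset.sum_le_card_nsmul _ _ _ (h2 i hi)).trans ?_
    rw [nsmul_eq_mul, Nat.card_Icc]
    refine mul_le_mul_of_nonneg_right ?_ hB
    exact_mod_cast (by omega : n + 1 - (i + 1) ≤ n)
  · rw [nsmul_eq_mul, Nat.card_Icc, Nat.add_sub_cancel, sq, mul_assoc]

include hd hν

theorem abs_sum_projMean_sub_le {κ : ℝ} (hκ : HasSum (projMean v ν) (2 * κ)) (K : ℕ) :
    |∑ k ∈ Finset.range K, projMean v ν k - 2 * κ| ≤ C * β ^ K / (1 - β) := by
  have hs := summable_geometric_of_lt_one hv.pos.le hv.lt_one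
  rw [← hκ.tsum_eq, ← hκ.summable.sum_add_tsum_nat_add K, abs_sub_comm, add_sub_cancel_left,
    ← Real.norm_eq_abs]
  have hg : HasSum (fun k : ℕ => C * β ^ K * β ^ k) (C * β ^ K * (1 - β)⁻¹) :=
    (hasSum_geometric_of_lt_one hv.pos.le hv.lt_one).mul_left _
  refine (tsum_of_norm_bounded hg fun k => ?_).trans (le_of_eq (div_eq_mul_inv _ _).symm)
  refine (hv.abs_projMean_le hd hν (k + K)).trans (le_of_eq ?_)
  rw [pow_add]; ring

/-- **Linearization.** Up to a small error in mean, the U-statistic is `n` times the sum of the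
Hoeffding projection along the cyclic word. -/
theorem cycMean_abs_kernelCount_sub_le {n : ℕ} [NeZero n] {K : ℕ} (hK : 1 ≤ K) (hn : 16 * K ≤ n)
    {κ : ℝ} (hκ : HasSum (projMean v ν) (2 * κ)) :
    (cycMean d fun w : ZMod n → A =>
      |kernelCount v w - (n : ℝ) ^ 2 * κ - n * cycSum (linPart v ν K) w|) ≤
      3 / 2 * (n : ℝ) ^ 2 * (C * β ^ K / (1 - β)) + 1 / 2 * (n * (K * C)) +
        1 / 4 * ((2304 * C ^ 2 + 1) * (n * K ^ 2) + 384 * C ^ 2 * ((n : ℝ) ^ 3 * (1 / 2) ^ K)) := by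
  have hC := hv.bound_nonneg
  have hn2 : 2 ≤ n := by omega
  have hn0 : (0 : ℝ) < n := by exact_mod_cast (by omega : 0 < n)
  have hK0 : (0 : ℝ) < K := by exact_mod_cast hK
  set tail : (ZMod n → A) → ℝ := fun w => ∑ i ∈ Finset.Icc 1 n, ∑ j ∈ Finset.Icc (i + 1) n,
      ∑ k ∈ Finset.Ico K n, v k (win w (i : ZMod n)) (win w (j : ZMod n)) with htail
  set u : (ℕ → A) → (ℕ → A) → ℝ := fun x y => ∑ k ∈ Finset.range K, v k x y with hu
  set θ := ∑ k ∈ Finset.range K, projMean v ν k with hθ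
  -- the weight with which `|X| ≤ X ^ 2 / (2 p) + p / 2` is applied to the degenerate part
  set p : ℝ := n * K ^ 2 with hp
  have hp0 : 0 < p := by positivity
  have hub : ∀ x y, |u x y| ≤ K * C := fun x y => by
    refine (Finset.abs_sum_le_sum_abs _ _).trans ((Finset.sum_le_card_nsmul _ _ C
      fun k _ => hv.abs_le k x y).trans ?_)
    rw [Finset.card_range, nsmul_eq_mul]
  have split : ∀ w : ZMod n → A, kernelCount v w =
      ∑ i ∈ Finset.Icc 1 n, ∑ j ∈ Finset.Icc (i + 1) n,
        u (win w (i : ZMod n)) (win w (j : ZMod n)) + tail w := fun w => by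
    simp only [kernelCount, htail, hu, ← Finset.sum_add_distrib]
    refine Finset.sum_congr rfl fun i _ => Finset.sum_congr rfl fun j _ => ?_
    exact (Finset.sum_range_add_sum_Ico _ (by omega)).symm
  have full : ∀ w : ZMod n → A, 2 * ∑ i ∈ Finset.Icc 1 n, ∑ j ∈ Finset.Icc (i + 1) n,
        u (win w (i : ZMod n)) (win w (j : ZMod n)) + ∑ z, u (win w z) (win w z) =
      cycSum₂ (degPart v ν K) w + 2 * n * cycSum (linPart v ν K) w + (n : ℝ) ^ 2 * θ := fun w => by
    have h1 := two_mul_sum_lt_add_sum_diag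
      (f := fun i j => u (win w (i : ZMod n)) (win w (j : ZMod n)))
      (fun i j => Finset.sum_congr rfl fun k _ => hv.symm k _ _) n
    rw [sum_Icc_eq_sum_zmod fun z => u (win w z) (win w z)] at h1
    rw [h1]
    have h2 : ∀ i : ℕ, ∑ j ∈ Finset.Icc 1 n, u (win w (i : ZMod n)) (win w (j : ZMod n)) =
        ∑ z, u (win w (i : ZMod n)) (win w z) := fun i =>
      sum_Icc_eq_sum_zmod fun z => u (win w (i : ZMod n)) (win w z)
    simp only [h2]
    rw [sum_Icc_eq_sum_zmod fun z' => ∑ z, u (win w z') (win w z)]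
    simp only [hu, sum_kernel_eq (ν := ν), Finset.sum_add_distrib, Finset.sum_const,
      Finset.card_univ, ZMod.card, nsmul_eq_mul, ← Finset.mul_sum, cycSum₂, cycSum, hθ]
    ring
  have key : ∀ w : ZMod n → A,
      |kernelCount v w - (n : ℝ) ^ 2 * κ - n * cycSum (linPart v ν K) w| ≤
      (|tail w| + 1 / 4 * p⁻¹ * cycSum₂ (degPart v ν K) w ^ 2) +
        (1 / 4 * p + 1 / 2 * ((n : ℝ) ^ 2 * (C * β ^ K / (1 - β))) + 1 / 2 * (n * (K * C))) := by
    intro w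
    have e : kernelCount v w - (n : ℝ) ^ 2 * κ - n * cycSum (linPart v ν K) w =
        tail w + 1 / 2 * cycSum₂ (degPart v ν K) w + 1 / 2 * ((n : ℝ) ^ 2 * (θ - 2 * κ)) -
          1 / 2 * ∑ z, u (win w z) (win w z) := by
      have := full w
      rw [split w]
      linarith
    have b1 : |∑ z, u (win w z) (win w z)| ≤ n * (K * C) := by
      refine (Finset.abs_sum_le_sum_abs _ _).trans ((Finset.sum_le_card_nsmul _ _ (K * C)
        fun z _ => hub _ _).trans ?_)
      rw [Finset.card_univ, ZMod.card, nsmul_eq_mul]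
    have b2 : |(n : ℝ) ^ 2 * (θ - 2 * κ)| ≤ (n : ℝ) ^ 2 * (C * β ^ K / (1 - β)) := by
      rw [abs_mul, abs_of_nonneg (sq_nonneg (n : ℝ))]
      exact mul_le_mul_of_nonneg_left (hv.abs_sum_projMean_sub_le hd hν hκ K) (sq_nonneg _)
    have b3 : |cycSum₂ (degPart v ν K) w| ≤
        1 / 2 * p⁻¹ * cycSum₂ (degPart v ν K) w ^ 2 + 1 / 2 * p := by
      set X := cycSum₂ (degPart v ν K) w
      have : 1 / 2 * p⁻¹ * X ^ 2 + 1 / 2 * p - |X| = 1 / 2 * p⁻¹ * (|X| - p) ^ 2 := by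
        rw [← sq_abs X]; field_simp; ring
      have : 0 ≤ 1 / 2 * p⁻¹ * (|X| - p) ^ 2 := by positivity
      linarith
    rw [e]
    have t1 := abs_sub (tail w + 1 / 2 * cycSum₂ (degPart v ν K) w +
      1 / 2 * ((n : ℝ) ^ 2 * (θ - 2 * κ))) (1 / 2 * ∑ z, u (win w z) (win w z))
    have t2 := abs_add_three (tail w) (1 / 2 * cycSum₂ (degPart v ν K) w)
      (1 / 2 * ((n : ℝ) ^ 2 * (θ - 2 * κ)))
    rw [abs_mul (1 / 2) (cycSum₂ (degPart v ν K) w), abs_mul (1 / 2) ((n : ℝ) ^ 2 * (θ - 2 * κ)),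
      abs_of_pos (by norm_num : (0 : ℝ) < 1 / 2)] at t2
    rw [abs_mul (1 / 2) (∑ z, u (win w z) (win w z)),
      abs_of_pos (by norm_num : (0 : ℝ) < 1 / 2)] at t1
    linarith
  refine (cycMean_mono hd key).trans ?_
  have hdeg := cycMean_sq_cycSum₂_le (n := n) hd hν (hv.dependsOn_degPart K) (hv.degPart_symm K) hK
    (hv.abs_degPart_le K) (hv.integral_degPart K) hn
  rw [cycMean_add, cycMean_add, cycMean_const hd hn2, cycMean_const_mul]
  have ht := hv.cycMean_abs_tail_le hd (n := n) K
  have h3 := mul_le_mul_of_nonneg_left hdeg (by positivity : (0 : ℝ) ≤ 1 / 4 * p⁻¹)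
  have h4 : 1 / 4 * p⁻¹ * (144 * (n : ℝ) ^ 2 * K ^ 2 * (4 * K * C) ^ 2 +
      (n : ℝ) ^ 4 * (24 * (1 / 2) ^ K * (4 * K * C) ^ 2)) =
      1 / 4 * (2304 * C ^ 2 * (n * K ^ 2) + 384 * C ^ 2 * ((n : ℝ) ^ 3 * (1 / 2) ^ K)) := by
    rw [hp]; field_simp; ring
  rw [h4] at h3
  rw [hp] at *
  linarith

end IsKernelSeq

end Limit

/-! ### Convergence of the characteristic functions -/

section Convergence

/-- The truncation level at length `n`: the integer part of the sixteenth root of `n`. It grows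
slower than the scales `n ^ (1/2)` at stake, but exponentials in it beat any power of `n`. -/
def truncLevel (n : ℕ) : ℕ := Nat.findGreatest (fun K => K ^ 16 ≤ n) n

theorem truncLevel_pow_le (n : ℕ) : truncLevel n ^ 16 ≤ n :=
  Nat.findGreatest_spec (P := fun K => K ^ 16 ≤ n) (Nat.zero_le n) (by simp)

theorem le_truncLevel {K n : ℕ} (h : K ^ 16 ≤ n) : K ≤ truncLevel n :=
  Nat.le_findGreatest ((Nat.le_self_pow (by norm_num) K).trans h) h

theorem lt_truncLevel_succ_pow (n : ℕ) : n < (truncLevel n + 1) ^ 16 := by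
  by_contra h
  have := le_truncLevel (not_lt.1 h)
  omega

theorem tendsto_truncLevel : Tendsto truncLevel atTop atTop :=
  tendsto_atTop.2 fun K => (eventually_ge_atTop (K ^ 16)).mono fun _ h => le_truncLevel h

attribute [irreducible] truncLevel

theorem truncLevel_mul_le {n : ℕ} (h : 2 ≤ truncLevel n) : 16 * truncLevel n ≤ n := by
  refine le_trans ?_ (truncLevel_pow_le n)
  have h1 : 2 ^ 15 ≤ truncLevel n ^ 15 := Nat.pow_le_pow_left h 15
  rw [pow_succ]
  exact Nat.mul_le_mul_right _ (by omega)

theorem truncLevel_pow_le_sqrt (n : ℕ) : (truncLevel n : ℝ) ^ 8 ≤ √n := by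
  refine Real.le_sqrt_of_sq_le ?_
  rw [← pow_mul]
  exact_mod_cast truncLevel_pow_le n

theorem sqrt_le_truncLevel_pow (n : ℕ) : √n ≤ ((truncLevel n : ℝ) + 1) ^ 8 := by
  refine Real.sqrt_le_iff.2 ⟨by positivity, ?_⟩
  rw [← pow_mul]
  exact_mod_cast (lt_truncLevel_succ_pow n).le

theorem tendsto_succ_pow_mul_pow (p : ℕ) {r : ℝ} (h0 : 0 < r) (h1 : r < 1) :
    Tendsto (fun K : ℕ => ((K : ℝ) + 1) ^ p * r ^ K) atTop (𝓝 0) := by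
  have h := ((tendsto_add_atTop_iff_nat 1).2
    (tendsto_pow_const_mul_const_pow_of_lt_one p h0.le h1)).const_mul r⁻¹
  rw [mul_zero] at h
  refine h.congr fun K => ?_
  rw [pow_succ]
  push_cast
  field_simp

theorem rpow_three_halves (n : ℕ) : (n : ℝ) ^ (3 / 2 : ℝ) = √n ^ 3 := by
  rw [Real.sqrt_eq_rpow, ← Real.rpow_natCast, ← Real.rpow_mul (Nat.cast_nonneg n)]
  norm_num

/-- The error terms of the linearization, at scale `s ^ 3 = n ^ (3 / 2)`. -/
theorem linearization_error_le {s K C D : ℝ} (hs : 0 < s) (hK : 1 ≤ K) (hC : 0 ≤ C) (hD : 0 ≤ D)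
    {b h : ℝ} (hb : 0 ≤ b) (hh : 0 ≤ h) (h1 : K ^ 8 ≤ s) (h2 : s ≤ (K + 1) ^ 8) :
    (3 / 2 * (s ^ 2) ^ 2 * (D * b) + 1 / 2 * (s ^ 2 * (K * C)) +
        1 / 4 * ((2304 * C ^ 2 + 1) * (s ^ 2 * K ^ 2) + 384 * C ^ 2 * ((s ^ 2) ^ 3 * h))) / s ^ 3 ≤
      3 / 2 * D * ((K + 1) ^ 8 * b) + (1 / 2 * C + 1 / 4 * (2304 * C ^ 2 + 1)) * K⁻¹ +
        96 * C ^ 2 * ((K + 1) ^ 24 * h) := by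
  have hK0 : 0 < K := by linarith
  have e : (3 / 2 * (s ^ 2) ^ 2 * (D * b) + 1 / 2 * (s ^ 2 * (K * C)) +
        1 / 4 * ((2304 * C ^ 2 + 1) * (s ^ 2 * K ^ 2) + 384 * C ^ 2 * ((s ^ 2) ^ 3 * h))) / s ^ 3 =
      3 / 2 * D * (s * b) + (1 / 2 * C * (K / s) + 1 / 4 * (2304 * C ^ 2 + 1) * (K ^ 2 / s)) +
        96 * C ^ 2 * (s ^ 3 * h) := by
    field_simp
    ring
  have p1 : K / s ≤ K⁻¹ := by
    rw [div_le_iff₀ hs, inv_mul_eq_div, le_div_iff₀ hK0, ← sq]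
    exact (pow_le_pow_right₀ hK (by norm_num)).trans h1
  have p2 : K ^ 2 / s ≤ K⁻¹ := by
    rw [div_le_iff₀ hs, inv_mul_eq_div, le_div_iff₀ hK0, ← pow_succ]
    exact (pow_le_pow_right₀ hK (by norm_num)).trans h1
  have p3 : s ^ 3 ≤ (K + 1) ^ 24 := by
    have := pow_le_pow_left₀ hs.le h2 3
    rwa [← pow_mul] at this
  rw [e, add_mul]
  gcongr

/-- The error terms of the quantitative central limit theorem, at argument `t / s` with
`s = n ^ (1 / 2)`. -/
theorem clt_error_le {s K C t : ℝ} (hs : 0 < s) (hK : 1 ≤ K) (hC : 0 ≤ C)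
    {h : ℝ} (hh : 0 ≤ h) (h1 : K ^ 8 ≤ s) (h2 : s ≤ (K + 1) ^ 8) :
    |t / s| * s ^ 2 * (80 * (t / s) ^ 2 * K ^ 2 * (2 * K * C) ^ 3 +
        h * (2 * K * C) * (24 + 72 * |t / s| * K * (2 * K * C))) ≤
      |t| * (640 * t ^ 2 * C ^ 3 * K⁻¹ + 2 * C * (24 + 144 * |t| * C) * ((K + 1) ^ 9 * h)) := by
  have hK0 : 0 < K := by linarith
  rw [abs_div, abs_of_pos hs]
  have e : |t| / s * s ^ 2 * (80 * (t / s) ^ 2 * K ^ 2 * (2 * K * C) ^ 3 +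
        h * (2 * K * C) * (24 + 72 * (|t| / s) * K * (2 * K * C))) =
      |t| * (640 * t ^ 2 * C ^ 3 * (K ^ 5 / s) +
        2 * C * (24 + 144 * |t| * C * (K ^ 2 / s)) * (s * K * h)) := by
    field_simp
    ring
  have p1 : K ^ 5 / s ≤ K⁻¹ := by
    rw [div_le_iff₀ hs, inv_mul_eq_div, le_div_iff₀ hK0, ← pow_succ]
    exact (pow_le_pow_right₀ hK (by norm_num)).trans h1
  have p2 : 144 * |t| * C * (K ^ 2 / s) ≤ 144 * |t| * C := by
    refine mul_le_of_le_one_right (by positivity) ?_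
    rw [div_le_one hs]
    exact (pow_le_pow_right₀ hK (by norm_num)).trans h1
  have p3 : s * K ≤ (K + 1) ^ 9 := by
    rw [pow_succ]
    exact mul_le_mul h2 (by linarith) hK0.le (by positivity)
  rw [e]
  gcongr

variable {A : Type*} [Fintype A] [Nonempty A] [MeasurableSpace A] [DiscreteMeasurableSpace A]
variable {d : A → A → ℝ}
variable (hd : IsChainDensity d) {ν : Measure (ℕ → A)} [IsProbabilityMeasure ν]
  (hν : IsChainLaw d ν)

/-- The limiting variance: the sum over all integers of the autocovariances of the full
projection. -/
noncomputable def asympVar (v : ℕ → (ℕ → A) → (ℕ → A) → ℝ) (ν : Measure (ℕ → A)) : ℝ :=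
  ∑' m, autocov (fullPart v ν) ν m + ∑' m, autocov (fullPart v ν) ν (m + 1)

namespace IsKernelSeq

variable {v : ℕ → (ℕ → A) → (ℕ → A) → ℝ} {C β : ℝ} (hv : IsKernelSeq d v C β)
include hv hd hν

theorem tendsto_localVar :
    Tendsto (fun N : ℕ => localVar (N + 1) d (truncLevel (N + 1))
      (linPart v ν (truncLevel (N + 1)))) atTop (𝓝 (asympVar v ν)) := by
  set γ := autocov (fullPart v ν) ν with hγ
  have hK : Tendsto (fun N : ℕ => truncLevel (N + 1)) atTop atTop :=
    tendsto_truncLevel.comp (tendsto_add_atTop_nat 1)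
  have hs : Summable γ := hv.summable_autocov hd hν
  have hs1 : Summable fun m => γ (m + 1) := (summable_nat_add_iff 1).2 hs
  have h2 : Tendsto (fun K : ℕ => 2 * K) atTop atTop :=
    tendsto_atTop_mono (fun K => Nat.le_mul_of_pos_left K two_pos) tendsto_id
  have hmain : Tendsto (fun K : ℕ => ∑ m ∈ Finset.range (2 * K), γ (m + 1) +
      ∑ m ∈ Finset.range (2 * K), γ m) atTop (𝓝 (asympVar v ν)) := by
    rw [asympVar, add_comm]
    exact (hs1.hasSum.tendsto_sum_nat.comp h2).add (hs.hasSum.tendsto_sum_nat.comp h2)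
  have hdec := hv.isDecayingSeq_cproj hd hν
  have herr : Tendsto (fun K : ℕ => 4 * K * (6 * (1 / 2) ^ K * (2 * K * C) ^ 2 +
      4 * tailBound (2 * C) β 0 ^ 2 * √β ^ K)) atTop (𝓝 0) := by
    have a1 := (tendsto_pow_const_mul_const_pow_of_lt_one 3 (r := (1 / 2 : ℝ)) (by norm_num)
      (by norm_num)).const_mul (96 * C ^ 2)
    have a2 := (tendsto_pow_const_mul_const_pow_of_lt_one 1 hdec.sqrt_pos.le
      hdec.sqrt_lt_one).const_mul (16 * tailBound (2 * C) β 0 ^ 2)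
    have := a1.add a2
    rw [mul_zero, mul_zero, add_zero] at this
    refine this.congr fun K => ?_
    ring
  have := (hmain.comp hK).add (squeeze_zero_norm' (f := fun N : ℕ => localVar (N + 1) d
      (truncLevel (N + 1)) (linPart v ν (truncLevel (N + 1))) -
      (∑ m ∈ Finset.range (2 * truncLevel (N + 1)), γ (m + 1) +
        ∑ m ∈ Finset.range (2 * truncLevel (N + 1)), γ m)) ?_ (herr.comp hK))
  · rw [add_zero] at this
    refine this.congr fun N => ?_
    simp only [Function.comp_apply]
    ring
  · filter_upwards [hK.eventually_ge_atTop 2] with N hN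
    exact hv.abs_localVar_sub_le hd hν (by omega) (truncLevel_mul_le hN)

/-- Under the cyclic Markov measures, the characteristic functions of the normalized
U-statistics converge to a Gaussian one. -/
theorem tendsto_cycMean_cexp_kernelCount {κ : ℝ} (hκ : HasSum (projMean v ν) (2 * κ)) (t : ℝ) :
    Tendsto (fun N : ℕ => cycMean d fun w : ZMod (N + 1) → A => Complex.exp (Complex.I *
      ((t * ((kernelCount v w - ((N + 1 : ℕ) : ℝ) ^ 2 * κ) / ((N + 1 : ℕ) : ℝ) ^ (3 / 2 : ℝ)) : ℝ) :
        ℂ))) atTop (𝓝 (Complex.exp ((-(asympVar v ν * t ^ 2 / 2) : ℝ) : ℂ))) := by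
  have hC := hv.bound_nonneg
  have hβ : 0 < 1 - β := by linarith [hv.lt_one]
  set D := C / (1 - β) with hD
  have hD0 : 0 ≤ D := by positivity
  set lv : ℕ → ℝ := fun N => localVar (N + 1) d (truncLevel (N + 1))
      (linPart v ν (truncLevel (N + 1))) with hlv
  have hlim : Tendsto lv atTop (𝓝 (asympVar v ν)) := hv.tendsto_localVar hd hν
  have hK : Tendsto (fun N : ℕ => truncLevel (N + 1)) atTop atTop :=
    tendsto_truncLevel.comp (tendsto_add_atTop_nat 1)
  set E1 : ℕ → ℝ := fun K => |t| * (3 / 2 * D * (((K : ℝ) + 1) ^ 8 * β ^ K) +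
    (1 / 2 * C + 1 / 4 * (2304 * C ^ 2 + 1)) * (K : ℝ)⁻¹ +
    96 * C ^ 2 * (((K : ℝ) + 1) ^ 24 * (1 / 2) ^ K)) with hE1
  set E2 : ℕ → ℝ := fun K => |t| * (640 * t ^ 2 * C ^ 3 * (K : ℝ)⁻¹ +
    2 * C * (24 + 144 * |t| * C) * (((K : ℝ) + 1) ^ 9 * (1 / 2) ^ K)) with hE2
  have lim1 : Tendsto E1 atTop (𝓝 0) := by
    have a1 := (tendsto_succ_pow_mul_pow 8 hv.pos hv.lt_one).const_mul (3 / 2 * D)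
    have a2 := (tendsto_inv_atTop_nhds_zero_nat (𝕜 := ℝ)).const_mul
      (1 / 2 * C + 1 / 4 * (2304 * C ^ 2 + 1))
    have a3 := (tendsto_succ_pow_mul_pow 24 (r := 1 / 2) (by norm_num) (by norm_num)).const_mul
      (96 * C ^ 2)
    have := ((a1.add a2).add a3).const_mul |t|
    simpa only [mul_zero, add_zero] using this
  have lim2 : Tendsto E2 atTop (𝓝 0) := by
    have a2 := (tendsto_inv_atTop_nhds_zero_nat (𝕜 := ℝ)).const_mul (640 * t ^ 2 * C ^ 3)
    have a3 := (tendsto_succ_pow_mul_pow 9 (r := 1 / 2) (by norm_num) (by norm_num)).const_mul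
      (2 * C * (24 + 144 * |t| * C))
    have := (a2.add a3).const_mul |t|
    simpa only [mul_zero, add_zero] using this
  have limE : Tendsto (fun N => E1 (truncLevel (N + 1)) +
      E2 (truncLevel (N + 1)) * Real.exp (|lv N| * t ^ 2)) atTop (𝓝 0) := by
    have h3 : Tendsto (fun N => Real.exp (|lv N| * t ^ 2)) atTop
        (𝓝 (Real.exp (|asympVar v ν| * t ^ 2))) :=
      (Real.continuous_exp.tendsto _).comp (hlim.abs.mul_const _)
    have := (lim1.comp hK).add ((lim2.comp hK).mul h3)
    simpa only [zero_mul, add_zero, Function.comp_apply] using this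
  have limG : Tendsto (fun N => Complex.exp ((-(lv N * t ^ 2 / 2) : ℝ) : ℂ)) atTop
      (𝓝 (Complex.exp ((-(asympVar v ν * t ^ 2 / 2) : ℝ) : ℂ))) :=
    ((Complex.continuous_exp.comp Complex.continuous_ofReal).tendsto _).comp
      (((hlim.mul_const _).div_const 2).neg)
  refine limG.congr_dist (squeeze_zero' (Eventually.of_forall fun _ => dist_nonneg) ?_ limE)
  filter_upwards [hK.eventually_ge_atTop 2] with N hN
  set n := N + 1 with hn
  set K := truncLevel n with hKn
  have hn16 : 16 * K ≤ n := truncLevel_mul_le hN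
  have hK1 : 1 ≤ K := by omega
  have hKr : (1 : ℝ) ≤ K := by exact_mod_cast hK1
  have hn2 : 2 ≤ n := by omega
  set s : ℝ := √n with hs
  have hs0 : 0 < s := Real.sqrt_pos.2 (by exact_mod_cast (by omega : 0 < n))
  have hs2 : (n : ℝ) = s ^ 2 := (Real.sq_sqrt (Nat.cast_nonneg n)).symm
  have h1 : (K : ℝ) ^ 8 ≤ s := truncLevel_pow_le_sqrt n
  have h2 : s ≤ ((K : ℝ) + 1) ^ 8 := sqrt_le_truncLevel_pow n
  rw [rpow_three_halves, ← hs, dist_comm, dist_eq_norm]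
  have step1 : ‖(cycMean d fun w : ZMod n → A => Complex.exp (Complex.I *
      ((t * ((kernelCount v w - (n : ℝ) ^ 2 * κ) / s ^ 3) : ℝ) : ℂ))) -
      cycChar n d (linPart v ν K) (t / s)‖ ≤ E1 K := by
    rw [cycChar, ← cycMean_sub]
    refine (norm_cycMean_le hd _).trans ((cycMean_mono hd
      (G := fun w => |t| / s ^ 3 * |kernelCount v w - (n : ℝ) ^ 2 * κ -
        n * cycSum (linPart v ν K) w|) fun w => ?_).trans ?_)
    · refine (norm_cexp_I_sub_le _ _).trans (le_of_eq ?_)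
      rw [← abs_of_pos (pow_pos hs0 3), ← abs_div, ← abs_mul, abs_of_pos (pow_pos hs0 3), hs2]
      congr 1
      field_simp
    · rw [cycMean_const_mul]
      have b := hv.cycMean_abs_kernelCount_sub_le hd hν hK1 hn16 hκ
      rw [div_mul_eq_mul_div, mul_div_assoc]
      refine mul_le_mul_of_nonneg_left ?_ (abs_nonneg t)
      refine (div_le_div_of_nonneg_right b (by positivity)).trans ?_
      have := linearization_error_le hs0 hKr hC hD0 (pow_pos hv.pos K).le
        (by positivity : (0 : ℝ) ≤ (1 / 2) ^ K) h1 h2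
      rw [hs2, show C * β ^ K / (1 - β) = D * β ^ K by rw [hD]; ring]
      exact this
  have step2 : ‖cycChar n d (linPart v ν K) (t / s) -
      Complex.exp ((-(lv N * t ^ 2 / 2) : ℝ) : ℂ)‖ ≤ E2 K * Real.exp (|lv N| * t ^ 2) := by
    have b := norm_cycChar_sub_le (n := n) hd hν (hv.dependsOn_linPart K) hK1
      (hv.abs_linPart_le K) (hv.integral_linPart K) hn16 (t / s)
    have e1 : (n : ℝ) * localVar n d K (linPart v ν K) * (t / s) ^ 2 / 2 = lv N * t ^ 2 / 2 := by
      rw [show lv N = localVar n d K (linPart v ν K) from rfl, hs2]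
      field_simp
    have e2 : (n : ℝ) * |localVar n d K (linPart v ν K)| * (t / s) ^ 2 = |lv N| * t ^ 2 := by
      rw [show lv N = localVar n d K (linPart v ν K) from rfl, hs2]
      field_simp
    rw [e1, e2] at b
    refine b.trans (mul_le_mul_of_nonneg_right ?_ (Real.exp_pos _).le)
    rw [hs2]
    exact clt_error_le hs0 hKr hC (by positivity) h1 h2
  exact (norm_sub_le_norm_sub_add_norm_sub _ (cycChar n d (linPart v ν K) (t / s)) _).trans
    (add_le_add step1 step2)

end IsKernelSeq

end Convergence

/-! ### Letters and the chain of reduced sequences -/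

theorem integral_uniformOn_finset {Ω V : Type*} [MeasurableSpace Ω] [DiscreteMeasurableSpace Ω]
    [Finite Ω] [NormedAddCommGroup V] [NormedSpace ℝ V] [CompleteSpace V] (s : Finset Ω)
    (f : Ω → V) :
    ∫ x, f x ∂(uniformOn (s : Set Ω)) = (s.card : ℝ)⁻¹ • ∑ x ∈ s, f x := by
  have hi : IntegrableOn f s Measure.count := IntegrableOn.finset
  rw [uniformOn, ProbabilityTheory.cond, integral_smul_measure, setIntegral_finset s hi,
    Measure.count_apply_finset, ENNReal.toReal_inv]
  simp [Measure.real]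

theorem integral_uniformOn_univ {Ω V : Type*} [MeasurableSpace Ω] [DiscreteMeasurableSpace Ω]
    [NormedAddCommGroup V] [NormedSpace ℝ V] [CompleteSpace V] [Fintype Ω] (f : Ω → V) :
    ∫ x, f x ∂(uniformOn (Set.univ : Set Ω)) = avg f := by
  rw [← Finset.coe_univ, integral_uniformOn_finset, avg, Finset.card_univ]

namespace Letter

variable {ι : Type*}

theorem bar_bar (a : Letter ι) : a.bar.bar = a := Prod.ext rfl (Bool.not_not _)

theorem eq_bar_iff {a b : Letter ι} : b = a.bar ↔ a = b.bar :=
  ⟨fun h => by rw [h, bar_bar], fun h => by rw [h, bar_bar]⟩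

/-- The letters as a finite type. -/
noncomputable local instance fintype [Finite ι] : Fintype (Letter ι) := Fintype.ofFinite _

theorem four_le_card [Finite ι] [Nontrivial ι] : 4 ≤ Fintype.card (Letter ι) := by
  rw [Fintype.card_eq_nat_card]
  have h : Nat.card (Letter ι) = Nat.card ι * 2 := by
    rw [show Letter ι = (ι × Bool) from rfl, Nat.card_prod]
    simp
  have := Finite.one_lt_card (α := ι)
  omega

open Classical in
/-- The transition density of the reduced chain, relative to the uniform distribution and minus
`1`: it is `g / (g - 1) - 1` at allowed transitions and `-1` at forbidden ones. -/
noncomputable def density [Finite ι] (a b : Letter ι) : ℝ :=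
  if b = a.bar then -1 else ((Fintype.card (Letter ι) : ℝ) - 1)⁻¹

variable [Finite ι] [Nontrivial ι]

theorem three_le_card_sub : (3 : ℝ) ≤ (Fintype.card (Letter ι) : ℝ) - 1 := by
  have : (4 : ℝ) ≤ Fintype.card (Letter ι) := by exact_mod_cast four_le_card
  linarith

theorem sum_ite_bar (a : Letter ι) (x y : ℝ) [DecidableEq (Letter ι)] :
    ∑ b, (if b = a.bar then x else y) = x + ((Fintype.card (Letter ι) : ℝ) - 1) * y := by
  rw [Finset.sum_ite, Finset.sum_const, Finset.sum_const, Finset.filter_eq',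
    if_pos (Finset.mem_univ _), Finset.filter_ne', Finset.card_erase_of_mem (Finset.mem_univ _),
    Finset.card_univ]
  have := four_le_card (ι := ι)
  simp only [Finset.card_singleton, one_smul, nsmul_eq_mul]
  rw [Nat.cast_sub (by omega), Nat.cast_one]

theorem isChainDensity_density : IsChainDensity (density (ι := ι)) where
  abs_le a b := by
    have h := three_le_card_sub (ι := ι)
    rw [density]
    split_ifs
    · simp
    · rw [abs_inv, abs_of_nonneg (by linarith)]
      exact inv_le_one_of_one_le₀ (by linarith)
  avg_right a := by
    classical
    have h := three_le_card_sub (ι := ι)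
    have e : ∀ b, density a b = if b = a.bar then -1 else
      ((Fintype.card (Letter ι) : ℝ) - 1)⁻¹ := fun b => by rw [density]
    rw [avg, Finset.sum_congr rfl fun b _ => e b, sum_ite_bar, mul_inv_cancel₀ (by linarith)]
    simp
  avg_left b := by
    classical
    have h := three_le_card_sub (ι := ι)
    have e : ∀ a, density a b = if a = b.bar then -1 else
      ((Fintype.card (Letter ι) : ℝ) - 1)⁻¹ := fun a => by
        rw [density]; simp only [eq_bar_iff (a := a)]
    rw [avg, Finset.sum_congr rfl fun a _ => e a, sum_ite_bar, mul_inv_cancel₀ (by linarith)]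
    simp
  avg_abs a := by
    classical
    have h := three_le_card_sub (ι := ι)
    have e : ∀ b, |density a b| = if b = a.bar then 1 else
      ((Fintype.card (Letter ι) : ℝ) - 1)⁻¹ := fun b => by
        rw [density]
        split_ifs
        · simp
        · rw [abs_inv, abs_of_nonneg (by linarith)]
    rw [avg, Finset.sum_congr rfl fun b _ => e b, sum_ite_bar, mul_inv_cancel₀ (by linarith),
      smul_eq_mul, inv_mul_le_iff₀ (by linarith)]
    linarith

/-- One step of the chain, in terms of the transition density. -/
theorem integral_stepMeasure (a : Letter ι) (f : Letter ι → ℝ) :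
    ∫ b, f b ∂(stepMeasure a) = avg fun b => (1 + density a b) * f b := by
  classical
  have h := three_le_card_sub (ι := ι)
  have hs : {b | b ≠ a.bar} = ((Finset.univ.erase a.bar : Finset (Letter ι)) : Set (Letter ι)) := by
    ext; simp
  have e : ∀ b ∈ Finset.univ.erase a.bar, (1 + density a b) * f b =
      (1 + ((Fintype.card (Letter ι) : ℝ) - 1)⁻¹) * f b := fun b hb => by
    rw [density, if_neg (Finset.ne_of_mem_erase hb)]
  have e0 : (1 + density a a.bar) * f a.bar = 0 := by rw [density, if_pos rfl]; ring
  have hg := four_le_card (ι := ι)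
  rw [stepMeasure, hs, integral_uniformOn_finset, avg,
    ← Finset.add_sum_erase _ _ (Finset.mem_univ a.bar), e0, zero_add, Finset.sum_congr rfl e,
    ← Finset.mul_sum, Finset.card_erase_of_mem (Finset.mem_univ _), Finset.card_univ,
    Nat.cast_sub (by omega), Nat.cast_one, smul_eq_mul, smul_eq_mul, ← mul_assoc]
  congr 1
  have h1 : (Fintype.card (Letter ι) : ℝ) ≠ 0 := by linarith
  have h2 : (Fintype.card (Letter ι) : ℝ) - 1 ≠ 0 := by linarith
  field_simp
  ring

end Letter

section Chain

attribute [local instance] Letter.fintype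

variable {ι : Type*} [Finite ι] [Nonempty ι]

instance : IsProbabilityMeasure (uniformOn (Set.univ : Set (Letter ι))) :=
  isProbabilityMeasure_uniformOn Set.finite_univ Set.univ_nonempty

instance : IsProbabilityMeasure (chainMeasure ι) := by
  rw [chainMeasure]; infer_instance

/-- The Markov property. -/
theorem integral_chainMeasure_succ (p : ℕ)
    (G : ((_i : Finset.Iic p) → Letter ι) × Letter ι → ℝ) :
    ∫ x, G (Preorder.frestrictLe p x, x (p + 1)) ∂(chainMeasure ι) =
      ∫ x, ∫ b, G (Preorder.frestrictLe p x, b) ∂(stepMeasure (x p)) ∂(chainMeasure ι) := by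
  have h := Kernel.map_frestrictLe_trajMeasure_compProd_eq_map_trajMeasure
    (X := fun _ => Letter ι) (μ₀ := uniformOn Set.univ) (κ := stepKernel ι) (a := p)
  have hG : StronglyMeasurable G := (measurable_of_countable G).stronglyMeasurable
  have hm : Measurable fun x : ℕ → Letter ι =>
      (Preorder.frestrictLe (π := fun _ => Letter ι) p x, x (p + 1)) := by
    fun_prop
  have hm' : Measurable (Preorder.frestrictLe (π := fun _ => Letter ι) p) := by fun_prop
  have e1 := integral_map (μ := chainMeasure ι) hm.aemeasurable (f := G) hG.aestronglyMeasurable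
  rw [← e1, chainMeasure, ← h, Measure.integral_compProd, integral_map hm'.aemeasurable]
  · rfl
  · exact (measurable_of_countable _).aestronglyMeasurable
  · obtain ⟨M, hM⟩ := (Set.finite_range fun q => |G q|).bddAbove
    have : IsProbabilityMeasure (Measure.map (Preorder.frestrictLe p)
      (Kernel.trajMeasure (X := fun _ => Letter ι) (uniformOn Set.univ) (stepKernel ι))) :=
      Measure.isProbabilityMeasure_map hm'.aemeasurable
    exact Integrable.of_bound hG.aestronglyMeasurable M
      (ae_of_all _ fun q => hM (Set.mem_range_self q))

theorem integral_chainMeasure_zero (f : Letter ι → ℝ) :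
    ∫ x, f (x 0) ∂(chainMeasure ι) = avg f := by
  have hm : Measurable (Preorder.frestrictLe (π := fun _ => Letter ι) 0) := by fun_prop
  have h : (chainMeasure ι).map (Preorder.frestrictLe (π := fun _ => Letter ι) 0) =
      (uniformOn Set.univ).map (MeasurableEquiv.piUnique
        (fun _ : Finset.Iic 0 => Letter ι)).symm := by
    rw [chainMeasure, Kernel.trajMeasure, Measure.map_comp _ _ hm, Kernel.traj_map_frestrictLe,
      Kernel.partialTraj_self, Measure.id_comp]
  have e1 := integral_map (μ := chainMeasure ι) hm.aemeasurable
    (f := fun u : (_ : Finset.Iic 0) → Letter ι => f (u ⟨0, by simp⟩))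
    (measurable_of_countable _).aestronglyMeasurable
  have e2 := integral_map (μ := uniformOn (Set.univ : Set (Letter ι))) (MeasurableEquiv.piUnique
        (fun _ : Finset.Iic 0 => Letter ι)).symm.measurable.aemeasurable
    (f := fun u : (_ : Finset.Iic 0) → Letter ι => f (u ⟨0, by simp⟩))
    (measurable_of_countable _).aestronglyMeasurable
  rw [h, e2] at e1
  rw [← integral_uniformOn_univ]
  exact e1.symm

end Chain

section ChainLaw

attribute [local instance] Letter.fintype

variable {ι : Type*} [Finite ι] [Nontrivial ι]

/-- The chain of reduced sequences has density `∏ (1 + d)` relative to uniform letters. -/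
theorem isChainLaw_chainMeasure : IsChainLaw Letter.density (chainMeasure ι) := by
  intro p
  induction p with
  | zero =>
    intro F hF n _ hn
    have e : F = fun x => F fun _ => x 0 := by
      funext x
      refine hF fun i hi => ?_
      have : i < 0 + 1 := hi
      rw [show i = 0 by omega]
    rw [e, integral_chainMeasure_zero fun a => F fun _ => a]
    rw [← avg_update (0 : ZMod n)]
    simp [pathWeight, win, avg_const]
  | succ p ih =>
    intro F hF n _ hn
    -- `F` as a function of the first `p + 1` letters and the next one
    let G : ((_i : Finset.Iic p) → Letter ι) × Letter ι → ℝ := fun q =>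
      F fun j => if h : j ≤ p then q.1 ⟨j, Finset.mem_Iic.2 h⟩ else q.2
    have e : ∀ x, F x = G (Preorder.frestrictLe p x, x (p + 1)) := by
      intro x
      refine hF fun i hi => ?_
      have hi' : i < p + 1 + 1 := hi
      by_cases h : i ≤ p
      · simp [h, Preorder.frestrictLe]
      · simp [show i = p + 1 by omega]
    have hG : ∀ x y : ℕ → Letter ι, (∀ i ∈ Set.Iio (p + 1), x i = y i) → ∀ b,
        G (Preorder.frestrictLe p x, b) = G (Preorder.frestrictLe p y, b) := by
      intro x y h b
      have : Preorder.frestrictLe (π := fun _ => Letter ι) p x = Preorder.frestrictLe p y :=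
        funext fun i => h i (Nat.lt_succ_of_le (Finset.mem_Iic.1 i.2))
      rw [this]
    simp only [e]
    rw [integral_chainMeasure_succ]
    simp only [Letter.integral_stepMeasure]
    rw [ih _ (fun x y h => ?_) n (by omega)]
    · rw [← avg_update ((p + 1 : ℕ) : ZMod n) fun w : ZMod n → Letter ι =>
        pathWeight Letter.density (cycPath n 0) (p + 1) w *
          G (Preorder.frestrictLe p (win w 0), win w 0 (p + 1))]
      refine congrArg avg (funext fun w => ?_)
      rw [← smul_eq_mul, ← avg_smul]
      refine congrArg avg (funext fun b => ?_)
      have hne : ∀ i ≤ p, (i : ZMod n) ≠ ((p + 1 : ℕ) : ZMod n) := fun i hi h => by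
        have := zmod_natCast_inj (by omega) (by omega) h
        omega
      have hw : ∀ i ≤ p, Function.update w ((p + 1 : ℕ) : ZMod n) b (i : ZMod n) = w i :=
        fun i hi => Function.update_of_ne (hne i hi) _ _
      have hfw : Preorder.frestrictLe (π := fun _ => Letter ι) p
          (win (Function.update w ((p + 1 : ℕ) : ZMod n) b) 0) =
          Preorder.frestrictLe p (win w 0) := by
        funext i
        have := hw i (Finset.mem_Iic.1 i.2)
        simpa [win, Preorder.frestrictLe] using this
      have hpw : pathWeight Letter.density (cycPath n 0) p
          (Function.update w ((p + 1 : ℕ) : ZMod n) b) =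
          pathWeight Letter.density (cycPath n 0) p w := by
        refine Finset.prod_congr rfl fun j hj => ?_
        have := Finset.mem_range.1 hj
        simp only [cycPath, zero_add]
        rw [hw j (by omega), hw (j + 1) (by omega)]
      have hps : ∀ w' : ZMod n → Letter ι, pathWeight Letter.density (cycPath n 0) (p + 1) w' =
          pathWeight Letter.density (cycPath n 0) p w' *
            (1 + Letter.density (w' (cycPath n 0 p)) (w' (cycPath n 0 (p + 1)))) :=
        fun w' => Finset.prod_range_succ _ _
      rw [hps, hpw, hfw]
      have h1 : win (Function.update w ((p + 1 : ℕ) : ZMod n) b) 0 (p + 1) = b := by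
        simp [win]
      have h2 : Function.update w ((p + 1 : ℕ) : ZMod n) b (cycPath n 0 p) = win w 0 p := by
        simp only [cycPath, zero_add, win]
        exact hw p le_rfl
      have h3 : Function.update w ((p + 1 : ℕ) : ZMod n) b (cycPath n 0 (p + 1)) = b := by
        simp [cycPath]
      rw [h1, h2, h3, smul_eq_mul]
      ring
    · simp only [h p (Nat.lt_succ_self p), hG x y h]

theorem ae_reduced_chainMeasure :
    ∀ᵐ x ∂(chainMeasure ι), ∀ i, x (i + 1) ≠ (x i).bar := by
  classical
  rw [ae_all_iff]
  intro i
  have hS : MeasurableSet {x : ℕ → Letter ι | x (i + 1) = (x i).bar} :=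
    measurableSet_eq_fun (measurable_pi_apply _)
      ((measurable_of_countable Letter.bar).comp (measurable_pi_apply i))
  have h := integral_chainMeasure_succ (ι := ι) i fun q =>
    if q.2 = (q.1 ⟨i, Finset.mem_Iic.2 le_rfl⟩).bar then 1 else 0
  have hz : ∀ x : ℕ → Letter ι, ∫ b, (if b = (x i).bar then (1 : ℝ) else 0) ∂(stepMeasure (x i))
      = 0 := by
    intro x
    rw [Letter.integral_stepMeasure, avg, Finset.sum_eq_zero, smul_zero]
    intro b _
    by_cases hb : b = (x i).bar
    · rw [Letter.density, if_pos hb]; ring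
    · rw [if_neg hb, mul_zero]
  have e : (fun x : ℕ → Letter ι => if x (i + 1) = (x i).bar then (1 : ℝ) else 0) =
      Set.indicator {x : ℕ → Letter ι | x (i + 1) = (x i).bar} fun _ => 1 := by
    funext x
    simp [Set.indicator]
  have h' : ∫ x : ℕ → Letter ι, (if x (i + 1) = (x i).bar then (1 : ℝ) else 0) ∂(chainMeasure ι)
      = 0 := by
    refine Eq.trans h ?_
    exact (integral_congr_ae (ae_of_all _ fun x => hz x)).trans (by simp)
  rw [e, integral_indicator_const _ hS, smul_eq_mul, mul_one] at h'
  rw [ae_iff]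
  simpa [measureReal_eq_zero_iff] using h'

omit [Nontrivial ι] in
theorem measurableSet_reduced : MeasurableSet {x : ℕ → Letter ι | ∀ i, x (i + 1) ≠ (x i).bar} := by
  simp only [Set.ofPred_forall]
  exact MeasurableSet.iInter fun i => (measurableSet_eq_fun
    (f := fun x : ℕ → Letter ι => x (i + 1)) (g := fun x => (x i).bar) (measurable_pi_apply _)
    ((measurable_of_countable Letter.bar).comp (measurable_pi_apply i))).compl

omit [Nontrivial ι] in
theorem measurableEmbedding_val :
    MeasurableEmbedding (Subtype.val : InfString ι → ℕ → Letter ι) :=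
  MeasurableEmbedding.subtype_coe measurableSet_reduced

/-- The Markov measure on reduced sequences is the law of the chain. -/
theorem measurePreserving_val :
    MeasurePreserving (Subtype.val : InfString ι → ℕ → Letter ι) (markovMeasure ι)
      (chainMeasure ι) := by
  refine ⟨measurable_subtype_coe, ?_⟩
  rw [markovMeasure, measurableEmbedding_val.map_comap, Subtype.range_coe_subtype]
  exact Measure.restrict_eq_self_of_ae_mem ae_reduced_chainMeasure

instance : IsProbabilityMeasure (markovMeasure ι) := by
  refine ⟨?_⟩
  rw [← Set.preimage_univ (f := (Subtype.val : InfString ι → ℕ → Letter ι)),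
    measurePreserving_val.measure_preimage MeasurableSet.univ.nullMeasurableSet, measure_univ]

end ChainLaw

/-! ### Joinable strings as cyclic words -/

section Joinable

attribute [local instance] Letter.fintype

variable {ι : Type*}

/-- Joinable strings as a finite type. -/
noncomputable local instance JoinableString.fintype [Finite ι] (n : ℕ) :
    Fintype (JoinableString ι n) := Fintype.ofFinite _

theorem cyclicShift_iterate_apply {N : ℕ} (w : ZMod (N + 1) → Letter ι) (i : ℕ)
    (z : ZMod (N + 1)) : ((cyclicShift (n := N + 1))^[i] w) z = w (z + i) := by
  induction i generalizing w with
  | zero => rw [Nat.cast_zero, add_zero]; rfl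
  | succ i ih =>
    have step : ∀ z : ZMod (N + 1), cyclicShift (n := N + 1) w z = w (z + 1) := fun z =>
      congrArg w (finRotate_apply (n := N + 1) z)
    refine (ih (cyclicShift (n := N + 1) w)).trans ((step _).trans ?_)
    rw [Nat.cast_succ, add_assoc]

/-- A joinable string as a cyclic word; `ZMod (N + 1)` and `Fin (N + 1)` are the same type. -/
def JoinableString.word {N : ℕ} (α : JoinableString ι (N + 1)) : ZMod (N + 1) → Letter ι := α.1

theorem JoinableString.word_shift_iterate {N : ℕ} (α : JoinableString ι (N + 1)) (i : ℕ)
    (z : ZMod (N + 1)) : (JoinableString.shift^[i] α).word z = α.word (z + i) := by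
  rw [JoinableString.word, JoinableString.shift_val_iterate]
  exact cyclicShift_iterate_apply α.1 i z

theorem fin_mk_eq_natCast {N i : ℕ} (hi : i < N + 1) :
    ((⟨i, hi⟩ : Fin (N + 1)) : ZMod (N + 1)) = (i : ZMod (N + 1)) := by
  refine Fin.ext ?_
  exact (ZMod.val_cast_of_lt hi).symm

/-- A cyclic word is joinable if and only if all its cyclic transitions are allowed. -/
theorem isJoinable_iff {N : ℕ} (w : ZMod (N + 1) → Letter ι) :
    (∀ i : ℕ, IsReducedWord (n := N + 1) ((cyclicShift (n := N + 1))^[i] w)) ↔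
      ∀ z, w (z + 1) ≠ (w z).bar := by
  constructor
  · intro h z
    rcases Nat.eq_zero_or_pos N with rfl | hN
    · have : z + 1 = z := Subsingleton.elim (α := Fin 1) _ _
      rw [this]
      exact (w z).ne_bar
    · have := h z.val 0 (by omega)
      rw [fin_mk_eq_natCast, fin_mk_eq_natCast] at this
      rw [cyclicShift_iterate_apply, cyclicShift_iterate_apply] at this
      simpa [add_comm] using this
  · intro h i j hj
    rw [fin_mk_eq_natCast, fin_mk_eq_natCast, cyclicShift_iterate_apply,
      cyclicShift_iterate_apply]
    have := h (j + i)
    rwa [show (j + i + 1 : ZMod (N + 1)) = ((j + 1 : ℕ) : ZMod (N + 1)) + i by push_cast; ring]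
      at this

section Uniform

variable [Finite ι] [Nontrivial ι]

omit [Nontrivial ι] in
/-- The cyclic Markov weight is constant on joinable strings and vanishes elsewhere. -/
theorem cycWeight_density {N : ℕ} (w : ZMod (N + 1) → Letter ι)
    [Decidable (∀ z, w (z + 1) ≠ (w z).bar)] :
    cycWeight Letter.density w = if ∀ z, w (z + 1) ≠ (w z).bar then
      (1 + ((Fintype.card (Letter ι) : ℝ) - 1)⁻¹) ^ (N + 1) else 0 := by
  split_ifs with h
  · rw [cycWeight, Finset.prod_congr rfl fun z _ => by rw [Letter.density, if_neg (h z)],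
      Finset.prod_const, Finset.card_univ, ZMod.card]
  · push Not at h
    obtain ⟨z, hz⟩ := h
    refine Finset.prod_eq_zero (Finset.mem_univ z) ?_
    rw [Letter.density, if_pos hz]
    ring

omit [Nontrivial ι] in
theorem sum_cycWeight_smul {V : Type*} [NormedAddCommGroup V] [NormedSpace ℝ V] {N : ℕ}
    (F : (ZMod (N + 1) → Letter ι) → V) :
    ∑ w, cycWeight Letter.density w • F w =
      (1 + ((Fintype.card (Letter ι) : ℝ) - 1)⁻¹) ^ (N + 1) •
        ∑ α : JoinableString ι (N + 1), F α.word := by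
  classical
  simp only [cycWeight_density, ite_smul, zero_smul]
  rw [← Finset.sum_filter, Finset.smul_sum]
  exact Finset.sum_subtype (p := fun w : Fin (N + 1) → Letter ι =>
      ∀ i : ℕ, IsReducedWord (cyclicShift^[i] w)) _
    (fun w => by
      refine Iff.trans ?_ (isJoinable_iff w).symm
      exact Finset.mem_filter_univ (α := ZMod (N + 1) → Letter ι) w)
    fun w => (1 + ((Fintype.card (Letter ι) : ℝ) - 1)⁻¹) ^ (N + 1) • F w

theorem avg_cycWeight_density (N : ℕ) :
    avg (cycWeight (n := N + 1) (Letter.density (ι := ι))) =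
      ((Fintype.card (Letter ι) : ℝ) - 1)⁻¹ ^ (N + 1) *
        Fintype.card (JoinableString ι (N + 1)) := by
  have h := sum_cycWeight_smul (ι := ι) (N := N) fun _ => (1 : ℝ)
  have hg := Letter.three_le_card_sub (ι := ι)
  simp only [smul_eq_mul, mul_one, Finset.sum_const, Finset.card_univ, nsmul_eq_mul] at h
  rw [avg, h, Fintype.card_fun, ZMod.card, smul_eq_mul, ← mul_assoc]
  congr 1
  push_cast
  rw [← inv_pow, ← mul_pow]
  congr 1
  have h1 : (Fintype.card (Letter ι) : ℝ) ≠ 0 := by linarith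
  have h2 : (Fintype.card (Letter ι) : ℝ) - 1 ≠ 0 := by linarith
  field_simp
  ring

/-- Uniformly random joinable strings are random cyclic words. -/
theorem integral_joinableUniform {V : Type*} [NormedAddCommGroup V] [NormedSpace ℝ V]
    [CompleteSpace V] {N : ℕ} (F : (ZMod (N + 1) → Letter ι) → V) :
    ∫ α, F α.word ∂(joinableUniform ι (N + 1)) = cycMean Letter.density F := by
  have hg := Letter.three_le_card_sub (ι := ι)
  have h := sum_cycWeight_smul (ι := ι) (N := N) fun _ => (1 : ℝ)
  simp only [smul_eq_mul, mul_one, Finset.sum_const, Finset.card_univ, nsmul_eq_mul] at h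
  have hc : (0 : ℝ) < (1 + ((Fintype.card (Letter ι) : ℝ) - 1)⁻¹) ^ (N + 1) := by
    have : (0 : ℝ) < ((Fintype.card (Letter ι) : ℝ) - 1)⁻¹ := inv_pos.2 (by linarith)
    positivity
  have hp : (0 : ℝ) < (Fintype.card (ZMod (N + 1) → Letter ι) : ℝ) := by
    exact_mod_cast Fintype.card_pos
  rw [joinableUniform, integral_uniformOn_univ, cycMean, avg, avg, avg, h, sum_cycWeight_smul,
    smul_smul, smul_smul, smul_eq_mul]
  congr 1
  field_simp

/-- There are about `(g - 1) ^ n` joinable strings of length `n`. -/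
theorem half_mul_pow_le_card_joinableString {N : ℕ} (hN : 1 ≤ N) :
    1 / 2 * ((Fintype.card (Letter ι) : ℝ) - 1) ^ (N + 1) ≤
      Fintype.card (JoinableString ι (N + 1)) := by
  have hg := Letter.three_le_card_sub (ι := ι)
  have h := half_le_avg_cycWeight (n := N + 1) (Letter.isChainDensity_density (ι := ι)) (by omega)
  have hp : (0 : ℝ) < ((Fintype.card (Letter ι) : ℝ) - 1) ^ (N + 1) := pow_pos (by linarith) _
  rw [avg_cycWeight_density, inv_pow, inv_mul_eq_div, le_div_iff₀ hp] at h
  exact h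

end Uniform

end Joinable

/-! ### Kernels on sequences of letters -/

section LetterKernel

attribute [local instance] Letter.fintype

variable {ι : Type*}

/-- The word of the first `k` letters. -/
def wordPrefix (k : ℕ) (x : ℕ → Letter ι) : Fin k → Letter ι := fun i => x i

open Classical in
/-- The kernel `h k` on words of length `k`, extended by `0` to words that are not reduced. -/
noncomputable def wordKernel (h : KernelFamily ι) (k : ℕ) (u u' : Fin k → Letter ι) : ℝ :=
  if H : IsReducedWord u ∧ IsReducedWord u' then h k (.finite u H.1) (.finite u' H.2) else 0

/-- The kernel `h (k + 1)` evaluated at the words of the first `k + 1` letters. -/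
noncomputable def letterKernel (h : KernelFamily ι) (k : ℕ) (x y : ℕ → Letter ι) : ℝ :=
  wordKernel h (k + 1) (wordPrefix (k + 1) x) (wordPrefix (k + 1) y)

theorem ReducedSeq.isReducedWord_wordPrefix {ω : ReducedSeq ι} {k : ℕ} {x : ℕ → Letter ι}
    (hx : ∀ j < k, ω.entry j = some (x j)) : IsReducedWord (wordPrefix k x) := by
  intro i hi
  have h1 := hx (i + 1) hi
  have h0 := hx i (Nat.lt_of_succ_lt hi)
  cases ω with
  | finite w hw =>
    simp only [ReducedSeq.entry] at h0 h1
    split_ifs at h0 h1 with h0' h1'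
    have := hw i h1'
    rw [Option.some.inj h0, Option.some.inj h1] at this
    exact this
  | infinite z =>
    have := z.2 i
    rw [Option.some.inj h0, Option.some.inj h1] at this
    exact this

theorem ReducedSeq.le_length {ω : ReducedSeq ι} {k : ℕ} {x : ℕ → Letter ι}
    (hx : ∀ j < k, ω.entry j = some (x j)) : (k : ℕ∞) ≤ ω.length := by
  cases ω with
  | @finite n w hw =>
    simp only [ReducedSeq.length, Nat.cast_le]
    by_contra hn
    have := hx n (not_le.1 hn)
    simp [ReducedSeq.entry] at this
  | infinite z => exact le_top

theorem ReducedSeq.entry_wordPrefix {k : ℕ} {x : ℕ → Letter ι}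
    (hx : IsReducedWord (wordPrefix k x)) :
    ∀ j < k, (ReducedSeq.finite _ hx).entry j = some (x j) := by
  intro j hj
  simp [ReducedSeq.entry, hj, wordPrefix]

/-- By locality, the kernels see only the letters. -/
theorem KernelFamily.IsLocal.eq_letterKernel {h : KernelFamily ι} (H2 : h.IsLocal) {k : ℕ}
    {ω ω' : ReducedSeq ι} {x y : ℕ → Letter ι} (hx : ∀ j < k + 1, ω.entry j = some (x j))
    (hy : ∀ j < k + 1, ω'.entry j = some (y j)) : h (k + 1) ω ω' = letterKernel h k x y := by
  have hx' := ReducedSeq.isReducedWord_wordPrefix hx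
  have hy' := ReducedSeq.isReducedWord_wordPrefix hy
  rw [letterKernel, wordKernel, dif_pos ⟨hx', hy'⟩]
  have ex := ReducedSeq.entry_wordPrefix hx'
  have ey := ReducedSeq.entry_wordPrefix hy'
  refine H2 (k + 1) (by omega) _ _ _ _ (ReducedSeq.le_length hx) (ReducedSeq.le_length hy)
    (ReducedSeq.le_length ex) (ReducedSeq.le_length ey) ?_ ?_
  · exact fun j hj => (hx j hj).trans (ex j hj).symm
  · exact fun j hj => (hy j hj).trans (ey j hj).symm

theorem KernelFamily.IsLocal.infinite_eq {h : KernelFamily ι} (H2 : h.IsLocal) (k : ℕ)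
    (x y : InfString ι) : h (k + 1) (.infinite x) (.infinite y) = letterKernel h k x.1 y.1 :=
  H2.eq_letterKernel (fun _ _ => rfl) fun _ _ => rfl

theorem entry_shift_iterate {N : ℕ} (α : JoinableString ι (N + 1)) (i : ℕ) {j : ℕ}
    (hj : j < N + 1) : (JoinableString.shift^[i] α).toSeq.entry j =
      some (win α.word (i : ZMod (N + 1)) j) := by
  have e : (JoinableString.shift^[i] α).word (j : ZMod (N + 1)) = win α.word i j := by
    rw [JoinableString.word_shift_iterate, win, add_comm]
  rw [← e]
  refine (dif_pos hj).trans ?_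
  exact congrArg (fun z => some ((JoinableString.shift^[i] α).word z)) (fin_mk_eq_natCast hj)

theorem KernelFamily.IsLocal.shift_eq {h : KernelFamily ι} (H2 : h.IsLocal) {N k : ℕ}
    (hk : k < N + 1) (α : JoinableString ι (N + 1)) (i j : ℕ) :
    h (k + 1) (JoinableString.shift^[i] α).toSeq (JoinableString.shift^[j] α).toSeq =
      letterKernel h k (win α.word (i : ZMod (N + 1)))
        (win α.word (j : ZMod (N + 1))) :=
  H2.eq_letterKernel (fun _ hl => entry_shift_iterate α i (by omega))
    fun _ hl => entry_shift_iterate α j (by omega)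

theorem KernelFamily.IsLocal.joinableCount_eq {h : KernelFamily ι} (H2 : h.IsLocal) {N : ℕ}
    (α : JoinableString ι (N + 1)) :
    h.joinableCount α = kernelCount (letterKernel h) α.word := by
  refine Finset.sum_congr rfl fun i _ => Finset.sum_congr rfl fun j _ => ?_
  rw [Finset.sum_congr rfl fun k hk => (H2.shift_eq (Finset.mem_range.1 hk) α i j).symm]
  rw [Finset.range_eq_Ico, Finset.sum_Ico_add' (fun k => h k (JoinableString.shift^[i] α).toSeq
    (JoinableString.shift^[j] α).toSeq) 0 (N + 1) 1]
  rfl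

theorem dependsOn_letterKernel (h : KernelFamily ι) (k : ℕ) (y : ℕ → Letter ι) :
    DependsOn (fun x => letterKernel h k x y) (Set.Iio (k + 1)) := by
  intro x x' hx
  have e : wordPrefix (k + 1) x = wordPrefix (k + 1) x' := funext fun i => hx i i.2
  simp only [letterKernel, e]

/-- The kernels on letters satisfy the hypotheses of the limit theorem for cyclic words. -/
theorem exists_isKernelSeq [Finite ι] [Nontrivial ι] {h : KernelFamily ι} (H0 : h.IsSymm)
    (H1 : h.IsBounded) (H2 : h.IsLocal) (H3 : h.HasExpDecay) :
    ∃ C β, IsKernelSeq Letter.density (letterKernel h) C β := by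
  obtain ⟨C₁, h1⟩ := H1
  obtain ⟨C₂, β, hβ0, hβ1, h3⟩ := H3
  -- `C₂ * β`, since the kernels are indexed from `0` here
  set C := max 0 (max C₁ (C₂ * β)) with hC
  refine ⟨C, β, hβ0, hβ1, fun k x y => ?_, fun k x y => ?_, dependsOn_letterKernel h, ?_⟩
  · rw [letterKernel, letterKernel, wordKernel, wordKernel]
    by_cases H : IsReducedWord (wordPrefix (k + 1) x) ∧ IsReducedWord (wordPrefix (k + 1) y)
    · rw [dif_pos H, dif_pos H.symm]
      exact H0 _ (by omega) _ _
    · rw [dif_neg H, dif_neg fun H' => H H'.symm]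
  · rw [letterKernel, wordKernel]
    split_ifs with H
    · exact (h1 _ (by omega) _ _).trans ((le_max_left _ _).trans (le_max_right _ _))
    · rw [abs_zero]; exact le_max_left _ _
  · intro n _ k i hk hi hin
    obtain ⟨N, rfl⟩ : ∃ N, n = N + 1 := ⟨n - 1, by omega⟩
    have e := integral_joinableUniform (ι := ι) (N := N) fun w =>
      |letterKernel h k (win w 0) (win w (i : ZMod (N + 1)))|
    refine (le_of_eq e.symm).trans ?_
    have b := h3 (N + 1) (k + 1) i (by omega) hk hi hin
    have e2 : ∀ α : JoinableString ι (N + 1),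
        |letterKernel h k (win α.word 0) (win α.word (i : ZMod (N + 1)))| =
        |h (k + 1) α.toSeq (JoinableString.shift^[i] α).toSeq| := fun α => by
      have := H2.shift_eq (k := k) (by omega) α 0 i
      rw [Nat.cast_zero] at this
      rw [← this]
      rfl
    simp only [e2]
    refine b.trans ?_
    rw [pow_succ, mul_comm (β ^ k), ← mul_assoc]
    exact mul_le_mul_of_nonneg_right ((le_max_right _ _).trans (le_max_right _ _))
      (pow_pos hβ0 k).le

end LetterKernel

/-! ### Hoeffding projections on reduced sequences -/

section Hoeffding

attribute [local instance] Letter.fintype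

variable {ι : Type*} [Finite ι] [Nontrivial ι] {h : KernelFamily ι}

omit [Finite ι] [Nontrivial ι] in
theorem InfString.val_shift_iterate (x : InfString ι) (i : ℕ) :
    (InfString.shift^[i] x).1 = seqShift i x.1 := by
  induction i generalizing x with
  | zero => funext j; simp [seqShift]
  | succ i ih =>
    rw [Function.iterate_succ_apply, ih]
    funext j
    exact congrArg x.1 (by omega)

theorem KernelFamily.IsLocal.hoeffding_eq (H2 : h.IsLocal) (k : ℕ) (x : InfString ι) :
    h.hoeffding (k + 1) x = proj (letterKernel h) (chainMeasure ι) k x.1 := by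
  simp only [KernelFamily.hoeffding, H2.infinite_eq]
  exact measurePreserving_val.integral_comp measurableEmbedding_val (letterKernel h k x.1)

theorem integral_hoeffding (H2 : h.IsLocal) (k : ℕ) :
    ∫ x, h.hoeffding (k + 1) x ∂(markovMeasure ι) =
      projMean (letterKernel h) (chainMeasure ι) k := by
  simp only [H2.hoeffding_eq]
  exact measurePreserving_val.integral_comp measurableEmbedding_val
    (proj (letterKernel h) (chainMeasure ι) k)

variable {C β : ℝ} (hv : IsKernelSeq Letter.density (letterKernel h) C β)
include hv

theorem summable_projMean : Summable (projMean (letterKernel h) (chainMeasure ι)) :=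
  Summable.of_norm_bounded ((summable_geometric_of_lt_one hv.pos.le hv.lt_one).mul_left C)
    fun k => hv.abs_projMean_le Letter.isChainDensity_density isChainLaw_chainMeasure k

theorem ae_summable_hoeffding (H2 : h.IsLocal) :
    ∀ᵐ x ∂(markovMeasure ι), ∀ i, Summable fun k : ℕ =>
      h.hoeffding (k + 1) (InfString.shift^[i] x) := by
  have hs := (hv.isDecayingSeq_proj Letter.isChainDensity_density
    isChainLaw_chainMeasure).ae_summable
  simp only [H2.hoeffding_eq, InfString.val_shift_iterate]
  refine ae_all_iff.2 fun i => ?_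
  have h1 := (measurePreserving_seqShift Letter.isChainDensity_density
    (isChainLaw_chainMeasure (ι := ι)) i).quasiMeasurePreserving.ae hs
  exact measurePreserving_val.quasiMeasurePreserving.ae h1

/-- The sum of all Hoeffding projections is the centred sum plus its mean. -/
theorem ae_hoeffdingSum_eq (H2 : h.IsLocal) {κ : ℝ}
    (hκ : HasSum (projMean (letterKernel h) (chainMeasure ι)) (2 * κ)) :
    ∀ᵐ x ∂(markovMeasure ι), ∀ i, h.hoeffdingSum (InfString.shift^[i] x) =
      fullPart (letterKernel h) (chainMeasure ι) (seqShift i x.1) + 2 * κ := by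
  filter_upwards [ae_summable_hoeffding hv H2] with x hx i
  have hxi := hx i
  rw [KernelFamily.hoeffdingSum, fullPart]
  simp only [H2.hoeffding_eq, InfString.val_shift_iterate, cproj] at hxi ⊢
  rw [hxi.tsum_sub hκ.summable, hκ.tsum_eq]
  ring

theorem memLp_sum_hoeffdingSum (H2 : h.IsLocal) {κ : ℝ}
    (hκ : HasSum (projMean (letterKernel h) (chainMeasure ι)) (2 * κ)) (n : ℕ) :
    MemLp (fun x => ∑ i ∈ Finset.Icc 1 n, h.hoeffdingSum (InfString.shift^[i] x)) 2
      (markovMeasure ι) := by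
  have hF := hv.memLp_fullPart Letter.isChainDensity_density isChainLaw_chainMeasure
  have h1 : ∀ i, MemLp (fun x : InfString ι =>
      fullPart (letterKernel h) (chainMeasure ι) (seqShift i x.1) + 2 * κ) 2 (markovMeasure ι) :=
    fun i => ((hF.comp_measurePreserving (measurePreserving_seqShift
      Letter.isChainDensity_density isChainLaw_chainMeasure i)).comp_measurePreserving
        measurePreserving_val).add (memLp_const _)
  refine (memLp_finsetSum (Finset.Icc 1 n) fun i _ => h1 i).ae_eq ?_
  filter_upwards [ae_hoeffdingSum_eq hv H2 hκ] with x hx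
  simp only [hx]

theorem tendsto_variance_hoeffdingSum (H2 : h.IsLocal) {κ : ℝ}
    (hκ : HasSum (projMean (letterKernel h) (chainMeasure ι)) (2 * κ)) :
    Tendsto (fun n : ℕ => (1 / (n : ℝ)) *
      ∫ x, ((∑ i ∈ Finset.Icc 1 n, h.hoeffdingSum (InfString.shift^[i] x)) - n * (2 * κ)) ^ 2
        ∂(markovMeasure ι)) atTop (𝓝 (asympVar (letterKernel h) (chainMeasure ι))) := by
  refine (hv.tendsto_variance Letter.isChainDensity_density isChainLaw_chainMeasure).congr
    fun n => ?_
  congr 1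
  rw [← measurePreserving_val.integral_comp measurableEmbedding_val]
  refine integral_congr_ae ?_
  filter_upwards [ae_hoeffdingSum_eq hv H2 hκ] with x hx
  simp only [hx, Finset.sum_add_distrib, Finset.sum_const, Nat.card_Icc, Nat.add_sub_cancel,
    nsmul_eq_mul, add_sub_cancel_right]

theorem asympVar_nonneg : 0 ≤ asympVar (letterKernel h) (chainMeasure ι) :=
  ge_of_tendsto' (hv.tendsto_variance Letter.isChainDensity_density isChainLaw_chainMeasure)
    fun n => mul_nonneg (by positivity) (integral_nonneg fun _ => sq_nonneg _)

end Hoeffding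

/-! ### From joinable strings to necklaces -/

section Necklaces

attribute [local instance] Letter.fintype JoinableString.fintype

variable {ι : Type*} [Finite ι]

/-- Necklaces as a finite type. -/
noncomputable local instance Necklace.fintype (n : ℕ) : Fintype (Necklace ι n) :=
  Fintype.ofFinite _

/-- The necklace of a joinable string. -/
def JoinableString.necklace {n : ℕ} (α : JoinableString ι n) : Necklace ι n :=
  Quotient.mk (JoinableString.rotationSetoid ι n) α

/-- Joinable strings with a nontrivial rotational symmetry. -/
def JoinableString.IsPeriodic {n : ℕ} (α : JoinableString ι n) : Prop :=
  ∃ i, 1 ≤ i ∧ i < n ∧ JoinableString.shift^[i] α = α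

omit [Finite ι] in
theorem JoinableString.necklace_eq_iff {n : ℕ} {α γ : JoinableString ι n} :
    α.necklace = γ.necklace ↔ ∃ i, γ = JoinableString.shift^[i] α :=
  ⟨fun h => Quotient.exact h, fun h => Quotient.sound h⟩

omit [Finite ι] in
theorem JoinableString.shift_iterate_mod {n : ℕ} (α : JoinableString ι n) (i : ℕ) :
    JoinableString.shift^[i % n] α = JoinableString.shift^[i] α := by
  conv_rhs => rw [← Nat.mod_add_div i n, Function.iterate_add_apply, Function.iterate_mul,
    Function.iterate_fixed α.shift_iterate_length]

open Classical in
theorem JoinableString.fiber_eq {n : ℕ} [NeZero n] (α : JoinableString ι n) :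
    (Finset.univ.filter fun γ : JoinableString ι n => γ.necklace = α.necklace) =
      (Finset.range n).image fun i => JoinableString.shift^[i] α := by
  ext γ
  rw [Finset.mem_filter_univ, Finset.mem_image, eq_comm, JoinableString.necklace_eq_iff]
  constructor
  · rintro ⟨i, rfl⟩
    exact ⟨i % n, Finset.mem_range.2 (Nat.mod_lt _ (NeZero.pos n)), α.shift_iterate_mod i⟩
  · rintro ⟨i, _, rfl⟩
    exact ⟨i, rfl⟩

open Classical in
/-- A necklace is the class of `n` joinable strings, unless it has a rotational symmetry. -/
theorem JoinableString.abs_sub_card_fiber_le {n : ℕ} [NeZero n] (α : JoinableString ι n) :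
    |(n : ℝ) - (Finset.univ.filter fun γ : JoinableString ι n => γ.necklace = α.necklace).card| ≤
      if α.IsPeriodic then (n : ℝ) else 0 := by
  rw [α.fiber_eq]
  have hle : ((Finset.range n).image fun i => JoinableString.shift^[i] α).card ≤ n :=
    Finset.card_image_le.trans (Finset.card_range n).le
  have hle' : (((Finset.range n).image fun i => JoinableString.shift^[i] α).card : ℝ) ≤ n := by
    exact_mod_cast hle
  split_ifs with h
  · rw [abs_of_nonneg (by linarith)]
    linarith [Nat.cast_nonneg (α := ℝ)
      ((Finset.range n).image fun i => JoinableString.shift^[i] α).card]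
  · rw [Finset.card_image_of_injOn, Finset.card_range, sub_self, abs_zero]
    have key : ∀ i j, i < j → j < n → JoinableString.shift^[i] α ≠ JoinableString.shift^[j] α := by
      intro i j hij hj e
      refine h ⟨j - i, by omega, by omega, ?_⟩
      have e' := congrArg (JoinableString.shift^[n - i]) e
      rw [← Function.iterate_add_apply, ← Function.iterate_add_apply,
        show n - i + i = n by omega, show n - i + j = (j - i) + n by omega,
        Function.iterate_add_apply, α.shift_iterate_length] at e'
      exact e'.symm
    intro i hi j hj e
    have hi' := Finset.mem_range.1 (Finset.mem_coe.1 hi)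
    have hj' := Finset.mem_range.1 (Finset.mem_coe.1 hj)
    rcases lt_trichotomy i j with hij | hij | hij
    · exact absurd e (key i j hij hj')
    · exact hij
    · exact absurd e.symm (key j i hij hi')

open Classical in
/-- Summing over necklaces `n` times and summing over joinable strings differ at most by the
contribution of the periodic strings. -/
theorem norm_sum_necklace_sub_le {n : ℕ} [NeZero n] {V : Type*} [NormedAddCommGroup V]
    [NormedSpace ℝ V] (φ : Necklace ι n → V) (hφ : ∀ x, ‖φ x‖ ≤ 1) :
    ‖(n : ℝ) • ∑ x, φ x - ∑ α : JoinableString ι n, φ α.necklace‖ ≤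
      n * (Finset.univ.filter fun α : JoinableString ι n => α.IsPeriodic).card := by
  have e1 : ∑ α : JoinableString ι n, φ α.necklace = ∑ x : Necklace ι n,
      ((Finset.univ.filter fun γ : JoinableString ι n => γ.necklace = x).card : ℝ) • φ x := by
    rw [← Finset.sum_fiberwise Finset.univ fun α : JoinableString ι n => α.necklace]
    refine Finset.sum_congr rfl fun x _ => ?_
    rw [Finset.sum_congr rfl fun γ hγ => by rw [(Finset.mem_filter.1 hγ).2], Finset.sum_const,
      Nat.cast_smul_eq_nsmul]
  rw [e1, Finset.smul_sum, ← Finset.sum_sub_distrib]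
  have hout : ∀ x : Necklace ι n, JoinableString.necklace (Quotient.out x) = x := fun x =>
    Quotient.out_eq x
  calc ‖∑ x : Necklace ι n, ((n : ℝ) • φ x -
        ((Finset.univ.filter fun γ : JoinableString ι n => γ.necklace = x).card : ℝ) • φ x)‖
      ≤ ∑ x : Necklace ι n, if (Quotient.out x : JoinableString ι n).IsPeriodic then (n : ℝ)
          else 0 := by
        refine (norm_sum_le _ _).trans (Finset.sum_le_sum fun x _ => ?_)
        rw [← sub_smul, norm_smul, Real.norm_eq_abs]
        have := JoinableString.abs_sub_card_fiber_le (Quotient.out x : JoinableString ι n)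
        rw [hout] at this
        exact (mul_le_of_le_one_right (abs_nonneg _) (hφ x)).trans this
    _ = n * (Finset.univ.filter fun x : Necklace ι n =>
          (Quotient.out x : JoinableString ι n).IsPeriodic).card := by
        rw [← Finset.sum_filter, Finset.sum_const, nsmul_eq_mul, mul_comm]
    _ ≤ _ := by
        refine mul_le_mul_of_nonneg_left ?_ (Nat.cast_nonneg n)
        refine Nat.cast_le.2 (Finset.card_le_card_of_injOn Quotient.out ?_ ?_)
        · intro x hx
          simpa using hx
        · intro x _ y _ h
          exact Quotient.out_injective h

open Classical in
/-- Words with a rotational symmetry are determined by their first half. -/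
theorem card_isPeriodic_le (N : ℕ) :
    (Finset.univ.filter fun α : JoinableString ι (N + 1) => α.IsPeriodic).card ≤
      (N + 1) * Fintype.card (Letter ι) ^ ((N + 1) / 2) := by
  set q := (N + 1) / 2 with hq
  have hsub : (Finset.univ.filter fun α : JoinableString ι (N + 1) => α.IsPeriodic) ⊆
      (Finset.Icc 1 q).biUnion fun i => Finset.univ.filter fun α : JoinableString ι (N + 1) =>
        JoinableString.shift^[i] α = α := by
    intro α hα
    obtain ⟨i, hi1, hi2, hi⟩ := (Finset.mem_filter.1 hα).2
    rw [Finset.mem_biUnion]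
    rcases le_or_gt i q with h | h
    · exact ⟨i, Finset.mem_Icc.2 ⟨hi1, h⟩, Finset.mem_filter.2 ⟨Finset.mem_univ _, hi⟩⟩
    · refine ⟨N + 1 - i, Finset.mem_Icc.2 ⟨by omega, by omega⟩,
        Finset.mem_filter.2 ⟨Finset.mem_univ _, ?_⟩⟩
      conv_lhs => rw [← hi]
      rw [← Function.iterate_add_apply, show N + 1 - i + i = N + 1 by omega,
        α.shift_iterate_length]
  refine (Finset.card_le_card hsub).trans (Finset.card_biUnion_le.trans ?_)
  refine (Finset.sum_le_card_nsmul _ _ (Fintype.card (Letter ι) ^ q) fun i hi => ?_).trans ?_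
  · have hi' := Finset.mem_Icc.1 hi
    rw [← Fintype.card_fin q, ← Fintype.card_fun, ← Finset.card_univ]
    refine Finset.card_le_card_of_injOn
      (fun α (j : Fin q) => α.word ((j : ℕ) : ZMod (N + 1))) (fun _ _ => by simp) ?_
    intro α hα γ hγ h
    have per : ∀ {δ : JoinableString ι (N + 1)}, JoinableString.shift^[i] δ = δ →
        ∀ z, δ.word (z + i) = δ.word z := fun {δ} hδ z => by
      conv_rhs => rw [← hδ]
      rw [JoinableString.word_shift_iterate]
    have hα' := per (Finset.mem_filter.1 (Finset.mem_coe.1 hα)).2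
    have hγ' := per (Finset.mem_filter.1 (Finset.mem_coe.1 hγ)).2
    have main : ∀ j : ℕ, α.word (j : ZMod (N + 1)) = γ.word j := by
      intro j
      induction j using Nat.strong_induction_on with
      | _ j ih =>
        rcases lt_or_ge j q with hj | hj
        · exact congrFun h ⟨j, hj⟩
        · obtain ⟨l, rfl⟩ : ∃ l, j = l + i := ⟨j - i, by omega⟩
          rw [Nat.cast_add, hα', hγ', ih l (by omega)]
    have hw : α.word = γ.word := funext fun z => by
      have := main z.val
      rwa [ZMod.natCast_zmod_val] at this
    exact Subtype.ext hw
  · rw [Nat.card_Icc, smul_eq_mul, Nat.add_sub_cancel]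
    exact Nat.mul_le_mul_right _ (by omega)

variable [Nontrivial ι]

/-- Uniform necklaces and uniform joinable strings give nearly the same means. -/
theorem norm_integral_necklaceUniform_sub_le {N : ℕ} (hN : 1 ≤ N) (φ : Necklace ι (N + 1) → ℂ)
    (hφ : ∀ x, ‖φ x‖ ≤ 1) :
    ‖∫ x, φ x ∂(necklaceUniform ι (N + 1)) -
      ∫ α : JoinableString ι (N + 1), φ α.necklace ∂(joinableUniform ι (N + 1))‖ ≤
      16 * ((((N + 1) / 2 : ℕ) : ℝ) + 1) ^ 2 * (4 / 9) ^ ((N + 1) / 2) := by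
  classical
  set P := (Finset.univ.filter fun α : JoinableString ι (N + 1) => α.IsPeriodic).card with hP
  set g : ℝ := (Fintype.card (Letter ι) : ℝ) with hg
  set q := (N + 1) / 2 with hq
  set m : ℝ := (Fintype.card (Necklace ι (N + 1)) : ℝ) with hm
  set j : ℝ := (Fintype.card (JoinableString ι (N + 1)) : ℝ) with hj
  set n : ℝ := ((N + 1 : ℕ) : ℝ) with hn
  have hg3 : 3 ≤ g - 1 := Letter.three_le_card_sub
  have hm0 : 0 < m := Nat.cast_pos.2 Fintype.card_pos
  have hj0 : 0 < j := Nat.cast_pos.2 Fintype.card_pos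
  have hn0 : 0 < n := Nat.cast_pos.2 (Nat.succ_pos N)
  have hq1 : n ≤ 2 * ((q : ℝ) + 1) := by
    rw [hn]; exact_mod_cast (by omega : N + 1 ≤ 2 * (q + 1))
  have hPle : (P : ℝ) ≤ n * g ^ q := by
    have := card_isPeriodic_le (ι := ι) N
    rw [hn, hg]
    exact_mod_cast this
  -- since `g ≤ (4 / 9) (g - 1) ^ 2` for `g ≥ 4`, symmetric words are rare
  have hgq : g ^ q ≤ (4 / 9) ^ q * (g - 1) ^ (N + 1) := by
    have h1 : g ≤ 4 / 9 * (g - 1) ^ 2 := by nlinarith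
    refine (pow_le_pow_left₀ (by linarith) h1 q).trans ?_
    rw [mul_pow, ← pow_mul]
    exact mul_le_mul_of_nonneg_left (pow_le_pow_right₀ (by linarith) (by omega)) (by positivity)
  have hjle : 1 / 2 * (g - 1) ^ (N + 1) ≤ j := half_mul_pow_le_card_joinableString hN
  have d1 := norm_sum_necklace_sub_le φ hφ
  have d2 := norm_sum_necklace_sub_le (n := N + 1) (ι := ι) (fun _ => (1 : ℝ)) fun _ => by simp
  simp only [Finset.sum_const, Finset.card_univ, nsmul_eq_mul, mul_one, smul_eq_mul] at d2
  rw [Real.norm_eq_abs] at d2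
  rw [necklaceUniform, joinableUniform, integral_uniformOn_univ, integral_uniformOn_univ]
  set a := avg φ with ha
  set b := avg fun α : JoinableString ι (N + 1) => φ α.necklace with hb
  have ha1 : ‖a‖ ≤ 1 := (norm_avg_le φ).trans ((avg_mono hφ).trans (avg_const _).le)
  have sa : ∑ x, φ x = m • a := by rw [ha, avg, smul_smul, mul_inv_cancel₀ hm0.ne', one_smul]
  have sb : ∑ α : JoinableString ι (N + 1), φ α.necklace = j • b := by
    rw [hb, avg, smul_smul, mul_inv_cancel₀ hj0.ne', one_smul]
  rw [sa, sb, smul_smul] at d1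
  -- both `n m - j` and the difference of the sums are at most `n P`
  have key : j * ‖a - b‖ ≤ 2 * (n * P) := by
    have e : j • (a - b) = ((n * m) • a - j • b) - (n * m - j) • a := by
      rw [smul_sub, sub_smul]; abel
    rw [← abs_of_pos hj0, ← Real.norm_eq_abs j, ← norm_smul, e]
    refine (norm_sub_le _ _).trans ?_
    rw [norm_smul, Real.norm_eq_abs, two_mul]
    exact add_le_add d1 ((mul_le_of_le_one_right (abs_nonneg _) ha1).trans d2)
  have fin : 2 * (n * P) ≤ j * (16 * ((q : ℝ) + 1) ^ 2 * (4 / 9) ^ q) := by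
    calc 2 * (n * P) ≤ 2 * (n * (n * ((4 / 9) ^ q * (g - 1) ^ (N + 1)))) := by
          gcongr
          exact hPle.trans (mul_le_mul_of_nonneg_left hgq hn0.le)
      _ = 4 * n ^ 2 * (4 / 9) ^ q * (1 / 2 * (g - 1) ^ (N + 1)) := by ring
      _ ≤ 4 * n ^ 2 * (4 / 9) ^ q * j := by gcongr
      _ ≤ 4 * (2 * ((q : ℝ) + 1)) ^ 2 * (4 / 9) ^ q * j := by gcongr
      _ = _ := by ring
  exact le_of_mul_le_mul_left (key.trans fin) hj0

end Necklaces

section Main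

attribute [local instance] Letter.fintype

variable {ι : Type*} [Finite ι] [Nontrivial ι] {h : KernelFamily ι}

theorem tendsto_charFun_necklace (H0 : h.IsSymm) (H2 : h.IsLocal) {C β κ : ℝ}
    (hv : IsKernelSeq Letter.density (letterKernel h) C β)
    (hκ : HasSum (projMean (letterKernel h) (chainMeasure ι)) (2 * κ)) (t : ℝ) :
    Tendsto (fun N : ℕ => ∫ x, Complex.exp (Complex.I * ((t *
      ((h.necklaceCount H0 x - ((N + 1 : ℕ) : ℝ) ^ 2 * κ) / ((N + 1 : ℕ) : ℝ) ^ (3 / 2 : ℝ)) : ℝ) :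
        ℂ)) ∂(necklaceUniform ι (N + 1))) atTop
      (𝓝 (Complex.exp ((-(asympVar (letterKernel h) (chainMeasure ι) * t ^ 2 / 2) : ℝ) : ℂ))) := by
  have main := hv.tendsto_cycMean_cexp_kernelCount Letter.isChainDensity_density
    isChainLaw_chainMeasure hκ t
  have hq : Tendsto (fun N : ℕ => (N + 1) / 2) atTop atTop :=
    tendsto_atTop.2 fun K => (eventually_ge_atTop (2 * K)).mono fun N hN => by omega
  have lim : Tendsto (fun N : ℕ => 16 * ((((N + 1) / 2 : ℕ) : ℝ) + 1) ^ 2 *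
      (4 / 9) ^ ((N + 1) / 2)) atTop (𝓝 0) := by
    have := ((tendsto_succ_pow_mul_pow 2 (r := 4 / 9) (by norm_num) (by norm_num)).const_mul
      16).comp hq
    rw [mul_zero] at this
    refine this.congr fun N => ?_
    simp only [Function.comp_apply]
    ring
  refine main.congr_dist (squeeze_zero' (Eventually.of_forall fun _ => dist_nonneg) ?_ lim)
  filter_upwards [eventually_ge_atTop 1] with N hN
  rw [← integral_joinableUniform, dist_comm, dist_eq_norm]
  simp only [← H2.joinableCount_eq]
  exact norm_integral_necklaceUniform_sub_le hN _ fun _ => (norm_cexp_I _).le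

end Main

theorem mainTheorem2 {ι : Type*} [Finite ι] [Nontrivial ι] (h : KernelFamily ι)
    (H0 : h.IsSymm) (H1 : h.IsBounded) (H2 : h.IsLocal) (H3 : h.HasExpDecay) :
    ∃ (κ : ℝ) (σ2 : ℝ≥0),
      HasSum (fun k : ℕ => ∫ x, h.hoeffding (k + 1) x ∂(markovMeasure ι)) (2 * κ) ∧
      (∀ᵐ x ∂(markovMeasure ι), Summable fun k : ℕ => h.hoeffding (k + 1) x) ∧
      (∀ n : ℕ, MemLp (fun x => ∑ i ∈ Finset.Icc 1 n, h.hoeffdingSum (InfString.shift^[i] x)) 2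
        (markovMeasure ι)) ∧
      Tendsto (fun n : ℕ => (1 / (n : ℝ)) *
        ∫ x, ((∑ i ∈ Finset.Icc 1 n, h.hoeffdingSum (InfString.shift^[i] x)) - n * (2 * κ)) ^ 2
          ∂(markovMeasure ι)) atTop (𝓝 (σ2 : ℝ)) ∧
      TendstoInDistribution
        (fun (n : ℕ) (α : Necklace ι n) =>
          (h.necklaceCount H0 α - (n : ℝ) ^ 2 * κ) / (n : ℝ) ^ (3 / 2 : ℝ))
        atTop (fun x : ℝ => x) (necklaceUniform ι) (gaussianReal 0 σ2) := by
  obtain ⟨C, β, hv⟩ := exists_isKernelSeq H0 H1 H2 H3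
  set ν := chainMeasure ι with hν
  set κ := (∑' k, projMean (letterKernel h) ν k) / 2 with hκd
  have hκ : HasSum (projMean (letterKernel h) ν) (2 * κ) := by
    rw [hκd, mul_div_cancel₀ _ two_ne_zero]
    exact (summable_projMean hv).hasSum
  set σ2 : ℝ≥0 := ⟨asympVar (letterKernel h) ν, asympVar_nonneg hv⟩
  refine ⟨κ, σ2, ?_, ?_, memLp_sum_hoeffdingSum hv H2 hκ,
    tendsto_variance_hoeffdingSum hv H2 hκ, ?_⟩
  · simpa only [integral_hoeffding H2] using hκ
  · filter_upwards [ae_summable_hoeffding hv H2] with x hx using hx 0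
  · refine ⟨fun n => (measurable_of_countable _).aemeasurable, measurable_id.aemeasurable, ?_⟩
    refine (tendsto_add_atTop_iff_nat 1).1
      (ProbabilityMeasure.tendsto_iff_tendsto_charFun.2 fun t => ?_)
    convert tendsto_charFun_necklace H0 H2 hv hκ t using 2 with N
    · rw [charFun_apply_real]
      simp only [ProbabilityMeasure.coe_mk]
      rw [integral_map (measurable_of_countable _).aemeasurable (by fun_prop)]
      refine integral_congr_ae (ae_of_all _ fun x => ?_)
      simp only
      push_cast
      ring_nf
    · simp only [ProbabilityMeasure.coe_mk]
      rw [Measure.map_id', charFun_gaussianReal]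
      simp [show (σ2 : ℝ) = asympVar (letterKernel h) (chainMeasure ι) from rfl]
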